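/- Let $\ell\ge 0$, let $\alpha_1<\beta_1<\alpha_2<\beta_2<\cdots<\alpha_{\ell+1}<\beta_{\ell+1}$ be real numbers, and put $\mathfrak e=\bigcup_{j=1}^{\ell+1}[\alpha_j,\beta_j]$. Let $\mathbb D$ be the open unit disk and let $x:\mathbb D\to(\mathbb C\setminus\mathfrak e)\cup\{\infty\}$ be the holomorphic universal covering map normalized by $x(0)=\infty$ and $\lim_{z\to0}z\,x(z)>0$. Let $\mathbb F$ be the connected component containing $0$ of $x^{-1}\bigl[(\mathbb C\setminus[\alpha_1,\beta_{\ell+1}])\cup\{\infty\}\bigr]$, and let $\overline{\mathbb F}$ be its closure in $\mathbb C$. The boundary of $\mathbb F$ inside $\mathbb D$ consists of arcs of $2\ell$ circles orthogonal to $\partial\mathbb D$: $C_1^+,\dots,C_\ell^+$ in the upper half-plane and their complex conjugates $C_1^-,\dots,C_\ell^-$. Let $\gamma_j^\pm$ be complex conjugation followed by inversion in $C_j^\pm$, so that $(\gamma_j^+)^{-1}=\gamma_j^-$; these maps generate the Fuchsian group $\Gamma$ of the covering map $x$. Let $\Gamma^{(k)}$ be the set of elements of $\Gamma$ given by words of length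 $k$ in the $\gamma_j^\pm$ in which no $\gamma_j^+$ is next to $\gamma_j^-$ with the same $j$ (so $\Gamma^{(0)}=\{\mathrm{id}\}$), and put $$\mathcal R_m=\partial\mathbb D\setminus\bigcup_{k<m}\ \bigcup_{\gamma\in\Gamma^{(k)}}\gamma[\,\overline{\mathbb F}\,].$$ Let $|\cdot|$ be Lebesgue (arc length) measure on $\partial\mathbb D$. Then there exist constants $A>0$ and $C$ such that, for all integers $m\ge0$, $$|\mathcal R_m|\le C e^{-Am}.$$ -/

import Mathlib

open Set Filter Topology MeasureTheory

noncomputable section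

namespace FiniteGap

/-- The open unit disk. -/
def disk : Set ℂ := Metric.ball 0 1

/-- The unit circle, the boundary of the disk. -/
def unitCircle : Set ℂ := Metric.sphere 0 1

/-- The union of the closed real intervals `[α j, β j]`. -/
def bands {ℓ : ℕ} (α β : Fin (ℓ + 1) → ℝ) : Set ℝ := ⋃ j, Icc (α j) (β j)

/-- For `S ⊆ ℝ`, the set `(ℂ \ S) ∪ {∞}` in the Riemann sphere. -/
def sphereCompl (S : Set ℝ) : Set (OnePoint ℂ) :=
  ((fun t : ℝ => ((t : ℂ) : OnePoint ℂ)) '' S)ᶜ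

/-- The finite value of a point of the Riemann sphere (with `0` as the value at `∞`). -/
def finiteValue (w : OnePoint ℂ) : ℂ := w.elim 0 id

open Classical in
/-- `x` is holomorphic on `U` as a map to the Riemann sphere: near every point of `U` it is
a holomorphic function, or the reciprocal of a holomorphic function vanishing at the point. -/
def HolomorphicToSphereOn (x : ℂ → OnePoint ℂ) (U : Set ℂ) : Prop :=
  ∀ z₀ ∈ U,
    (∃ f : ℂ → ℂ, AnalyticAt ℂ f z₀ ∧ ∀ᶠ z in 𝓝 z₀, x z = (f z : OnePoint ℂ)) ∨
    (∃ g : ℂ → ℂ, AnalyticAt ℂ g z₀ ∧ g z₀ = 0 ∧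
      ∀ᶠ z in 𝓝 z₀, x z = if g z = 0 then OnePoint.infty else (((g z)⁻¹ : ℂ) : OnePoint ℂ))

/-- `x` restricted to the disk is a holomorphic covering map of the disk onto `(ℂ \ S) ∪ {∞}`
(the universal covering, as the disk is simply connected), normalized by `x 0 = ∞` and
`lim_{z → 0} z x(z) > 0`. Values of `x` outside the disk play no role. -/
structure IsNormalizedCovering (S : Set ℝ) (x : ℂ → OnePoint ℂ) : Prop where
  holomorphic : HolomorphicToSphereOn x disk
  surjOn : SurjOn x disk (sphereCompl S)
  covering : ∃ h : MapsTo x disk (sphereCompl S), IsCoveringMap (h.restrict x disk (sphereCompl S))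
  map_zero : x 0 = OnePoint.infty
  residue_pos : ∃ r : ℝ, 0 < r ∧
    Tendsto (fun z : ℂ => z * finiteValue (x z)) (𝓝[≠] 0) (𝓝 (r : ℂ))

/-- The fundamental domain: the connected component containing `0` of the part of the disk
that `x` maps to `(ℂ \ [a, b]) ∪ {∞}`; here `[a, b]` is the convex hull of the bands. -/
def fundamentalDomain (a b : ℝ) (x : ℂ → OnePoint ℂ) : Set ℂ :=
  connectedComponentIn (disk ∩ x ⁻¹' sphereCompl (Icc a b)) 0

/-- The radius of the circle with center `c` (`1 < ‖c‖`) that is orthogonal to the unit circle. -/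
def orthoRadius (c : ℂ) : ℝ := √(‖c‖ ^ 2 - 1)

/-- The circle with center `c` that is orthogonal to the unit circle. -/
def orthoCircle (c : ℂ) : Set ℂ := Metric.sphere c (orthoRadius c)

/-- The centers of the circles orthogonal to the unit circle that bound `F` inside the disk. -/
def boundaryCenters (F : Set ℂ) : Set ℂ :=
  {c | 1 < ‖c‖ ∧ orthoCircle c ∩ disk ⊆ frontier F}

/-- The generator attached to the orthogonal circle with center `c`: complex conjugation
followed by inversion in that circle. -/
def generator (c : ℂ) (z : ℂ) : ℂ :=
  EuclideanGeometry.inversion c (orthoRadius c) (starRingEnd ℂ z)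

/-- The map `generator c₁ ∘ ⋯ ∘ generator cₖ` of a word `[c₁, …, cₖ]`. -/
def wordMap (w : List ℂ) : ℂ → ℂ := w.foldr (fun c f => generator c ∘ f) id

/-- The maps given by the reduced words of length `k` in the generators attached to the circles
bounding `F`. The circles with centers `c` and `conj c` give mutually inverse generators,
so these two are never adjacent in a reduced word. -/
def reducedWords (F : Set ℂ) (k : ℕ) : Set (ℂ → ℂ) :=
  {γ | ∃ w : List ℂ, w.length = k ∧ (∀ c ∈ w, c ∈ boundaryCenters F) ∧
    w.IsChain (fun c d => d ≠ starRingEnd ℂ c) ∧ γ = wordMap w}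

/-- The part of the unit circle not covered by the images of the closure of `F` under the
reduced words of length less than `m`. -/
def remainder (F : Set ℂ) (m : ℕ) : Set ℂ :=
  unitCircle \ ⋃ k < m, ⋃ γ ∈ reducedWords F k, γ '' closure F

/-- Lebesgue (arc length) measure on the unit circle, as a measure on `ℂ`. -/
def arcLength : Measure ℂ :=
  (volume.restrict (Ioc 0 (2 * Real.pi))).map (circleMap 0 1)

end FiniteGap

end

open Set Filter Topology MeasureTheory

noncomputable section

namespace FiniteGap

open ComplexConjugate EuclideanGeometry Metric
open scoped ENNReal

/-! ### Inversions in circles orthogonal to the unit circle -/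

/-! The coordinate `1 / (w - b)`, with `b` the right end of the last band, sends `∞` to `0` and
turns `x` into a holomorphic covering `ξ` of the complement of a closed real set `E ⊆ (-∞, lam]`,
where `lam < 0`, `ξ 0 = 0` and `ξ' 0 > 0`. The domain `F` becomes the component of `0` over the
plane slit along `(-∞, lam]`. The argument then has a geometric half and a metric half.

Geometry. By the Schwarz lemma, a lift of complex conjugation that fixes a point over a gap is the
inversion in a circle orthogonal to the unit circle (`exists_isReflection`), and the boundary of `F`
in the disk is made of full arcs of such circles. In the Klein model the region outside these
circles is convex, hence connected, so it lies in `F` (`outside_subset`). Since `F` is a single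
sheet over the slit plane, each gap carries at most two sides, one approached from each half-plane;
so the sides are finite in number. Their closed disks are pairwise disjoint (`schottkyFamily`). Two
sides cannot cross, because a lift is determined by one value. They cannot be nested, because `F`
lies outside every disk. They cannot be tangent on the unit circle: two geodesics with a common
endpoint come arbitrarily close in the hyperbolic metric, whereas `1 / (1 + √h)` with `h = (w - a')
/ (w - b')`, for a suitable band `[a', b']`, is a bounded holomorphic function whose values on
different gaps stay apart. Sides over one gap are complex conjugates, so a common endpoint of theirs
would be `1` or `-1`; these are excluded in the same way, by comparing a side with the real
diameter.

Metric. A reduced word that may be followed by the generator of `c` is the identity or has its pole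
in a disk other than that of `c`, so it distorts the arc of `c` by a factor bounded independently of
the word (`exists_distortion`). The generator of `c` maps the part of the circle outside all disks,
which has positive measure because it contains a neighbourhood of `1`, into the arc of `c` and away
from the arcs of the next level. Bounded distortion turns this loss into a fixed proportion at every
step (`exists_contraction`), and the points that survive `n` steps lie in nested arcs of total
measure `O(q ^ n)` with `q < 1`. One-dimensional Hausdorff measure stands in for arc length, since
it is controlled by Lipschitz bounds alone. -/

lemma orthoRadius_pos {c : ℂ} (hc : 1 < ‖c‖) : 0 < orthoRadius c :=
  Real.sqrt_pos.2 (by nlinarith)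

lemma orthoRadius_sq {c : ℂ} (hc : 1 < ‖c‖) : orthoRadius c ^ 2 = ‖c‖ ^ 2 - 1 :=
  Real.sq_sqrt (by nlinarith)

lemma orthoRadius_conj (c : ℂ) : orthoRadius (conj c) = orthoRadius c := by
  simp [orthoRadius]

lemma mem_unitCircle {z : ℂ} : z ∈ unitCircle ↔ ‖z‖ = 1 := by simp [unitCircle]

lemma mem_disk {z : ℂ} : z ∈ disk ↔ ‖z‖ < 1 := by simp [disk]

lemma dist_conj_left (z w : ℂ) : dist (conj z) w = dist z (conj w) := by
  rw [← Complex.dist_conj_conj, Complex.conj_conj]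

lemma inversion_eq (c : ℂ) (r : ℝ) (z : ℂ) : inversion c r z = c + r ^ 2 / conj (z - c) := by
  rcases eq_or_ne z c with rfl | h
  · simp
  have h' : z - c ≠ 0 := sub_ne_zero.2 h
  have h2 : conj (z - c) ≠ 0 := (map_ne_zero _).2 h'
  rw [inversion, dist_eq_norm]
  simp only [vsub_eq_sub, vadd_eq_add, Complex.real_smul]
  rw [add_comm]
  congr 1
  have : (((r / ‖z - c‖) ^ 2 : ℝ) : ℂ) = r ^ 2 / ((z - c) * conj (z - c)) := by
    rw [Complex.mul_conj, Complex.normSq_eq_norm_sq]; push_cast; ring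
  rw [this]
  field_simp

lemma conj_inversion (c : ℂ) (r : ℝ) (z : ℂ) :
    conj (inversion c r z) = inversion (conj c) r (conj z) := by
  simp [inversion_eq]

lemma generator_conj_generator {c : ℂ} (hc : 1 < ‖c‖) (z : ℂ) :
    generator (conj c) (generator c z) = z := by
  rw [generator, generator, orthoRadius_conj, conj_inversion, Complex.conj_conj,
    inversion_inversion _ (orthoRadius_pos hc).ne']

lemma generator_generator_conj {c : ℂ} (hc : 1 < ‖c‖) (z : ℂ) :
    generator c (generator (conj c) z) = z := by
  have := generator_conj_generator (c := conj c) (by simpa using hc) z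
  rwa [Complex.conj_conj] at this

lemma dist_generator_center (c z : ℂ) :
    dist (generator c z) c = orthoRadius c ^ 2 / dist z (conj c) := by
  rw [generator, dist_inversion_center, dist_conj_left]

lemma dist_generator_generator {c z w : ℂ} (hz : z ≠ conj c) (hw : w ≠ conj c) :
    dist (generator c z) (generator c w) =
      orthoRadius c ^ 2 / (dist z (conj c) * dist w (conj c)) * dist z w := by
  rw [generator, generator, dist_inversion_inversion, dist_conj_left, dist_conj_left,
    Complex.dist_conj_conj]
  · rintro rfl; simp at hz
  · rintro rfl; simp at hw

lemma ne_of_mem_unitCircle {c z : ℂ} (hc : 1 < ‖c‖) (hz : z ∈ unitCircle) : z ≠ conj c := by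
  rintro rfl
  rw [mem_unitCircle, Complex.norm_conj] at hz
  linarith

/-- The correction term has the sign of `‖z‖ ^ 2 - 1`, which is why the inversion preserves both the
unit circle and the disk. -/
lemma norm_inversion_sq {c : ℂ} (hc : 1 < ‖c‖) {z : ℂ} (hz : z ≠ c) :
    ‖inversion c (orthoRadius c) z‖ ^ 2 = 1 +
      orthoRadius c ^ 2 * (‖z‖ ^ 2 - 1) / ‖z - c‖ ^ 2 := by
  have h : z - c ≠ 0 := sub_ne_zero.2 hz
  have h' : conj z - conj c ≠ 0 := by rw [← map_sub]; exact (map_ne_zero _).2 h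
  have hn : ‖z - c‖ ≠ 0 := by simpa using h
  have key : inversion c (orthoRadius c) z = (c * conj z - 1) / conj (z - c) := by
    rw [inversion_eq]
    have : ((orthoRadius c : ℝ) : ℂ) ^ 2 = c * conj c - 1 := by
      rw [← Complex.ofReal_pow, orthoRadius_sq hc, Complex.mul_conj, Complex.normSq_eq_norm_sq]
      push_cast; ring
    rw [this, map_sub]
    field_simp
    ring
  rw [key, norm_div, Complex.norm_conj, div_pow, orthoRadius_sq hc]
  field_simp
  simp only [← Complex.normSq_eq_norm_sq, Complex.normSq_apply]
  simp
  ring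

lemma inversion_mem_unitCircle {c z : ℂ} (hc : 1 < ‖c‖) (hz : z ∈ unitCircle) :
    inversion c (orthoRadius c) z ∈ unitCircle := by
  rw [mem_unitCircle] at *
  have h := norm_inversion_sq hc (z := z) (by rintro rfl; linarith)
  rw [hz] at h
  have : ‖inversion c (orthoRadius c) z‖ ^ 2 = 1 := by rw [h]; simp
  nlinarith [norm_nonneg (inversion c (orthoRadius c) z)]

lemma inversion_mem_disk {c z : ℂ} (hc : 1 < ‖c‖) (hz : z ∈ disk) :
    inversion c (orthoRadius c) z ∈ disk := by
  rw [mem_disk] at *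
  have hne : z ≠ c := by rintro rfl; linarith
  have h := norm_inversion_sq hc hne
  have h1 : 0 < ‖z - c‖ := by simpa [sub_eq_zero] using hne
  have h2 := orthoRadius_pos hc
  have : orthoRadius c ^ 2 * (‖z‖ ^ 2 - 1) / ‖z - c‖ ^ 2 < 0 :=
    div_neg_of_neg_of_pos (mul_neg_of_pos_of_neg (by positivity)
      (by nlinarith [norm_nonneg z])) (by positivity)
  nlinarith [norm_nonneg (inversion c (orthoRadius c) z)]

lemma generator_mem_unitCircle {c z : ℂ} (hc : 1 < ‖c‖) (hz : z ∈ unitCircle) :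
    generator c z ∈ unitCircle :=
  inversion_mem_unitCircle hc (by simpa [mem_unitCircle] using hz)

lemma generator_mem_ball {c z : ℂ} (hc : 1 < ‖c‖)
    (hz : z ∉ closedBall (conj c) (orthoRadius c)) :
    generator c z ∈ ball c (orthoRadius c) := by
  have hr := orthoRadius_pos hc
  rw [mem_closedBall, not_le] at hz
  rw [mem_ball, dist_generator_center, div_lt_iff₀ (by linarith)]
  nlinarith

lemma generator_notMem_closedBall {c z : ℂ} (hc : 1 < ‖c‖) (hzc : z ≠ conj c)
    (hz : z ∈ ball (conj c) (orthoRadius c)) :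
    generator c z ∉ closedBall c (orthoRadius c) := by
  have hr := orthoRadius_pos hc
  have hd : 0 < dist z (conj c) := dist_pos.2 hzc
  rw [mem_ball] at hz
  rw [mem_closedBall, not_le, dist_generator_center, lt_div_iff₀ hd]
  nlinarith

/-! ### Bounded distortion of words -/

/-- The open arc of the unit circle cut off by the orthogonal circle with center `c`. -/
def arc (c : ℂ) : Set ℂ := unitCircle ∩ ball c (orthoRadius c)

/-- `γ` acts on the unit circle like a Möbius map with pole `p`. -/
def HasPole (γ : ℂ → ℂ) (p : ℂ) (ρ : ℝ) : Prop :=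
  ∀ z ∈ unitCircle, ∀ w ∈ unitCircle,
    dist (γ z) (γ w) * (dist z p * dist w p) = ρ * dist z w

lemma hasPole_generator {c : ℂ} (hc : 1 < ‖c‖) :
    HasPole (generator c) (conj c) (orthoRadius c ^ 2) := by
  intro z hz w hw
  have h1 := ne_of_mem_unitCircle hc hz
  have h2 := ne_of_mem_unitCircle hc hw
  rw [dist_generator_generator h1 h2]
  have := dist_pos.2 h1
  have := dist_pos.2 h2
  field_simp

/-- The new pole is the preimage of `p` under the generator. By `key`, the distance to `p` after the
generator, times the distance to the generator's own pole, is a constant multiple of the distance to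
the new pole, so the two formulas multiply. -/
lemma HasPole.comp_generator {γ : ℂ → ℂ} {p : ℂ} {ρ : ℝ} (h : HasPole γ p ρ) {c : ℂ}
    (hc : 1 < ‖c‖) (hp : p ≠ c) :
    HasPole (γ ∘ generator c) (generator (conj c) p)
      (ρ * orthoRadius c ^ 2 / dist p c ^ 2) := by
  have hpc := dist_pos.2 hp
  have hr := orthoRadius_pos hc
  have key : ∀ z ∈ unitCircle,
      dist (generator c z) p * dist z (conj c) = dist p c * dist z (generator (conj c) p) := by
    intro z hz
    have hz' := ne_of_mem_unitCircle hc hz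
    have hq : dist (generator (conj c) p) (conj c) = orthoRadius c ^ 2 / dist p c := by
      rw [dist_generator_center, orthoRadius_conj, Complex.conj_conj]
    have hq' : generator (conj c) p ≠ conj c := by
      rw [← dist_pos, hq]; positivity
    have := dist_generator_generator (c := c) hz' hq'
    rw [generator_generator_conj hc, hq] at this
    rw [this]
    have := dist_pos.2 hz'
    field_simp
  intro z hz w hw
  have h1 := h _ (generator_mem_unitCircle hc hz) _ (generator_mem_unitCircle hc hw)
  have h2 := hasPole_generator hc z hz w hw
  have kz := key z hz
  have kw := key w hw
  have pz := dist_pos.2 (ne_of_mem_unitCircle hc hz)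
  have pw := dist_pos.2 (ne_of_mem_unitCircle hc hw)
  simp only [Function.comp_apply]
  set q := generator (conj c) p
  have e1 : dist z q = dist (generator c z) p * dist z (conj c) / dist p c := by
    rw [kz]; field_simp
  have e2 : dist w q = dist (generator c w) p * dist w (conj c) / dist p c := by
    rw [kw]; field_simp
  rw [e1, e2]
  calc _ = (dist (γ (generator c z)) (γ (generator c w)) *
        (dist (generator c z) p * dist (generator c w) p)) *
        (dist z (conj c) * dist w (conj c)) / dist p c ^ 2 := by field_simp
    _ = ρ * (dist (generator c z) (generator c w) *
        (dist z (conj c) * dist w (conj c))) / dist p c ^ 2 := by rw [h1]; ring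
    _ = _ := by rw [h2]; ring

/-- `γ` is a map given by a word in the generators attached to `B` that may be followed by the
generator attached to `c`: it is the identity, or its pole lies in the disk of a circle other
than that of `c`. -/
def Admissible (B : Set ℂ) (γ : ℂ → ℂ) (c : ℂ) : Prop :=
  γ = id ∨ ∃ e ∈ B, e ≠ c ∧ ∃ p ∈ closedBall e (orthoRadius e), ∃ ρ > 0, HasPole γ p ρ

/-- A family of centers of pairwise disjoint disks orthogonal to the unit circle, closed under
complex conjugation. -/
structure SchottkyFamily (B : Set ℂ) : Prop where
  finite : B.Finite
  one_lt : ∀ c ∈ B, 1 < ‖c‖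
  conj_mem : ∀ c ∈ B, conj c ∈ B
  separated : ∀ c ∈ B, ∀ d ∈ B, c ≠ d → orthoRadius c + orthoRadius d < dist c d

lemma SchottkyFamily.disjoint {B : Set ℂ} (hB : SchottkyFamily B) {c d : ℂ} (hc : c ∈ B)
    (hd : d ∈ B) (h : c ≠ d) :
    Disjoint (closedBall c (orthoRadius c)) (closedBall d (orthoRadius d)) :=
  closedBall_disjoint_closedBall (hB.separated c hc d hd h)

/-- The pole `p` lies outside the closed disk of `c`, and the inverse generator sends that outside
into the disk of `conj c`, which is not the disk of `d`. -/
lemma Admissible.comp_generator {B : Set ℂ} (hB : SchottkyFamily B) {γ : ℂ → ℂ} {c d : ℂ}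
    (h : Admissible B γ c) (hc : c ∈ B) (hd : d ≠ conj c) :
    Admissible B (γ ∘ generator c) d := by
  have hc1 := hB.one_lt c hc
  have hr := orthoRadius_pos hc1
  right
  refine ⟨conj c, hB.conj_mem c hc, hd.symm, ?_⟩
  rw [orthoRadius_conj]
  rcases h with rfl | ⟨e, he, hec, p, hp, ρ, hρ, hpole⟩
  · exact ⟨conj c, mem_closedBall_self hr.le, _, by positivity, hasPole_generator hc1⟩
  · have hpc : p ∉ closedBall c (orthoRadius c) :=
      fun h => (hB.disjoint he hc hec).le_bot ⟨hp, h⟩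
    have hpc' : p ≠ c := by rintro rfl; exact hpc (mem_closedBall_self hr.le)
    have := dist_pos.2 hpc'
    refine ⟨generator (conj c) p, ball_subset_closedBall ?_, _, by positivity,
      hpole.comp_generator hc1 hpc'⟩
    have := generator_mem_ball (c := conj c) (z := p) (by simpa using hc1)
      (by rwa [Complex.conj_conj, orthoRadius_conj])
    rwa [orthoRadius_conj] at this

lemma exists_pos_forall_le_of_finite {ι : Type*} {s : Set ι} (hs : s.Finite) (f : ι → ℝ)
    (h : ∀ i ∈ s, 0 < f i) : ∃ δ > 0, ∀ i ∈ s, δ ≤ f i := by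
  have h1 : ∀ᶠ δ : ℝ in 𝓝[>] 0, ∀ i ∈ s, δ ≤ f i :=
    (eventually_all_finite hs).2 fun i hi =>
      nhdsWithin_le_nhds ((eventually_lt_nhds (h i hi)).mono fun _ => le_of_lt)
  obtain ⟨δ, hδ, h0⟩ := (h1.and self_mem_nhdsWithin).exists
  exact ⟨δ, h0, hδ⟩

/-- Whatever the word, its pole stays at a distance between `δ`, a lower bound for the gaps between
the disks, and `|M| + 1` from the arc. The chord formula of `HasPole` therefore varies by a factor
of at most `((|M| + 1) / δ) ^ 2`; the added `1` gives `K ≥ 1`, as the identity needs. -/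
lemma exists_distortion {B : Set ℂ} (hB : SchottkyFamily B) :
    ∃ K : ℝ, 0 < K ∧ ∀ (γ : ℂ → ℂ), ∀ c ∈ B, Admissible B γ c →
      ∃ L : ℝ, 0 < L ∧ ∀ z ∈ arc c, ∀ w ∈ arc c,
        L * dist z w ≤ dist (γ z) (γ w) ∧ dist (γ z) (γ w) ≤ K * L * dist z w := by
  obtain ⟨δ, hδ, hδB⟩ := exists_pos_forall_le_of_finite
    (s := {q : ℂ × ℂ | q ∈ B ×ˢ B ∧ q.1 ≠ q.2})
    ((hB.finite.prod hB.finite).subset fun q hq => hq.1)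
    (fun q => dist q.1 q.2 - orthoRadius q.1 - orthoRadius q.2)
    (fun q hq => by have := hB.separated q.1 hq.1.1 q.2 hq.1.2 hq.2; linarith)
  obtain ⟨M, hM⟩ := (hB.finite.image fun e => ‖e‖ + orthoRadius e).bddAbove
  replace hM : ∀ e ∈ B, ‖e‖ + orthoRadius e ≤ M := fun e he => hM ⟨e, he, rfl⟩
  have hK : 0 < ((|M| + 1) / δ) ^ 2 + 1 := by positivity
  refine ⟨((|M| + 1) / δ) ^ 2 + 1, hK, fun γ c hc hγ => ?_⟩
  rcases hγ with rfl | ⟨e, he, hec, p, hp, ρ, hρ, hpole⟩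
  · refine ⟨1, one_pos, fun z _ w _ => ?_⟩
    have := dist_nonneg (x := z) (y := w)
    simp only [id]
    constructor
    · linarith
    · nlinarith [sq_nonneg ((|M| + 1) / δ)]
  · have hb : ∀ z ∈ arc c, δ ≤ dist z p ∧ dist z p ≤ |M| + 1 := by
      intro z hz
      have h1 := hδB (c, e) ⟨⟨hc, he⟩, hec.symm⟩
      have h2 := mem_ball.1 hz.2
      have h3 := mem_closedBall.1 hp
      have h4 := mem_unitCircle.1 hz.1
      simp only at h1
      constructor
      · have := dist_triangle4 c z p e
        rw [dist_comm c z] at this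
        linarith
      · have t1 := dist_triangle z 0 p
        have t2 := dist_triangle 0 e p
        rw [dist_comm e p] at t2
        rw [dist_zero_right, h4] at t1
        rw [dist_zero_left e] at t2
        linarith [hM e he, le_abs_self M]
    refine ⟨ρ / (|M| + 1) ^ 2, by positivity,
      fun z hz w hw => ?_⟩
    obtain ⟨hz1, hz2⟩ := hb z hz
    obtain ⟨hw1, hw2⟩ := hb w hw
    have h := hpole z hz.1 w hw.1
    have hz0 : 0 < dist z p := by linarith
    have hw0 : 0 < dist w p := by linarith
    have hd := dist_nonneg (x := z) (y := w)
    have hg := dist_nonneg (x := γ z) (y := γ w)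
    have e1 : dist (γ z) (γ w) = ρ * dist z w / (dist z p * dist w p) := by
      rw [← h]; field_simp
    have b1 : dist z p * dist w p ≤ (|M| + 1) ^ 2 := by
      rw [sq]; exact mul_le_mul hz2 hw2 hw0.le (by positivity)
    have b2 : δ ^ 2 ≤ dist z p * dist w p := by
      rw [sq]; exact mul_le_mul hz1 hw1 hδ.le hz0.le
    rw [e1]
    constructor
    · rw [div_mul_eq_mul_div]
      exact div_le_div_of_nonneg_left (by positivity) (by positivity) b1
    · calc ρ * dist z w / (dist z p * dist w p) ≤ ρ * dist z w / δ ^ 2 :=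
            div_le_div_of_nonneg_left (by positivity) (by positivity) b2
        _ = ((|M| + 1) / δ) ^ 2 * (ρ / (|M| + 1) ^ 2) * dist z w := by
            have : |M| + 1 ≠ 0 := by positivity
            field_simp
        _ ≤ _ := by gcongr; linarith

/-! ### Arc length and one-dimensional Hausdorff measure -/

lemma hausdorffMeasure_image_le_ofReal {X Y : Type*} [MetricSpace X] [MeasurableSpace X]
    [BorelSpace X] [MetricSpace Y] [MeasurableSpace Y] [BorelSpace Y] {f : X → Y} {s : Set X}
    {K : ℝ} (h : ∀ x ∈ s, ∀ y ∈ s, dist (f x) (f y) ≤ K * dist x y) :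
    μH[1] (f '' s) ≤ ENNReal.ofReal K * μH[1] s := by
  have : LipschitzOnWith K.toNNReal f s := LipschitzOnWith.of_dist_le_mul fun x hx y hy =>
    (h x hx y hy).trans (by gcongr; exact Real.le_coe_toNNReal K)
  simpa [ENNReal.ofReal] using this.hausdorffMeasure_image_le zero_le_one

lemma hausdorffMeasure_le_ofReal_image {X Y : Type*} [MetricSpace X] [MeasurableSpace X]
    [BorelSpace X] [MetricSpace Y] [MeasurableSpace Y] [BorelSpace Y] {f : X → Y} {s : Set X}
    {K : ℝ} (h : ∀ x ∈ s, ∀ y ∈ s, dist x y ≤ K * dist (f x) (f y)) :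
    μH[1] s ≤ ENNReal.ofReal K * μH[1] (f '' s) := by
  rcases s.eq_empty_or_nonempty with rfl | ⟨x₀, hx₀⟩
  · simp
  have : Nonempty X := ⟨x₀⟩
  have hinj : InjOn f s := fun x hx y hy hxy => by
    have := h x hx y hy
    rw [hxy, dist_self, mul_zero] at this
    exact dist_le_zero.1 this
  have hs : Function.invFunOn f s '' (f '' s) = s := hinj.invFunOn_image Subset.rfl
  conv_lhs => rw [← hs]
  refine hausdorffMeasure_image_le_ofReal ?_
  rintro _ ⟨x, hx, rfl⟩ _ ⟨y, hy, rfl⟩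
  rw [hinj.leftInvOn_invFunOn hx, hinj.leftInvOn_invFunOn hy]
  exact h x hx y hy

lemma dist_circleMap_le (s t : ℝ) : dist (circleMap 0 1 s) (circleMap 0 1 t) ≤ 1 * dist s t := by
  have := (lipschitzWith_circleMap 0 1).dist_le_mul s t
  simpa using this

/-- The chord is `2 |sin ((s - t) / 2)|`, and Jordan's inequality applies because the half-angle is
at most `π / 2`. -/
lemma dist_le_dist_circleMap {s t : ℝ} (h : |s - t| ≤ Real.pi) :
    dist s t ≤ Real.pi / 2 * dist (circleMap 0 1 s) (circleMap 0 1 t) := by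
  have key : dist (circleMap 0 1 s) (circleMap 0 1 t) = 2 * |Real.sin ((s - t) / 2)| := by
    have h1 : dist (circleMap 0 1 s) (circleMap 0 1 t) ^ 2 = (2 * |Real.sin ((s - t) / 2)|) ^ 2 := by
      rw [mul_pow, sq_abs, Real.sin_sq_eq_half_sub, Complex.dist_eq, ← Complex.normSq_eq_norm_sq,
        Complex.normSq_apply]
      simp only [circleMap, zero_add, Complex.ofReal_one, one_mul, Complex.sub_re, Complex.sub_im,
        Complex.exp_ofReal_mul_I_re, Complex.exp_ofReal_mul_I_im]
      rw [mul_div_cancel₀ _ two_ne_zero, Real.cos_sub]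
      nlinarith [Real.sin_sq_add_cos_sq s, Real.sin_sq_add_cos_sq t]
    exact (pow_left_inj₀ dist_nonneg (by positivity) two_ne_zero).1 h1
  have h2 : 2 / Real.pi * |(s - t) / 2| ≤ |Real.sin ((s - t) / 2)| :=
    Real.mul_abs_le_abs_sin (by rw [abs_div, abs_two]; linarith)
  rw [key, Real.dist_eq]
  rw [abs_div, abs_two] at h2
  have := Real.pi_pos
  calc |s - t| = Real.pi * (2 / Real.pi * (|s - t| / 2)) := by field_simp
    _ ≤ Real.pi * |Real.sin ((s - t) / 2)| := by gcongr
    _ = _ := by ring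

lemma volume_le_hausdorffMeasure_image {T : Set ℝ} {a : ℝ} (hT : T ⊆ Icc a (a + Real.pi)) :
    volume T ≤ ENNReal.ofReal (Real.pi / 2) * μH[1] (circleMap 0 1 '' T) := by
  rw [← hausdorffMeasure_real]
  refine hausdorffMeasure_le_ofReal_image fun s hs t ht => dist_le_dist_circleMap ?_
  have h1 := hT hs
  have h2 := hT ht
  rw [abs_le]
  constructor <;> linarith [h1.1, h1.2, h2.1, h2.2]

/-- `S` is arbitrary, so it is first replaced by a measurable hull for `μH[1]`. Each half of the
circle then contributes a factor `π / 2`. -/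
lemma arcLength_le (S : Set ℂ) : arcLength S ≤ ENNReal.ofReal Real.pi * μH[1] S := by
  have hm : Measurable (circleMap 0 1) := (continuous_circleMap 0 1).measurable
  refine (measure_mono (subset_toMeasurable μH[1] S)).trans ?_
  rw [← measure_toMeasurable (μ := μH[1]) S]
  set S' := toMeasurable μH[1] S
  have hS' : MeasurableSet S' := measurableSet_toMeasurable _ _
  rw [arcLength, Measure.map_apply hm hS', Measure.restrict_apply (hm hS')]
  have hsub : circleMap 0 1 ⁻¹' S' ∩ Ioc 0 (2 * Real.pi) ⊆
      (circleMap 0 1 ⁻¹' S' ∩ Icc 0 (0 + Real.pi)) ∪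
        (circleMap 0 1 ⁻¹' S' ∩ Icc Real.pi (Real.pi + Real.pi)) := by
    rintro t ⟨ht, ht1, ht2⟩
    rcases le_total t Real.pi with h | h
    · exact Or.inl ⟨ht, ht1.le, by linarith⟩
    · exact Or.inr ⟨ht, h, by linarith⟩
  have himg : ∀ U : Set ℝ, circleMap 0 1 '' (circleMap 0 1 ⁻¹' S' ∩ U) ⊆ S' := by
    rintro U _ ⟨t, ht, rfl⟩; exact ht.1
  calc _ ≤ _ := measure_mono hsub
    _ ≤ _ := measure_union_le _ _
    _ ≤ ENNReal.ofReal (Real.pi / 2) * μH[1] S' + ENNReal.ofReal (Real.pi / 2) * μH[1] S' := by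
      gcongr
      · exact (volume_le_hausdorffMeasure_image inter_subset_right).trans
          (by gcongr; exact himg _)
      · exact (volume_le_hausdorffMeasure_image inter_subset_right).trans
          (by gcongr; exact himg _)
    _ = _ := by
      rw [← add_mul, ← ENNReal.ofReal_add (by positivity) (by positivity), add_halves]

lemma hausdorffMeasure_unitCircle_le : μH[1] unitCircle ≤ ENNReal.ofReal (2 * Real.pi) := by
  have h : circleMap 0 1 '' Ioc 0 (2 * Real.pi) = unitCircle := by
    rw [image_circleMap_Ioc]; simp [unitCircle]
  rw [← h]
  refine (hausdorffMeasure_image_le_ofReal fun s _ t _ => dist_circleMap_le s t).trans ?_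
  rw [hausdorffMeasure_real]
  simp

lemma hausdorffMeasure_inter_unitCircle_pos {U : Set ℂ} (hU : IsOpen U) (h1 : (1 : ℂ) ∈ U) :
    0 < μH[1] (U ∩ unitCircle) := by
  have ho : IsOpen (circleMap 0 1 ⁻¹' U) := hU.preimage (continuous_circleMap 0 1)
  have h0 : (0 : ℝ) ∈ circleMap 0 1 ⁻¹' U := by simpa [circleMap] using h1
  have hT : 0 < volume (circleMap 0 1 ⁻¹' U ∩ Ioo (-1) 1) :=
    (ho.inter isOpen_Ioo).measure_pos _ ⟨0, h0, by norm_num⟩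
  have hle := volume_le_hausdorffMeasure_image (T := circleMap 0 1 ⁻¹' U ∩ Ioo (-1) 1) (a := -1)
    (fun t ht => ⟨ht.2.1.le, by linarith [ht.2.2, Real.pi_gt_three]⟩)
  refine pos_iff_ne_zero.2 fun h => hT.ne' (le_zero_iff.1 (hle.trans ?_))
  rw [measure_mono_null _ h, mul_zero]
  rintro _ ⟨t, ht, rfl⟩
  exact ⟨ht.1, circleMap_mem_sphere 0 zero_le_one t⟩

/-! ### Exponential decay of the remainders -/

lemma disjoint_image_of_injOn {X Y : Type*} {f : X → Y} {s t u : Set X} (hf : InjOn f s)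
    (ht : t ⊆ s) (hu : u ⊆ s) (h : Disjoint t u) : Disjoint (f '' t) (f '' u) := by
  rw [disjoint_iff_inter_eq_empty] at *
  rw [← hf.image_inter ht hu, h, image_empty]

lemma hausdorffMeasure_ne_top {S : Set ℂ} (hS : S ⊆ unitCircle) : μH[1] S ≠ ∞ :=
  ((measure_mono hS).trans_lt (hausdorffMeasure_unitCircle_le.trans_lt ENNReal.ofReal_lt_top)).ne

lemma arc_subset (c : ℂ) : arc c ⊆ unitCircle := inter_subset_left

lemma measurableSet_arc (c : ℂ) : MeasurableSet (arc c) :=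
  isClosed_sphere.measurableSet.inter isOpen_ball.measurableSet

/-- The part of the arc of `c` reached by the reduced words of length `n + 1` that begin with the
generator of `c`. -/
def nestedArc (B : Set ℂ) : ℕ → ℂ → Set ℂ
  | 0, c => arc c
  | n + 1, c => generator c '' ⋃ d ∈ B \ {conj c}, nestedArc B n d

/-- The part of the unit circle outside all closed disks of the family `B`. -/
def freePart (B : Set ℂ) : Set ℂ := (⋃ c ∈ B, closedBall c (orthoRadius c))ᶜ ∩ unitCircle

section

variable {B : Set ℂ} (hB : SchottkyFamily B)
include hB

lemma SchottkyFamily.isOpen_compl : IsOpen (⋃ c ∈ B, closedBall c (orthoRadius c))ᶜ :=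
  (hB.finite.isClosed_biUnion fun _ _ => isClosed_closedBall).isOpen_compl

lemma SchottkyFamily.generator_arc_subset {c d : ℂ} (hc : c ∈ B) (hd : d ∈ B \ {conj c}) :
    generator c '' arc d ⊆ arc c := by
  rintro _ ⟨z, hz, rfl⟩
  refine ⟨generator_mem_unitCircle (hB.one_lt c hc) hz.1,
    generator_mem_ball (hB.one_lt c hc) fun h => ?_⟩
  rw [← orthoRadius_conj] at h
  exact (hB.disjoint hd.1 (hB.conj_mem c hc) hd.2).le_bot ⟨ball_subset_closedBall hz.2, h⟩

lemma SchottkyFamily.generator_freePart_subset {c : ℂ} (hc : c ∈ B) :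
    generator c '' freePart B ⊆ arc c := by
  rintro _ ⟨z, hz, rfl⟩
  refine ⟨generator_mem_unitCircle (hB.one_lt c hc) hz.2,
    generator_mem_ball (hB.one_lt c hc) fun h => hz.1 ?_⟩
  rw [← orthoRadius_conj] at h
  exact mem_biUnion (hB.conj_mem c hc) h

lemma SchottkyFamily.generator_injective {c : ℂ} (hc : c ∈ B) :
    Function.Injective (generator c) :=
  Function.LeftInverse.injective (generator_conj_generator (hB.one_lt c hc))

lemma SchottkyFamily.continuousOn_generator {c : ℂ} (hc : c ∈ B) :
    ContinuousOn (generator c) unitCircle := by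
  unfold generator
  refine ContinuousOn.inversion continuousOn_const continuousOn_const
    Complex.continuous_conj.continuousOn fun z hz h => ?_
  exact ne_of_mem_unitCircle (hB.one_lt c hc) hz (by rw [← h, Complex.conj_conj])

/-- A neighbourhood of `1` on the circle is free of the disks, and on the circle the generator
contracts chords by a bounded factor only, since the distance to its pole is bounded. -/
lemma SchottkyFamily.hausdorffMeasure_generator_freePart_pos
    (h1 : ∀ c ∈ B, (1 : ℂ) ∉ closedBall c (orthoRadius c)) {c : ℂ} (hc : c ∈ B) :
    0 < μH[1] (generator c '' freePart B) := by
  have hc1 := hB.one_lt c hc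
  have hr := orthoRadius_pos hc1
  have h0 : 0 < μH[1] (freePart B) :=
    hausdorffMeasure_inter_unitCircle_pos hB.isOpen_compl (by simpa using h1)
  have hle : μH[1] (freePart B) ≤ ENNReal.ofReal ((1 + ‖c‖) ^ 2 / orthoRadius c ^ 2) *
      μH[1] (generator c '' freePart B) := by
    refine hausdorffMeasure_le_ofReal_image fun z hz w hw => ?_
    have h := hasPole_generator hc1 z hz.2 w hw.2
    have hb : ∀ z ∈ unitCircle, dist z (conj c) ≤ 1 + ‖c‖ := fun z hz => by
      rw [← mem_unitCircle.1 hz, dist_eq_norm, ← Complex.norm_conj c]; exact norm_sub_le _ _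
    calc dist z w = dist (generator c z) (generator c w) *
          (dist z (conj c) * dist w (conj c)) / orthoRadius c ^ 2 := by rw [h]; field_simp
      _ ≤ dist (generator c z) (generator c w) * ((1 + ‖c‖) * (1 + ‖c‖)) / orthoRadius c ^ 2 := by
          gcongr
          · exact hb z hz.2
          · exact hb w hw.2
      _ = _ := by ring
  refine pos_iff_ne_zero.2 fun h => h0.ne' (le_zero_iff.1 (hle.trans ?_))
  rw [h, mul_zero]

/-- Each step removes at least a fixed fraction of every arc. -/
lemma SchottkyFamily.exists_contraction
    (h1 : ∀ c ∈ B, (1 : ℂ) ∉ closedBall c (orthoRadius c)) :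
    ∃ q : ℝ, 0 < q ∧ q < 1 ∧ ∀ γ, ∀ c ∈ B, Admissible B γ c →
      ∑ d ∈ hB.finite.toFinset.erase (conj c), μH[1] ((γ ∘ generator c) '' arc d) ≤
        ENNReal.ofReal q * μH[1] (γ '' arc c) := by
  obtain ⟨K, hK, hKB⟩ := exists_distortion hB
  have hgfin : ∀ c ∈ B, μH[1] (generator c '' freePart B) ≠ ∞ := fun c hc =>
    hausdorffMeasure_ne_top ((hB.generator_freePart_subset hc).trans (arc_subset c))
  obtain ⟨δ, hδ, hδB⟩ := exists_pos_forall_le_of_finite hB.finite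
    (fun c => (μH[1] (generator c '' freePart B)).toReal)
    (fun c hc => ENNReal.toReal_pos (hB.hausdorffMeasure_generator_freePart_pos h1 hc).ne'
      (hgfin c hc))
  have hπ := Real.pi_pos
  -- Every removed piece has measure at least `δ`, and an arc has measure at most `2π`; after
  -- distortion by `K` the removed proportion is still at least `δ / (K * 2π)`. The minimum with `1
  -- / 2` keeps `1 - η` positive.
  set η : ℝ := min (1 / 2) (δ / (K * (2 * Real.pi))) with hη
  have hη0 : 0 < η := lt_min (by norm_num) (by positivity)
  have hη1 : η ≤ 1 / 2 := min_le_left _ _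
  have hη2 : η * (K * (2 * Real.pi)) ≤ δ :=
    (le_div_iff₀ (by positivity)).1 (min_le_right (1 / 2) (δ / (K * (2 * Real.pi))))
  refine ⟨1 - η, by linarith, by linarith, fun γ c hc hγ => ?_⟩
  obtain ⟨L, hL, hLγ⟩ := hKB γ c hc hγ
  have hupper : μH[1] (γ '' arc c) ≤ ENNReal.ofReal (K * L) * μH[1] (arc c) :=
    hausdorffMeasure_image_le_ofReal fun z hz w hw => (hLγ z hz w hw).2
  have hfin : μH[1] (γ '' arc c) ≠ ∞ :=
    (hupper.trans_lt (ENNReal.mul_lt_top ENNReal.ofReal_lt_top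
      (hausdorffMeasure_ne_top (arc_subset c)).lt_top)).ne
  have hgap : ENNReal.ofReal η * μH[1] (γ '' arc c) ≤
      μH[1] ((γ ∘ generator c) '' freePart B) := by
    have hlow : μH[1] (generator c '' freePart B) ≤
        ENNReal.ofReal (1 / L) * μH[1] (γ '' (generator c '' freePart B)) :=
      hausdorffMeasure_le_ofReal_image fun z hz w hw => by
        have := (hLγ z (hB.generator_freePart_subset hc hz) w
          (hB.generator_freePart_subset hc hw)).1
        rw [one_div, inv_mul_eq_div, le_div_iff₀ hL]
        linarith
    have hδ' : ENNReal.ofReal δ ≤ μH[1] (generator c '' freePart B) :=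
      ENNReal.ofReal_le_of_le_toReal (hδB c hc)
    calc ENNReal.ofReal η * μH[1] (γ '' arc c)
        ≤ ENNReal.ofReal η * (ENNReal.ofReal (K * L) * ENNReal.ofReal (2 * Real.pi)) := by
          gcongr
          refine hupper.trans ?_
          gcongr
          exact (measure_mono (arc_subset c)).trans hausdorffMeasure_unitCircle_le
      _ = ENNReal.ofReal (L * (η * (K * (2 * Real.pi)))) := by
          rw [← ENNReal.ofReal_mul (by positivity), ← ENNReal.ofReal_mul hη0.le]
          ring_nf
      _ ≤ ENNReal.ofReal (L * δ) := by gcongr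
      _ = ENNReal.ofReal L * ENNReal.ofReal δ := ENNReal.ofReal_mul hL.le
      _ ≤ ENNReal.ofReal L *
          (ENNReal.ofReal (1 / L) * μH[1] (γ '' (generator c '' freePart B))) := by
          gcongr; exact hδ'.trans hlow
      _ = μH[1] ((γ ∘ generator c) '' freePart B) := by
          rw [← mul_assoc, ← ENNReal.ofReal_mul hL.le, mul_one_div_cancel hL.ne',
            ENNReal.ofReal_one, one_mul, image_comp]
  have hγinj : InjOn γ (arc c) := fun x hx y hy hxy => by
    have := (hLγ x hx y hy).1
    rw [hxy, dist_self] at this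
    exact dist_le_zero.1 (by nlinarith [dist_nonneg (x := x) (y := y)])
  have hγcont : ContinuousOn γ (arc c) := by
    have : LipschitzOnWith (K * L).toNNReal γ (arc c) :=
      LipschitzOnWith.of_dist_le_mul fun x hx y hy =>
        ((hLγ x hx y hy).2).trans (by gcongr; exact Real.le_coe_toNNReal _)
    exact this.continuousOn
  have hmaps : ∀ d ∈ B \ {conj c}, MapsTo (generator c) (arc d) (arc c) := fun d hd =>
    mapsTo_iff_image_subset.2 (hB.generator_arc_subset hc hd)
  have hmem : ∀ d, d ∈ hB.finite.toFinset.erase (conj c) ↔ d ∈ B \ {conj c} := fun d => by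
    simp [and_comm]
  have hmeas : ∀ d ∈ B \ {conj c}, MeasurableSet ((γ ∘ generator c) '' arc d) := fun d hd =>
    (measurableSet_arc d).image_of_continuousOn_injOn
      (hγcont.comp ((hB.continuousOn_generator hc).mono (arc_subset d)) (hmaps d hd))
      (hγinj.comp (hB.generator_injective hc).injOn (hmaps d hd))
  have hginj : InjOn (γ ∘ generator c) (generator c ⁻¹' arc c) :=
    hγinj.comp (hB.generator_injective hc).injOn (mapsTo_preimage _ _)
  have hfree : freePart B ⊆ generator c ⁻¹' arc c :=
    image_subset_iff.1 (hB.generator_freePart_subset hc)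
  have hdisj : Disjoint ((γ ∘ generator c) '' freePart B)
      (⋃ d ∈ hB.finite.toFinset.erase (conj c), (γ ∘ generator c) '' arc d) := by
    simp only [disjoint_iUnion_right, hmem]
    intro d hd
    refine disjoint_image_of_injOn hginj hfree (hmaps d hd) (disjoint_left.2 fun z hz hzd => hz.1 ?_)
    exact mem_biUnion hd.1 (ball_subset_closedBall hzd.2)
  have hsum : ∑ d ∈ hB.finite.toFinset.erase (conj c), μH[1] ((γ ∘ generator c) '' arc d) =
      μH[1] (⋃ d ∈ hB.finite.toFinset.erase (conj c), (γ ∘ generator c) '' arc d) := by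
    refine (measure_biUnion_finset ?_ fun d hd => hmeas d ((hmem d).1 hd)).symm
    intro d hd e he hde
    have hd' := (hmem d).1 hd
    have he' := (hmem e).1 he
    refine disjoint_image_of_injOn hginj (hmaps d hd') (hmaps e he') ?_
    exact (hB.disjoint hd'.1 he'.1 hde).mono
      (inter_subset_right.trans ball_subset_closedBall)
      (inter_subset_right.trans ball_subset_closedBall)
  have htot : ENNReal.ofReal η * μH[1] (γ '' arc c) +
      μH[1] (⋃ d ∈ hB.finite.toFinset.erase (conj c), (γ ∘ generator c) '' arc d) ≤
      μH[1] (γ '' arc c) := by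
    refine (add_le_add_left hgap _).trans ?_
    rw [← measure_union hdisj (Finset.measurableSet_biUnion _ fun d hd => hmeas d ((hmem d).1 hd))]
    refine measure_mono (union_subset ?_ (iUnion₂_subset fun d hd => ?_))
    · rw [image_comp]; exact image_mono (hB.generator_freePart_subset hc)
    · rw [image_comp]; exact image_mono (hB.generator_arc_subset hc ((hmem d).1 hd))
  rw [hsum, ENNReal.ofReal_sub _ hη0.le, ENNReal.ofReal_one,
    ENNReal.sub_mul (fun _ _ => hfin), one_mul]
  exact ENNReal.le_sub_of_add_le_left (ENNReal.mul_ne_top ENNReal.ofReal_ne_top hfin) htot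

/-- The induction runs over all admissible `γ` at once: the first letter of the nested word is
absorbed by passing from `γ` to `γ ∘ generator c`. -/
lemma SchottkyFamily.hausdorffMeasure_nestedArc_le {q : ℝ} (hq : 0 < q)
    (h : ∀ γ, ∀ c ∈ B, Admissible B γ c →
      ∑ d ∈ hB.finite.toFinset.erase (conj c), μH[1] ((γ ∘ generator c) '' arc d) ≤
        ENNReal.ofReal q * μH[1] (γ '' arc c)) (n : ℕ) :
    ∀ γ, ∀ c ∈ B, Admissible B γ c →
      μH[1] (γ '' nestedArc B n c) ≤ ENNReal.ofReal (q ^ n) * μH[1] (γ '' arc c) := by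
  induction n with
  | zero => intro γ c _ _; simp [nestedArc]
  | succ n ih =>
    intro γ c hc hγ
    have hset : γ '' nestedArc B (n + 1) c =
        ⋃ d ∈ hB.finite.toFinset.erase (conj c), (γ ∘ generator c) '' nestedArc B n d := by
      rw [nestedArc, ← image_comp, image_iUnion₂]
      ext z
      simp [and_comm]
    rw [hset]
    calc _ ≤ ∑ d ∈ hB.finite.toFinset.erase (conj c),
          μH[1] ((γ ∘ generator c) '' nestedArc B n d) := measure_biUnion_finset_le _ _
      _ ≤ ∑ d ∈ hB.finite.toFinset.erase (conj c),
          ENNReal.ofReal (q ^ n) * μH[1] ((γ ∘ generator c) '' arc d) := by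
          refine Finset.sum_le_sum fun d hd => ?_
          rw [Finset.mem_erase, Finite.mem_toFinset] at hd
          exact ih _ d hd.2 (hγ.comp_generator hB hc hd.1)
      _ ≤ ENNReal.ofReal (q ^ n) * (ENNReal.ofReal q * μH[1] (γ '' arc c)) := by
          rw [← Finset.mul_sum]; gcongr; exact h γ c hc hγ
      _ = _ := by
          rw [← mul_assoc, ← ENNReal.ofReal_mul (by positivity), pow_succ]

end

/-- Undo the first letter: `generator (conj c)` moves `z` out of the closed disk of `conj c`. The
image is not in `closure F`, because the word `[c]` is excluded, so it lies in the arc of some `d ≠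
conj c`. Prefixing `c` to a reduced word beginning with `d` keeps it reduced, so the exclusions for
`z` pass to the image. -/
lemma mem_nestedArc {F : Set ℂ} (hB : SchottkyFamily (boundaryCenters F))
    (hF : ∀ z ∈ unitCircle, (∀ c ∈ boundaryCenters F, z ∉ ball c (orthoRadius c)) →
      z ∈ closure F) (n : ℕ) :
    ∀ c ∈ boundaryCenters F, ∀ z ∈ arc c,
      (∀ w : List ℂ, w.length < n → (∀ d ∈ c :: w, d ∈ boundaryCenters F) →
        (c :: w).IsChain (fun c d => d ≠ conj c) → z ∉ wordMap (c :: w) '' closure F) →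
      z ∈ nestedArc (boundaryCenters F) n c := by
  induction n with
  | zero => intro c _ z hz _; exact hz
  | succ n ih =>
    intro c hc z hz hw
    have hc1 := hB.one_lt c hc
    have hc2 : 1 < ‖conj c‖ := by simpa using hc1
    have hcirc := generator_mem_unitCircle hc2 hz.1
    have hback : generator c (generator (conj c) z) = z := generator_generator_conj hc1 z
    have hout : generator (conj c) z ∉ closedBall (conj c) (orthoRadius (conj c)) :=
      generator_notMem_closedBall hc2 (ne_of_mem_unitCircle hc2 hz.1)
        (by rw [Complex.conj_conj, orthoRadius_conj]; exact hz.2)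
    have hncl : generator (conj c) z ∉ closure F := fun h =>
      hw [] (Nat.succ_pos n) (by simpa using hc) (by simp) ⟨_, h, hback⟩
    obtain ⟨d, hd, hzd⟩ : ∃ d ∈ boundaryCenters F,
        generator (conj c) z ∈ ball d (orthoRadius d) := by
      by_contra! hcon
      exact hncl (hF _ hcirc hcon)
    have hdc : d ≠ conj c := by
      rintro rfl
      exact hout (ball_subset_closedBall hzd)
    refine ⟨generator (conj c) z, mem_biUnion (show d ∈ boundaryCenters F \ {conj c} from
      ⟨hd, hdc⟩) (ih d hd _ ⟨hcirc, hzd⟩ ?_), hback⟩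
    rintro w hwn hwB hwc ⟨y, hy, hyz⟩
    refine hw (d :: w) (by simpa using hwn) (by simpa [hc] using hwB)
      (List.isChain_cons_cons.2 ⟨hdc, hwc⟩) ⟨y, hy, ?_⟩
    rw [← hback, ← hyz]
    rfl

lemma remainder_subset {F : Set ℂ} (hB : SchottkyFamily (boundaryCenters F))
    (hF : ∀ z ∈ unitCircle, (∀ c ∈ boundaryCenters F, z ∉ ball c (orthoRadius c)) →
      z ∈ closure F) (n : ℕ) :
    remainder F (n + 1) ⊆ ⋃ c ∈ boundaryCenters F, nestedArc (boundaryCenters F) n c := by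
  rintro z ⟨hz, hzn⟩
  have hword : ∀ w : List ℂ, w.length < n + 1 → (∀ d ∈ w, d ∈ boundaryCenters F) →
      w.IsChain (fun c d => d ≠ conj c) → z ∉ wordMap w '' closure F := by
    intro w hwn hwB hwc h
    exact hzn (mem_biUnion hwn (mem_biUnion (show wordMap w ∈ reducedWords F w.length from
      ⟨w, rfl, hwB, hwc, rfl⟩) h))
  have hncl : z ∉ closure F := fun h => hword [] (by simp) (by simp) (by simp) ⟨z, h, rfl⟩
  obtain ⟨c, hc, hzc⟩ : ∃ c ∈ boundaryCenters F, z ∈ ball c (orthoRadius c) := by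
    by_contra! hcon
    exact hncl (hF z hz hcon)
  exact mem_biUnion hc (mem_nestedArc hB hF n c hc z ⟨hz, hzc⟩ fun w hw hwB hwc =>
    hword (c :: w) (by simpa using hw) hwB hwc)

/-- The remainders decay exponentially, provided that the circles bounding `F` have separated
closed disks and that `closure F` contains the part of the unit circle outside these disks. -/
theorem exists_arcLength_remainder_le {F : Set ℂ} (hB : SchottkyFamily (boundaryCenters F))
    (h1 : ∀ c ∈ boundaryCenters F, (1 : ℂ) ∉ closedBall c (orthoRadius c))
    (hF : ∀ z ∈ unitCircle, (∀ c ∈ boundaryCenters F, z ∉ ball c (orthoRadius c)) →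
      z ∈ closure F) :
    ∃ A C : ℝ, 0 < A ∧ ∀ m : ℕ,
      arcLength (remainder F m) ≤ ENNReal.ofReal (C * Real.exp (-A * m)) := by
  obtain ⟨q, hq0, hq1, hq⟩ := hB.exists_contraction h1
  have hn := hB.hausdorffMeasure_nestedArc_le hq0 hq
  have hπ := Real.pi_pos
  set N : ℝ := (hB.finite.toFinset.card : ℝ) with hN
  have hN0 : 0 ≤ N := Nat.cast_nonneg _
  set P : ℝ := Real.pi * (2 * Real.pi) with hP
  have hP0 : 0 < P := by positivity
  have hexp : ∀ m : ℕ, Real.exp (-(-Real.log q) * m) = q ^ m := fun m => by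
    rw [neg_neg, mul_comm, Real.exp_nat_mul, Real.exp_log hq0]
  -- `N / q` pays for the shift from `q ^ n` to `q ^ (n + 1)`; the `1` covers `m = 0`, where the
  -- whole circle remains.
  refine ⟨-Real.log q, P * (N / q + 1), by linarith [Real.log_neg hq0 hq1], fun m => ?_⟩
  rw [hexp]
  refine (arcLength_le _).trans ?_
  cases m with
  | zero =>
    calc _ ≤ ENNReal.ofReal Real.pi * ENNReal.ofReal (2 * Real.pi) := by
          gcongr
          exact (measure_mono sdiff_subset).trans hausdorffMeasure_unitCircle_le
      _ = ENNReal.ofReal P := (ENNReal.ofReal_mul hπ.le).symm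
      _ ≤ _ := by
          apply ENNReal.ofReal_le_ofReal
          rw [pow_zero, mul_one]
          have : 0 ≤ N / q := by positivity
          nlinarith
  | succ n =>
    have hle : μH[1] (remainder F (n + 1)) ≤ ENNReal.ofReal (N * (q ^ n * (2 * Real.pi))) := by
      calc _ ≤ μH[1] (⋃ c ∈ hB.finite.toFinset, nestedArc (boundaryCenters F) n c) := by
            refine measure_mono ((remainder_subset hB hF n).trans_eq ?_)
            simp
        _ ≤ ∑ c ∈ hB.finite.toFinset, μH[1] (nestedArc (boundaryCenters F) n c) :=
            measure_biUnion_finset_le _ _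
        _ ≤ ∑ c ∈ hB.finite.toFinset, ENNReal.ofReal (q ^ n * (2 * Real.pi)) := by
            refine Finset.sum_le_sum fun c hc => ?_
            have := hn n id c (by simpa using hc) (Or.inl rfl)
            rw [image_id, image_id] at this
            refine this.trans ?_
            rw [ENNReal.ofReal_mul (by positivity)]
            gcongr
            exact (measure_mono (arc_subset c)).trans hausdorffMeasure_unitCircle_le
        _ = _ := by
            rw [Finset.sum_const, nsmul_eq_mul, hN, ENNReal.ofReal_mul (Nat.cast_nonneg _),
              ENNReal.ofReal_natCast]
    calc _ ≤ ENNReal.ofReal Real.pi * ENNReal.ofReal (N * (q ^ n * (2 * Real.pi))) := by gcongr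
      _ = ENNReal.ofReal (Real.pi * (N * (q ^ n * (2 * Real.pi)))) :=
          (ENNReal.ofReal_mul hπ.le).symm
      _ ≤ _ := by
          apply ENNReal.ofReal_le_ofReal
          have : P * (N / q + 1) * q ^ (n + 1) =
              Real.pi * (N * (q ^ n * (2 * Real.pi))) + P * q ^ (n + 1) := by
            rw [hP]; field_simp; ring
          rw [this]
          have : 0 ≤ P * q ^ (n + 1) := by positivity
          linarith

/-! ### Coverings of the complement of a real closed set -/

/-- `ξ` is a holomorphic covering map of the disk onto the complement of the closed set `E` of
real numbers, normalized by `ξ 0 = 0` and `ξ' 0 > 0`. The covering property is recorded through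
the lifting of maps from simply connected spaces and the uniqueness of lifts. -/
structure IsRealCovering (E : Set ℂ) (ξ : ℂ → ℂ) : Prop where
  isClosed : IsClosed E
  im_eq_zero : ∀ e ∈ E, e.im = 0
  differentiableOn : DifferentiableOn ℂ ξ disk
  mapsTo : MapsTo ξ disk Eᶜ
  exists_injOn : ∀ z ∈ disk, ∃ U ∈ 𝓝 z, InjOn ξ U
  exists_lift : ∀ (A : Type) [TopologicalSpace A] [SimplyConnectedSpace A]
    [LocallyPathConnectedSpace A] (f : A → ℂ), Continuous f → (∀ a, f a ∉ E) →
    ∀ a₀, ∀ z₀ ∈ disk, ξ z₀ = f a₀ →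
      ∃ g : A → ℂ, Continuous g ∧ (∀ a, g a ∈ disk) ∧ (∀ a, ξ (g a) = f a) ∧ g a₀ = z₀
  eqOn_lift : ∀ (A : Type) [TopologicalSpace A] (s : Set A), IsPreconnected s →
    ∀ f g : A → ℂ, ContinuousOn f s → ContinuousOn g s → MapsTo f s disk → MapsTo g s disk →
      (∀ a ∈ s, ξ (f a) = ξ (g a)) → ∀ a₀ ∈ s, f a₀ = g a₀ → EqOn f g s
  map_zero : ξ 0 = 0
  exists_deriv_pos : ∃ r : ℝ, 0 < r ∧ HasDerivAt ξ r 0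

lemma isOpen_disk : IsOpen disk := isOpen_ball

lemma isPreconnected_disk : IsPreconnected disk := (convex_ball 0 1).isPreconnected

lemma zero_mem_disk : (0 : ℂ) ∈ disk := by simp [disk]

lemma conj_mem_disk {z : ℂ} (hz : z ∈ disk) : conj z ∈ disk := by simpa [mem_disk] using hz

/-- The inversion in the circle with center `c` orthogonal to the unit circle. -/
def reflection (c : ℂ) : ℂ → ℂ := inversion c (orthoRadius c)

lemma generator_eq (c z : ℂ) : generator c z = c + orthoRadius c ^ 2 / (z - conj c) := by
  rw [generator, inversion_eq]; simp

lemma reflection_eq_generator (c z : ℂ) : reflection c z = generator c (conj z) := by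
  simp [reflection, generator]

lemma conj_reflection (c z : ℂ) : conj (reflection c z) = generator (conj c) z := by
  rw [reflection, conj_inversion, generator, orthoRadius_conj]

lemma reflection_reflection {c : ℂ} (hc : 1 < ‖c‖) (z : ℂ) :
    reflection c (reflection c z) = z :=
  inversion_inversion c (orthoRadius_pos hc).ne' z

lemma reflection_mem_disk {c z : ℂ} (hc : 1 < ‖c‖) (hz : z ∈ disk) : reflection c z ∈ disk :=
  inversion_mem_disk hc hz

lemma generator_mem_disk {c z : ℂ} (hc : 1 < ‖c‖) (hz : z ∈ disk) : generator c z ∈ disk :=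
  inversion_mem_disk hc (conj_mem_disk hz)

lemma ne_of_mem_disk {c z : ℂ} (hc : 1 < ‖c‖) (hz : z ∈ disk) : z ≠ c := by
  rintro rfl; rw [mem_disk] at hz; linarith

lemma differentiableOn_generator {c : ℂ} (hc : 1 < ‖c‖) :
    DifferentiableOn ℂ (generator c) disk := by
  have : generator c = fun z => c + orthoRadius c ^ 2 / (z - conj c) :=
    funext (generator_eq c)
  rw [this]
  refine (differentiableOn_const _).add ((differentiableOn_const _).div
    (differentiableOn_id.sub (differentiableOn_const _)) fun z hz => sub_ne_zero.2 ?_)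
  exact ne_of_mem_disk (by simpa using hc) hz

lemma continuousOn_reflection {c : ℂ} (hc : 1 < ‖c‖) : ContinuousOn (reflection c) disk :=
  ContinuousOn.inversion continuousOn_const continuousOn_const continuousOn_id
    fun _ hz => ne_of_mem_disk hc hz

lemma reflection_zero {c : ℂ} (hc : 1 < ‖c‖) : reflection c 0 = (conj c)⁻¹ := by
  have h0 : conj c ≠ 0 := (map_ne_zero _).2 (by rintro rfl; norm_num at hc)
  rw [reflection, inversion_eq, ← Complex.ofReal_pow, orthoRadius_sq hc, zero_sub, map_neg]
  have : ((‖c‖ ^ 2 - 1 : ℝ) : ℂ) = c * conj c - 1 := by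
    rw [Complex.mul_conj, Complex.normSq_eq_norm_sq]; push_cast; ring
  rw [this]
  field_simp
  ring

lemma reflection_eq_self_iff {c z : ℂ} (hc : 1 < ‖c‖) (hz : z ≠ c) :
    reflection c z = z ↔ z ∈ orthoCircle c := by
  have hr := orthoRadius_pos hc
  constructor
  · intro h
    have h1 := dist_inversion_center c z (orthoRadius c)
    have hd := dist_pos.2 hz
    rw [show inversion c (orthoRadius c) z = z from h, eq_div_iff hd.ne'] at h1
    rw [orthoCircle, Metric.mem_sphere]
    nlinarith
  · exact fun h => inversion_of_mem_sphere h

/-- A holomorphic bijection of the disk fixing the origin is a rotation. -/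
lemma exists_eq_mul_of_leftInverse {f g : ℂ → ℂ} (hf : DifferentiableOn ℂ f disk)
    (hg : DifferentiableOn ℂ g disk) (hfm : MapsTo f disk disk) (hgm : MapsTo g disk disk)
    (hf0 : f 0 = 0) (hg0 : g 0 = 0) (hgf : ∀ z ∈ disk, g (f z) = z) :
    ∃ u : ℂ, ∀ z ∈ disk, f z = u * z := by
  -- The Schwarz lemma for `f` and for `g` gives equality at one nonzero point, here `1 / 2`, and
  -- the equality case makes `f` linear.
  have hhalf : (1 / 2 : ℂ) ∈ disk := by rw [mem_disk]; norm_num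
  have h1 : ‖f (1 / 2)‖ ≤ ‖(1 / 2 : ℂ)‖ := Complex.norm_le_norm_of_mapsTo_ball hf
    (hfm.mono_right ball_subset_closedBall) hf0 (mem_disk.1 hhalf)
  have h2 : ‖g (f (1 / 2))‖ ≤ ‖f (1 / 2)‖ := Complex.norm_le_norm_of_mapsTo_ball hg
    (hgm.mono_right ball_subset_closedBall) hg0 (mem_disk.1 (hfm hhalf))
  rw [hgf _ hhalf] at h2
  have h3 : ‖dslope f 0 (1 / 2)‖ = 1 / 1 := by
    rw [dslope_of_ne _ (by norm_num), slope_def_field, hf0, norm_div, sub_zero, sub_zero,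
      le_antisymm h1 h2]
    norm_num
  have := Complex.affine_of_mapsTo_ball_of_norm_dslope_eq_div hf
    (by rw [hf0]; exact hfm.mono_right ball_subset_closedBall) hhalf h3
  refine ⟨dslope f 0 (1 / 2), fun z hz => ?_⟩
  rw [this hz, hf0]
  simp [mul_comm]

lemma conj_eq_self_of_im {z : ℂ} (h : z.im = 0) : conj z = z := Complex.conj_eq_iff_im.2 h

namespace IsRealCovering

variable {E : Set ℂ} {ξ : ℂ → ℂ} (hξ : IsRealCovering E ξ)
include hξ

lemma conj_notMem {w : ℂ} (hw : w ∉ E) : conj w ∉ E := fun h => hw (by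
  have := conj_eq_self_of_im (hξ.im_eq_zero _ h)
  rw [Complex.conj_conj] at this
  rwa [this])

lemma continuousOn : ContinuousOn ξ disk := hξ.differentiableOn.continuousOn

lemma exists_liftOn {s : Set ℂ} (ho : IsOpen s) {a : ℂ} (ha : a ∈ s) (hs : StarConvex ℝ a s)
    {f : ℂ → ℂ} (hf : ContinuousOn f s) (hfE : MapsTo f s Eᶜ) {a₀ z₀ : ℂ} (ha₀ : a₀ ∈ s)
    (hz₀ : z₀ ∈ disk) (h : ξ z₀ = f a₀) :
    ∃ g : ℂ → ℂ, ContinuousOn g s ∧ MapsTo g s disk ∧ (∀ z ∈ s, ξ (g z) = f z) ∧ g a₀ = z₀ := by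
  have : ContractibleSpace s := hs.contractibleSpace ⟨a, ha⟩
  have : LocallyPathConnectedSpace s := ho.locallyPathConnectedSpace
  obtain ⟨g, hg, hgd, hgξ, hg0⟩ := hξ.exists_lift s (s.domRestrict f)
    (continuousOn_iff_continuous_domRestrict.1 hf) (fun x => hfE x.2) ⟨a₀, ha₀⟩ z₀ hz₀ h
  classical
  set g' : ℂ → ℂ := fun z => if hz : z ∈ s then g ⟨z, hz⟩ else 0
  have hg' : ∀ z (hz : z ∈ s), g' z = g ⟨z, hz⟩ := fun z hz => by simp [g', hz]
  refine ⟨g', ?_, fun z hz => by rw [hg' z hz]; exact hgd _,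
    fun z hz => by rw [hg' z hz]; exact hgξ _, by rw [hg' a₀ ha₀, hg0]⟩
  rw [continuousOn_iff_continuous_domRestrict]
  convert hg using 1
  ext x
  exact hg' x x.2

lemma exists_section {z₀ : ℂ} (hz₀ : z₀ ∈ disk) {ε : ℝ} (hε : 0 < ε)
    (hE : ball (ξ z₀) ε ⊆ Eᶜ) :
    ∃ g : ℂ → ℂ, ContinuousOn g (ball (ξ z₀) ε) ∧ MapsTo g (ball (ξ z₀) ε) disk ∧
      (∀ w ∈ ball (ξ z₀) ε, ξ (g w) = w) ∧ g (ξ z₀) = z₀ :=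
  hξ.exists_liftOn isOpen_ball (mem_ball_self hε)
    ((convex_ball (ξ z₀) ε).starConvex (mem_ball_self hε)) continuousOn_id hE
    (mem_ball_self hε) hz₀ rfl

lemma exists_ball_subset {z₀ : ℂ} (hz₀ : z₀ ∈ disk) : ∃ ε > 0, ball (ξ z₀) ε ⊆ Eᶜ :=
  Metric.isOpen_iff.1 hξ.isClosed.isOpen_compl _ (hξ.mapsTo hz₀)

lemma differentiableAt {z : ℂ} (hz : z ∈ disk) : DifferentiableAt ℂ ξ z :=
  hξ.differentiableOn.differentiableAt (isOpen_disk.mem_nhds hz)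

lemma analyticAt {z : ℂ} (hz : z ∈ disk) : AnalyticAt ℂ ξ z :=
  hξ.differentiableOn.analyticAt (isOpen_disk.mem_nhds hz)

/-- A continuous local section `g` passes through `z₀`. If `ξ'` vanishes at most at `z₀` nearby, `g`
is holomorphic by removable singularities, and the chain rule for `ξ ∘ g = id` excludes a zero. If
`ξ'` vanishes near `z₀`, then `ξ` is locally constant, against local injectivity. -/
lemma deriv_ne_zero {z₀ : ℂ} (hz₀ : z₀ ∈ disk) : deriv ξ z₀ ≠ 0 := by
  obtain ⟨ε, hε, hE⟩ := hξ.exists_ball_subset hz₀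
  obtain ⟨g, hg, hgd, hgξ, hg0⟩ := hξ.exists_section hz₀ hε hE
  have hball : ball (ξ z₀) ε ∈ 𝓝 (ξ z₀) := ball_mem_nhds _ hε
  have hgc : ContinuousAt g (ξ z₀) := hg.continuousAt hball
  have hev : ∀ᶠ w in 𝓝 (ξ z₀), ξ (g w) = w := by
    filter_upwards [hball] with w hw using hgξ w hw
  rcases (hξ.analyticAt hz₀).deriv.eventually_eq_zero_or_eventually_ne_zero with h | h
  · exfalso
    obtain ⟨U, hU, hinj⟩ := hξ.exists_injOn z₀ hz₀
    obtain ⟨δ, hδ, hδU⟩ := Metric.mem_nhds_iff.1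
      (inter_mem (inter_mem h hU) (isOpen_disk.mem_nhds hz₀))
    have hconst : ∀ z ∈ ball z₀ δ, ξ z = ξ z₀ := fun z hz =>
      isOpen_ball.is_const_of_deriv_eq_zero (convex_ball z₀ δ).isPreconnected
        (fun y hy => (hξ.differentiableAt (hδU hy).2).differentiableWithinAt)
        (fun y hy => (hδU hy).1.1) hz (mem_ball_self hδ)
    have hmem : z₀ + (δ / 2 : ℝ) ∈ ball z₀ δ := by
      rw [mem_ball, dist_eq_norm, add_sub_cancel_left, Complex.norm_real, Real.norm_eq_abs,
        abs_of_pos (by positivity)]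
      linarith
    have := hinj (hδU hmem).1.2 (hδU (mem_ball_self hδ)).1.2 (hconst _ hmem)
    have h0 : ((δ / 2 : ℝ) : ℂ) = 0 := by simpa using this
    rw [Complex.ofReal_eq_zero] at h0
    linarith
  · have hd : ∀ᶠ w in 𝓝[≠] (ξ z₀), DifferentiableAt ℂ g w := by
      have ht : Tendsto g (𝓝[≠] (ξ z₀)) (𝓝[≠] z₀) := by
        refine tendsto_nhdsWithin_iff.2 ⟨?_, ?_⟩
        · have := hgc.tendsto; rw [hg0] at this; exact this.mono_left nhdsWithin_le_nhds
        · filter_upwards [self_mem_nhdsWithin, nhdsWithin_le_nhds hev] with w hw hw' h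
          exact hw (by rw [mem_singleton_iff, ← hw', show g w = z₀ from h])
      filter_upwards [ht.eventually h, nhdsWithin_le_nhds
        (eventually_mem_nhds_iff.2 hball)] with w hw hwb
      have hwm := mem_of_mem_nhds hwb
      exact (HasDerivAt.of_local_left_inverse (hg.continuousAt hwb)
        (hξ.differentiableAt (hgd hwm)).hasDerivAt hw
        (by filter_upwards [hwb] with y hy using hgξ y hy)).differentiableAt
    have ha := (Complex.analyticAt_of_differentiable_on_punctured_nhds_of_continuousAt
      hd hgc).differentiableAt.hasDerivAt
    have hcomp := HasDerivAt.comp (ξ z₀)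
      (by rw [hg0]; exact (hξ.differentiableAt hz₀).hasDerivAt) ha
    have hid : HasDerivAt (ξ ∘ g) 1 (ξ z₀) := (hasDerivAt_id _).congr_of_eventuallyEq hev
    intro h0
    have := hcomp.unique hid
    rw [h0, zero_mul] at this
    exact zero_ne_one this

/-- Since `ξ'` has no zeros, a continuous lift is locally a holomorphic inverse of `ξ` composed with
`f`. -/
lemma differentiableOn_lift {U : Set ℂ} (hU : IsOpen U) {f g : ℂ → ℂ}
    (hf : DifferentiableOn ℂ f U) (hg : ContinuousOn g U) (hgd : MapsTo g U disk)
    (hgf : ∀ z ∈ U, ξ (g z) = f z) : DifferentiableOn ℂ g U := by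
  intro a ha
  have hUa := hU.mem_nhds ha
  have hs : HasStrictDerivAt ξ (deriv ξ (g a)) (g a) :=
    (hξ.analyticAt (hgd ha)).hasStrictDerivAt
  have hne := hξ.deriv_ne_zero (hgd ha)
  have hinv := hs.to_localInverse hne
  have hleft : ∀ᶠ z in 𝓝 (g a), hs.localInverse ξ _ _ hne (ξ z) = z :=
    (hs.hasStrictFDerivAt_equiv hne).eventually_left_inverse
  have hev : g =ᶠ[𝓝 a] hs.localInverse ξ _ _ hne ∘ f := by
    filter_upwards [(hg.continuousAt hUa).eventually hleft, hUa] with z hz hzU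
    rw [Function.comp_apply, ← hgf z hzU, hz]
  have hfa := hf.differentiableAt hUa
  rw [hgf a ha] at hinv
  exact ((hinv.hasDerivAt.differentiableAt.comp a hfa).congr_of_eventuallyEq
    hev).differentiableWithinAt

/-- Lifts of holomorphic maps of the disk. -/
lemma exists_holomorphic_lift {f : ℂ → ℂ} (hf : DifferentiableOn ℂ f disk)
    (hfE : MapsTo f disk Eᶜ) {a₀ z₀ : ℂ} (ha₀ : a₀ ∈ disk) (hz₀ : z₀ ∈ disk) (h : ξ z₀ = f a₀) :
    ∃ g : ℂ → ℂ, DifferentiableOn ℂ g disk ∧ MapsTo g disk disk ∧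
      (∀ z ∈ disk, ξ (g z) = f z) ∧ g a₀ = z₀ := by
  obtain ⟨g, hg, hgd, hgf, hg0⟩ := hξ.exists_liftOn isOpen_disk zero_mem_disk
    ((convex_ball 0 1).starConvex zero_mem_disk) hf.continuousOn hfE ha₀ hz₀ h
  exact ⟨g, hξ.differentiableOn_lift isOpen_disk hf hg hgd hgf, hgd, hgf, hg0⟩

lemma eq_of_lift {f g : ℂ → ℂ} (hf : ContinuousOn f disk) (hg : ContinuousOn g disk)
    (hfd : MapsTo f disk disk) (hgd : MapsTo g disk disk)
    (h : ∀ z ∈ disk, ξ (f z) = ξ (g z)) {a : ℂ} (ha : a ∈ disk) (hfg : f a = g a) :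
    ∀ z ∈ disk, f z = g z := fun _ hz =>
  hξ.eqOn_lift ℂ disk isPreconnected_disk f g hf hg hfd hgd h a ha hfg hz

/-- The lift `φ` of `conj ∘ ξ ∘ conj` fixing `0` has an inverse, its own conjugate, so it is
multiplication by some `u`. Both `ξ` and its conjugate have the same derivative `r > 0` at `0`,
which forces `u = 1`. -/
lemma map_conj {z : ℂ} (hz : z ∈ disk) : ξ (conj z) = conj (ξ z) := by
  have hconj : MapsTo conj disk disk := fun _ => conj_mem_disk
  have hcc : ∀ f : ℂ → ℂ, DifferentiableOn ℂ f disk →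
      DifferentiableOn ℂ (conj ∘ f ∘ conj) disk := fun f hf z hz => by
    have := (hf.differentiableAt (isOpen_disk.mem_nhds (conj_mem_disk hz))).hasDerivAt.conj_conj
    rw [Complex.conj_conj] at this
    exact this.differentiableAt.differentiableWithinAt
  obtain ⟨φ, hφ, hφd, hφξ, hφ0⟩ := hξ.exists_holomorphic_lift (hcc ξ hξ.differentiableOn)
    (fun z hz => hξ.conj_notMem (hξ.mapsTo (conj_mem_disk hz))) zero_mem_disk zero_mem_disk
    (by simp [hξ.map_zero])
  set ψ : ℂ → ℂ := conj ∘ φ ∘ conj with hψ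
  have hψφ : ∀ z ∈ disk, φ (ψ z) = z := by
    refine hξ.eq_of_lift (hφ.continuousOn.comp (hcc φ hφ).continuousOn
      (hconj.comp (hφd.comp hconj))) continuousOn_id
      (hφd.comp (hconj.comp (hφd.comp hconj))) (fun z hz => hz) (fun z hz => ?_) zero_mem_disk
      (by simp [hψ, hφ0])
    simp [hψ, hφξ _ (conj_mem_disk (hφd (conj_mem_disk hz))), hφξ _ (conj_mem_disk hz)]
  obtain ⟨u, hu⟩ := exists_eq_mul_of_leftInverse (f := φ) (g := ψ) hφ (hcc φ hφ) hφd (hconj.comp (hφd.comp hconj))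
    hφ0 (by simp [hψ, hφ0]) (fun z hz => by
      have := hψφ _ (conj_mem_disk hz)
      simp only [hψ, Function.comp_apply, Complex.conj_conj] at this ⊢
      rw [this, Complex.conj_conj])
  obtain ⟨r, hr, hder⟩ := hξ.exists_deriv_pos
  have hr' : (r : ℂ) ≠ 0 := by exact_mod_cast hr.ne'
  have h1 : HasDerivAt (conj ∘ ξ ∘ conj) r 0 := by
    have := HasDerivAt.conj_conj hder
    rwa [Complex.conj_ofReal, _root_.map_zero] at this
  have h2 : HasDerivAt (ξ ∘ φ) (r * u) 0 := by
    have hφu : HasDerivAt φ u 0 := by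
      have : HasDerivAt (fun z => u * z) (u * 1) 0 := (hasDerivAt_id (0 : ℂ)).const_mul u
      rw [mul_one] at this
      refine this.congr_of_eventuallyEq ?_
      filter_upwards [isOpen_disk.mem_nhds zero_mem_disk] with z hz using hu z hz
    exact HasDerivAt.comp (h₂ := ξ) (h := φ) 0 (by rw [hφ0]; exact hder) hφu
  have h3 : HasDerivAt (conj ∘ ξ ∘ conj) (r * u) 0 := by
    refine h2.congr_of_eventuallyEq ?_
    filter_upwards [isOpen_disk.mem_nhds zero_mem_disk] with z hz using (hφξ z hz).symm
  have hu1 : u = 1 := by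
    have := h3.unique h1
    exact mul_left_cancel₀ hr' (by rw [this, mul_one])
  have := hφξ z hz
  rw [hu z hz, hu1, one_mul, Function.comp_apply, Function.comp_apply] at this
  rw [this, Complex.conj_conj]

end IsRealCovering

/-- The inversion in the orthogonal circle with center `c` is a lift of complex conjugation. -/
def IsReflection (ξ : ℂ → ℂ) (c : ℂ) : Prop :=
  1 < ‖c‖ ∧ ∀ z ∈ disk, ξ (reflection c z) = conj (ξ z)

lemma IsReflection.im_eq_zero {ξ : ℂ → ℂ} {c z : ℂ} (h : IsReflection ξ c) (hz : z ∈ disk)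
    (hzc : z ∈ orthoCircle c) : (ξ z).im = 0 := by
  have := h.2 z hz
  rw [(reflection_eq_self_iff h.1 (ne_of_mem_disk h.1 hz)).2 hzc] at this
  exact Complex.conj_eq_iff_im.1 this.symm

namespace IsRealCovering

variable {E : Set ℂ} {ξ : ℂ → ℂ} (hξ : IsRealCovering E ξ)
include hξ

/-- On the real diameter `ξ` is real and starts from `0 > lam`; to get further left it would have to
take the value `lam ∈ E`. -/
lemma lt_re_of_im_eq_zero {lam : ℝ} (hlam : (lam : ℂ) ∈ E) (hneg : lam < 0) {z : ℂ}
    (hz : z ∈ disk) (him : z.im = 0) : lam < (ξ z).re := by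
  by_contra! hle
  have hmem : ∀ t ∈ Icc (0 : ℝ) 1, (t : ℂ) * z ∈ disk := fun t ht => by
    rw [mem_disk] at *
    rw [norm_mul, Complex.norm_real, Real.norm_eq_abs, abs_of_nonneg ht.1]
    nlinarith [ht.2, norm_nonneg z]
  have hc : ContinuousOn (fun t : ℝ => (ξ (t * z)).re) (Icc 0 1) :=
    Complex.continuous_re.comp_continuousOn
      (hξ.continuousOn.comp (by fun_prop) fun t ht => hmem t ht)
  obtain ⟨t, ht, htl⟩ := intermediate_value_Icc' zero_le_one hc
    (show lam ∈ Icc _ _ from ⟨by simpa using hle, by simpa [hξ.map_zero] using hneg.le⟩)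
  refine hξ.mapsTo (hmem t ht) ?_
  have him' : (ξ (t * z)).im = 0 := by
    rw [← Complex.conj_eq_iff_im, ← hξ.map_conj (hmem t ht), map_mul, Complex.conj_ofReal,
      conj_eq_self_of_im him]
  have : ξ (t * z) = lam := Complex.ext htl (by simpa using him')
  rwa [this]

/-- Both inversions lift conjugation and both fix `z`, so they agree; the image `(conj c)⁻¹` of `0`
recovers the center. -/
lemma eq_of_isReflection {c d z : ℂ} (hc : IsReflection ξ c) (hd : IsReflection ξ d)
    (hz : z ∈ disk) (hzc : z ∈ orthoCircle c) (hzd : z ∈ orthoCircle d) : c = d := by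
  have h0 := hξ.eq_of_lift (continuousOn_reflection hc.1) (continuousOn_reflection hd.1)
    (fun _ => reflection_mem_disk hc.1) (fun _ => reflection_mem_disk hd.1)
    (fun z hz => by rw [hc.2 z hz, hd.2 z hz]) hz
    (by rw [(reflection_eq_self_iff hc.1 (ne_of_mem_disk hc.1 hz)).2 hzc,
      (reflection_eq_self_iff hd.1 (ne_of_mem_disk hd.1 hz)).2 hzd]) 0 zero_mem_disk
  rw [reflection_zero hc.1, reflection_zero hd.1] at h0
  exact (starRingEnd ℂ).injective (inv_injective h0)

/-- Lift `ξ` to `φ` with `φ (conj z₀) = z₀`; then `ρ = φ ∘ conj` is an antiholomorphic involution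
fixing `z₀`. Composed with the inversion that swaps `0` and `ρ 0`, it becomes a holomorphic
bijection fixing `0`, hence a rotation, and its value at `ρ 0` shows that it is the identity. -/
lemma exists_isReflection {lam : ℝ} (hlam : (lam : ℂ) ∈ E) (hneg : lam < 0) {z₀ : ℂ}
    (hz₀ : z₀ ∈ disk) (him : (ξ z₀).im = 0) (hre : (ξ z₀).re ≤ lam) :
    ∃ c, IsReflection ξ c ∧ z₀ ∈ orthoCircle c := by
  have hreal : ξ (conj z₀) = ξ z₀ := by rw [hξ.map_conj hz₀, conj_eq_self_of_im him]
  have hcont : ContinuousOn conj disk := Complex.continuous_conj.continuousOn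
  have hcd : MapsTo conj disk disk := fun _ => conj_mem_disk
  obtain ⟨φ, hφ, hφd, hφξ, hφ0⟩ := hξ.exists_holomorphic_lift hξ.differentiableOn hξ.mapsTo
    (conj_mem_disk hz₀) hz₀ hreal.symm
  set ρ : ℂ → ℂ := φ ∘ conj with hρ
  have hρd : MapsTo ρ disk disk := hφd.comp hcd
  have hρc : ContinuousOn ρ disk := hφ.continuousOn.comp hcont hcd
  have hρz₀ : ρ z₀ = z₀ := hφ0
  have hρξ : ∀ z ∈ disk, ξ (ρ z) = conj (ξ z) := fun z hz => by
    rw [hρ, Function.comp_apply, hφξ _ (conj_mem_disk hz), hξ.map_conj hz]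
  have hρρ : ∀ z ∈ disk, ρ (ρ z) = z := hξ.eq_of_lift (hρc.comp hρc hρd) continuousOn_id
    (hρd.comp hρd) (fun z hz => hz) (fun z hz => by
      rw [hρξ _ (hρd hz), hρξ z hz, Complex.conj_conj]) hz₀
    (by simp [hρz₀])
  -- Otherwise `φ` is the identity and `z₀` is real, but on the real diameter `ξ` stays to the right
  -- of `lam`.
  have hq : ρ 0 ≠ 0 := fun h => by
    have := hξ.eq_of_lift hφ.continuousOn continuousOn_id hφd (fun z hz => hz)
      (fun z hz => hφξ z hz) zero_mem_disk (by simpa [hρ] using h) (conj z₀) (conj_mem_disk hz₀)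
    rw [hφ0] at this
    exact hre.not_gt (hξ.lt_re_of_im_eq_zero hlam hneg hz₀
      (Complex.conj_eq_iff_im.1 this.symm))
  set c : ℂ := (conj (ρ 0))⁻¹ with hc
  have hqn : ‖ρ 0‖ < 1 := mem_disk.1 (hρd zero_mem_disk)
  have hc1 : 1 < ‖c‖ := by
    rw [hc, norm_inv, Complex.norm_conj]
    exact (one_lt_inv₀ (norm_pos_iff.2 hq)).2 hqn
  have hc0 : reflection c 0 = ρ 0 := by
    rw [reflection_zero hc1, hc, map_inv₀, inv_inv, Complex.conj_conj]
  have hcq : reflection c (ρ 0) = 0 := by rw [← hc0, reflection_reflection hc1]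
  have hcc1 : 1 < ‖conj c‖ := by simpa using hc1
  have hf : DifferentiableOn ℂ (fun z => reflection c (ρ z)) disk := by
    have h1 : DifferentiableOn ℂ (conj ∘ φ ∘ conj) disk := fun z hz => by
      have := (hφ.differentiableAt (isOpen_disk.mem_nhds (conj_mem_disk hz))).hasDerivAt.conj_conj
      rw [Complex.conj_conj] at this
      exact this.differentiableAt.differentiableWithinAt
    have h2 := (differentiableOn_generator hc1).comp h1 (hcd.comp (hφd.comp hcd))
    refine h2.congr fun z _ => ?_
    rw [reflection_eq_generator]
    rfl
  have hg : DifferentiableOn ℂ (fun z => ρ (reflection c z)) disk := by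
    refine (hφ.comp (differentiableOn_generator hcc1)
      fun z hz => generator_mem_disk hcc1 hz).congr fun z _ => ?_
    rw [hρ, Function.comp_apply, Function.comp_apply, conj_reflection]
  obtain ⟨u, hu⟩ := exists_eq_mul_of_leftInverse hf hg
    (fun z hz => reflection_mem_disk hc1 (hρd hz)) (fun z hz => hρd (reflection_mem_disk hc1 hz))
    hcq (by rw [hc0, hρρ 0 zero_mem_disk])
    (fun z hz => by rw [reflection_reflection hc1, hρρ z hz])
  have hu1 : u = 1 := by
    have := hu (ρ 0) (hρd zero_mem_disk)
    rw [hρρ 0 zero_mem_disk, hc0] at this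
    exact (mul_right_cancel₀ hq (by rw [one_mul]; exact this)).symm
  have hρc' : ∀ z ∈ disk, reflection c z = ρ z := fun z hz => by
    have := hu z hz
    rw [hu1, one_mul] at this
    conv_lhs => rw [← this]
    exact reflection_reflection hc1 _
  refine ⟨c, ⟨hc1, fun z hz => by rw [hρc' z hz, hρξ z hz]⟩, ?_⟩
  rw [← reflection_eq_self_iff hc1 (ne_of_mem_disk hc1 hz₀), hρc' z₀ hz₀, hρz₀]

end IsRealCovering

/-! ### The Klein model -/

/-- The map from the Klein model to the Poincaré model of the hyperbolic plane. -/
def kleinMap (k : ℂ) : ℂ := ((1 + √(1 - ‖k‖ ^ 2) : ℝ) : ℂ)⁻¹ * k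

lemma kleinMap_factor_pos (k : ℂ) : 0 < 1 + √(1 - ‖k‖ ^ 2) := by positivity

lemma continuous_kleinMap : Continuous kleinMap := by
  unfold kleinMap
  refine Continuous.mul (Continuous.inv₀ (by fun_prop) fun k => ?_) continuous_id
  exact_mod_cast (kleinMap_factor_pos k).ne'

lemma kleinMap_of_norm_eq_one {k : ℂ} (hk : ‖k‖ = 1) : kleinMap k = k := by
  simp [kleinMap, hk]

lemma kleinMap_zero : kleinMap 0 = 0 := by simp [kleinMap]

lemma kleinMap_mem_disk {k : ℂ} (hk : k ∈ disk) : kleinMap k ∈ disk := by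
  rw [mem_disk] at *
  have h : 0 < √(1 - ‖k‖ ^ 2) := Real.sqrt_pos.2 (by nlinarith [norm_nonneg k])
  rw [kleinMap, norm_mul, norm_inv, Complex.norm_real, Real.norm_eq_abs,
    abs_of_pos (kleinMap_factor_pos k), inv_mul_lt_iff₀ (kleinMap_factor_pos k)]
  linarith

lemma exists_kleinMap_eq {z : ℂ} (hz : z ∈ disk) : ∃ k ∈ disk, kleinMap k = z := by
  rw [mem_disk] at hz
  have h0 := norm_nonneg z
  have hpos : 0 < 1 + ‖z‖ ^ 2 := by positivity
  have hn : ‖((2 / (1 + ‖z‖ ^ 2) : ℝ) : ℂ) * z‖ = 2 / (1 + ‖z‖ ^ 2) * ‖z‖ := by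
    rw [norm_mul, Complex.norm_real, Real.norm_eq_abs, abs_of_pos (by positivity)]
  have hs : √(1 - (2 / (1 + ‖z‖ ^ 2) * ‖z‖) ^ 2) = (1 - ‖z‖ ^ 2) / (1 + ‖z‖ ^ 2) := by
    rw [Real.sqrt_eq_iff_mul_self_eq_of_pos]
    · field_simp; ring
    · exact div_pos (by nlinarith) hpos
  refine ⟨((2 / (1 + ‖z‖ ^ 2) : ℝ) : ℂ) * z, ?_, ?_⟩
  · rw [mem_disk, hn, div_mul_eq_mul_div, div_lt_one hpos]
    nlinarith [sq_pos_of_pos (sub_pos.2 hz)]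
  · rw [kleinMap, hn, hs, ← mul_assoc, ← Complex.ofReal_inv, ← Complex.ofReal_mul]
    have : (1 + (1 - ‖z‖ ^ 2) / (1 + ‖z‖ ^ 2))⁻¹ * (2 / (1 + ‖z‖ ^ 2)) = 1 := by
      field_simp; norm_num
    rw [this, Complex.ofReal_one, one_mul]

lemma dist_sq_eq (z c : ℂ) : dist z c ^ 2 = ‖z‖ ^ 2 - 2 * (z * conj c).re + ‖c‖ ^ 2 := by
  rw [dist_eq_norm]
  simp only [← Complex.normSq_eq_norm_sq, Complex.normSq_apply]
  simp
  ring

/-- The sign of `1 - (k * conj c).re` decides on which side of the circle the image lies: in the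
Klein model orthogonal circles are chords, and the outsides of their disks are half-planes. -/
lemma dist_kleinMap_sq {c k : ℂ} (hc : 1 < ‖c‖) (hk : ‖k‖ ≤ 1) :
    dist (kleinMap k) c ^ 2 =
      orthoRadius c ^ 2 + 2 * (1 - (k * conj c).re) / (1 + √(1 - ‖k‖ ^ 2)) := by
  have hpos := kleinMap_factor_pos k
  have hs : √(1 - ‖k‖ ^ 2) ^ 2 = 1 - ‖k‖ ^ 2 := Real.sq_sqrt (by nlinarith [norm_nonneg k])
  have hn : ‖kleinMap k‖ ^ 2 = ‖k‖ ^ 2 / (1 + √(1 - ‖k‖ ^ 2)) ^ 2 := by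
    rw [kleinMap, norm_mul, norm_inv, Complex.norm_real, Real.norm_eq_abs, abs_of_pos hpos,
      mul_pow, inv_pow]
    field_simp
  have hr : (kleinMap k * conj c).re = (k * conj c).re / (1 + √(1 - ‖k‖ ^ 2)) := by
    rw [kleinMap, mul_assoc, ← Complex.ofReal_inv, Complex.re_ofReal_mul]
    field_simp
  rw [dist_sq_eq, hn, hr, orthoRadius_sq hc]
  set s := √(1 - ‖k‖ ^ 2)
  have hk2 : ‖k‖ ^ 2 = (1 - s) * (1 + s) := by linarith [hs]
  rw [hk2]
  field_simp
  ring

lemma kleinMap_mem_orthoCircle {c k : ℂ} (hc : 1 < ‖c‖) (hk : ‖k‖ ≤ 1) :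
    kleinMap k ∈ orthoCircle c ↔ (k * conj c).re = 1 := by
  have hpos := kleinMap_factor_pos k
  have h := dist_kleinMap_sq hc hk
  rw [orthoCircle, Metric.mem_sphere, ← pow_left_inj₀ dist_nonneg (orthoRadius_pos hc).le
    two_ne_zero, h, add_eq_left, div_eq_zero_iff, or_iff_left hpos.ne', mul_eq_zero,
    or_iff_right two_ne_zero, sub_eq_zero, eq_comm]

lemma kleinMap_notMem_closedBall {c k : ℂ} (hc : 1 < ‖c‖) (hk : ‖k‖ ≤ 1) :
    kleinMap k ∉ closedBall c (orthoRadius c) ↔ (k * conj c).re < 1 := by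
  have hpos := kleinMap_factor_pos k
  have h := dist_kleinMap_sq hc hk
  rw [mem_closedBall, not_le, ← pow_lt_pow_iff_left₀ (orthoRadius_pos hc).le dist_nonneg
    two_ne_zero, h, lt_add_iff_pos_right, div_pos_iff_of_pos_right hpos]
  constructor <;> intro h <;> linarith

lemma convex_halfPlane_lt (c : ℂ) : Convex ℝ {k : ℂ | (k * conj c).re < 1} :=
  convex_halfSpace_lt (f := fun k : ℂ => (k * conj c).re)
    ⟨fun x y => by simp only [add_mul, Complex.add_re],
      fun a x => by simp only [Complex.real_smul, mul_assoc, Complex.re_ofReal_mul, smul_eq_mul]⟩ 1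

lemma convex_halfPlane_eq (c : ℂ) : Convex ℝ {k : ℂ | (k * conj c).re = 1} :=
  convex_hyperplane (f := fun k : ℂ => (k * conj c).re)
    ⟨fun x y => by simp only [add_mul, Complex.add_re],
      fun a x => by simp only [Complex.real_smul, mul_assoc, Complex.re_ofReal_mul, smul_eq_mul]⟩ 1

lemma isPreconnected_orthoCircle_inter {c : ℂ} (hc : 1 < ‖c‖) :
    IsPreconnected (orthoCircle c ∩ disk) := by
  have : orthoCircle c ∩ disk = kleinMap '' ({k : ℂ | (k * conj c).re = 1} ∩ disk) := by
    ext z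
    constructor
    · rintro ⟨hz, hzd⟩
      obtain ⟨k, hk, rfl⟩ := exists_kleinMap_eq hzd
      exact ⟨k, ⟨(kleinMap_mem_orthoCircle hc (mem_disk.1 hk).le).1 hz, hk⟩, rfl⟩
    · rintro ⟨k, ⟨hk1, hk⟩, rfl⟩
      exact ⟨(kleinMap_mem_orthoCircle hc (mem_disk.1 hk).le).2 hk1, kleinMap_mem_disk hk⟩
  rw [this]
  exact ((convex_halfPlane_eq c).inter (convex_ball 0 1)).isPreconnected.image _
    continuous_kleinMap.continuousOn

/-- In the Klein model this region is the disk cut by half-planes, hence convex. No finiteness of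
`B` is needed, so the lemma can be used before the sides are counted. -/
lemma isPreconnected_outside {B : Set ℂ} (hB : ∀ c ∈ B, 1 < ‖c‖) :
    IsPreconnected {z | z ∈ disk ∧ ∀ c ∈ B, z ∉ closedBall c (orthoRadius c)} := by
  have : {z | z ∈ disk ∧ ∀ c ∈ B, z ∉ closedBall c (orthoRadius c)} =
      kleinMap '' (disk ∩ ⋂ c ∈ B, {k : ℂ | (k * conj c).re < 1}) := by
    ext z
    constructor
    · rintro ⟨hzd, hz⟩
      obtain ⟨k, hk, rfl⟩ := exists_kleinMap_eq hzd
      exact ⟨k, ⟨hk, mem_iInter₂.2 fun c hc =>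
        (kleinMap_notMem_closedBall (hB c hc) (mem_disk.1 hk).le).1 (hz c hc)⟩, rfl⟩
    · rintro ⟨k, ⟨hk, hk1⟩, rfl⟩
      exact ⟨kleinMap_mem_disk hk, fun c hc =>
        (kleinMap_notMem_closedBall (hB c hc) (mem_disk.1 hk).le).2 (mem_iInter₂.1 hk1 c hc)⟩
  rw [this]
  exact ((convex_ball 0 1).inter (convex_iInter₂ fun c _ =>
    convex_halfPlane_lt c)).isPreconnected.image _ continuous_kleinMap.continuousOn

lemma zero_notMem_closedBall {c : ℂ} (hc : 1 < ‖c‖) : (0 : ℂ) ∉ closedBall c (orthoRadius c) := by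
  have h := (kleinMap_notMem_closedBall (k := 0) hc (by simp)).2 (by simp)
  rwa [kleinMap_zero] at h

/-- The point of the chord of `c` nearest to the origin. -/
lemma chord_foot {c : ℂ} (hc : 1 < ‖c‖) :
    ((conj c)⁻¹ * conj c).re = 1 ∧ ‖(conj c)⁻¹‖ < 1 := by
  have h0 : conj c ≠ 0 := (map_ne_zero _).2 (by rintro rfl; norm_num at hc)
  refine ⟨by rw [inv_mul_cancel₀ h0, Complex.one_re], ?_⟩
  rw [norm_inv, Complex.norm_conj]
  exact inv_lt_one_of_one_lt₀ hc

lemma nonempty_orthoCircle_inter {c : ℂ} (hc : 1 < ‖c‖) : (orthoCircle c ∩ disk).Nonempty :=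
  ⟨kleinMap (conj c)⁻¹, (kleinMap_mem_orthoCircle hc (chord_foot hc).2.le).2 (chord_foot hc).1,
    kleinMap_mem_disk (mem_disk.2 (chord_foot hc).2)⟩

/-- Two points determine a chord: its foot, and a nearby point displaced along it. They force the
real part of `conj d / conj c` to be `1` and the imaginary part to be `0`. -/
lemma eq_of_orthoCircle_subset {c d : ℂ} (hc : 1 < ‖c‖) (hd : 1 < ‖d‖)
    (h : orthoCircle c ∩ disk ⊆ orthoCircle d) : c = d := by
  have key : ∀ k : ℂ, ‖k‖ < 1 → (k * conj c).re = 1 → (k * conj d).re = 1 := fun k hk hkc =>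
    (kleinMap_mem_orthoCircle hd hk.le).1
      (h ⟨(kleinMap_mem_orthoCircle hc hk.le).2 hkc, kleinMap_mem_disk (mem_disk.2 hk)⟩)
  obtain ⟨h1, h2⟩ := chord_foot hc
  have e1 := key _ h2 h1
  have h0 : c ≠ 0 := by rintro rfl; norm_num at hc
  have hcc : conj c ≠ 0 := (map_ne_zero _).2 h0
  obtain ⟨t, ht0, ht⟩ : ∃ t : ℝ, t ≠ 0 ∧ ‖(conj c)⁻¹ + t * Complex.I * (conj c)⁻¹‖ < 1 := by
    have hcont : Continuous fun t : ℝ => ‖(conj c)⁻¹ + t * Complex.I * (conj c)⁻¹‖ := by fun_prop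
    have : ∀ᶠ t : ℝ in 𝓝[≠] 0, ‖(conj c)⁻¹ + t * Complex.I * (conj c)⁻¹‖ < 1 :=
      nhdsWithin_le_nhds (hcont.continuousAt.eventually_lt continuousAt_const (by simpa using h2))
    obtain ⟨t, ht, ht0⟩ := (this.and self_mem_nhdsWithin).exists
    exact ⟨t, ht0, ht⟩
  have e2 := key _ ht (by
    rw [add_mul, mul_assoc, inv_mul_cancel₀ hcc]; simp)
  set w : ℂ := (conj c)⁻¹ * conj d with hw
  have hw1 : w.re = 1 := e1
  have hw2 : w.im = 0 := by
    have : ((conj c)⁻¹ + t * Complex.I * (conj c)⁻¹) * conj d = w + t * (Complex.I * w) := by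
      rw [hw]; ring
    rw [this, Complex.add_re, Complex.re_ofReal_mul, hw1] at e2
    simp at e2
    exact e2.resolve_left ht0
  have hw3 : w = 1 := Complex.ext hw1 hw2
  rw [hw, inv_mul_eq_one₀ hcc] at hw3
  exact (starRingEnd ℂ).injective hw3

/-- In the Klein model the endpoint is approached along the chord, from its foot `(conj c)⁻¹`. -/
lemma mem_closure_orthoCircle_inter {c z : ℂ} (hc : 1 < ‖c‖) (hz : z ∈ unitCircle)
    (hzc : z ∈ orthoCircle c) : z ∈ closure (orthoCircle c ∩ disk) := by
  have hz1 := mem_unitCircle.1 hz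
  obtain ⟨h1, h2⟩ := chord_foot hc
  have hzre : (z * conj c).re = 1 := by
    rw [← kleinMap_mem_orthoCircle hc hz1.le, kleinMap_of_norm_eq_one hz1]; exact hzc
  set k : ℝ → ℂ := fun t => (1 - t : ℝ) * z + (t : ℝ) * (conj c)⁻¹ with hk
  have hlim : Tendsto (fun t => kleinMap (k t)) (𝓝[>] 0) (𝓝 z) := by
    have hcont : Continuous fun t => kleinMap (k t) := continuous_kleinMap.comp (by fun_prop)
    have := hcont.tendsto 0
    have h0 : kleinMap (k 0) = z := by simp [hk, kleinMap_of_norm_eq_one hz1]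
    rw [h0] at this
    exact this.mono_left nhdsWithin_le_nhds
  refine mem_closure_of_tendsto hlim ?_
  filter_upwards [Ioo_mem_nhdsGT one_pos] with t ht
  have hn : ‖k t‖ < 1 := by
    calc ‖k t‖ ≤ (1 - t) * 1 + t * ‖(conj c)⁻¹‖ := by
          refine (norm_add_le _ _).trans (le_of_eq ?_)
          rw [norm_mul, norm_mul, Complex.norm_real, Complex.norm_real, hz1, Real.norm_eq_abs,
            Real.norm_eq_abs, abs_of_pos ht.1, abs_of_pos (by linarith [ht.2])]
      _ < 1 := by nlinarith [ht.1]
  refine ⟨(kleinMap_mem_orthoCircle hc hn.le).2 ?_, kleinMap_mem_disk (mem_disk.2 hn)⟩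
  rw [hk]
  simp only [add_mul, mul_assoc, Complex.add_re, Complex.re_ofReal_mul, hzre, h1]
  ring

/-! ### The fundamental domain -/

/-- The plane slit along `(-∞, lam]`. -/
def slit (lam : ℝ) : Set ℂ := {w | w.im = 0 → lam < w.re}

/-- The component containing the origin of the preimage of the slit plane. -/
def slitComponent (lam : ℝ) (ξ : ℂ → ℂ) : Set ℂ := connectedComponentIn (disk ∩ ξ ⁻¹' slit lam) 0

lemma notMem_slit {lam : ℝ} {w : ℂ} : w ∉ slit lam ↔ w.im = 0 ∧ w.re ≤ lam := by
  simp [slit]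

lemma isOpen_slit (lam : ℝ) : IsOpen (slit lam) := by
  have : (slit lam)ᶜ = {w : ℂ | w.im = 0} ∩ {w : ℂ | w.re ≤ lam} := by
    ext w; exact notMem_slit
  rw [← isClosed_compl_iff, this]
  exact (isClosed_eq Complex.continuous_im continuous_const).inter
    (isClosed_le Complex.continuous_re continuous_const)

lemma conj_mem_slit {lam : ℝ} {w : ℂ} : conj w ∈ slit lam ↔ w ∈ slit lam := by
  simp [slit]

/-- `ξ` is a covering of the complement of `E`, where `E` is contained in `(-∞, lam]` and
contains the negative number `lam`. -/
structure IsSlitCovering (E : Set ℂ) (lam : ℝ) (ξ : ℂ → ℂ) : Prop extends IsRealCovering E ξ where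
  lam_mem : (lam : ℂ) ∈ E
  lam_neg : lam < 0
  re_le : ∀ e ∈ E, e.re ≤ lam

/-- The orthogonal circle with center `c` is the fixed line of a lift of complex conjugation, and
`ξ` maps it to `(-∞, lam]`. -/
def IsSide (lam : ℝ) (ξ : ℂ → ℂ) (c : ℂ) : Prop :=
  IsReflection ξ c ∧ ∀ z ∈ disk, z ∈ orthoCircle c → (ξ z).re ≤ lam

lemma IsSide.notMem_slit {lam : ℝ} {ξ : ℂ → ℂ} {c z : ℂ} (h : IsSide lam ξ c) (hz : z ∈ disk)
    (hzc : z ∈ orthoCircle c) : ξ z ∉ slit lam :=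
  FiniteGap.notMem_slit.2 ⟨h.1.im_eq_zero hz hzc, h.2 z hz hzc⟩

namespace IsSlitCovering

variable {E : Set ℂ} {lam : ℝ} {ξ : ℂ → ℂ} (hξ : IsSlitCovering E lam ξ)
include hξ

lemma isOpen_preimage_slit : IsOpen (disk ∩ ξ ⁻¹' slit lam) :=
  hξ.continuousOn.isOpen_inter_preimage isOpen_disk (isOpen_slit lam)

lemma isOpen_slitComponent : IsOpen (slitComponent lam ξ) :=
  hξ.isOpen_preimage_slit.connectedComponentIn

lemma zero_mem_slitComponent : (0 : ℂ) ∈ slitComponent lam ξ :=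
  mem_connectedComponentIn ⟨zero_mem_disk, by simp [slit, hξ.map_zero, hξ.lam_neg]⟩

omit hξ in
lemma slitComponent_subset : slitComponent lam ξ ⊆ disk ∩ ξ ⁻¹' slit lam :=
  connectedComponentIn_subset _ _

omit hξ in
lemma isPreconnected_slitComponent : IsPreconnected (slitComponent lam ξ) :=
  isPreconnected_connectedComponentIn

omit hξ in
lemma subset_slitComponent {V : Set ℂ} (hV : IsPreconnected V)
    (hVs : V ⊆ disk ∩ ξ ⁻¹' slit lam) (hne : (V ∩ slitComponent lam ξ).Nonempty) :
    V ⊆ slitComponent lam ξ := by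
  obtain ⟨y, hyV, hy⟩ := hne
  have := hV.subset_connectedComponentIn hyV hVs
  rwa [← connectedComponentIn_eq hy] at this

lemma notMem_slit_of_mem_frontier {z : ℂ} (hz : z ∈ disk)
    (hzf : z ∈ frontier (slitComponent lam ξ)) : ξ z ∉ slit lam := by
  intro hs
  rw [hξ.isOpen_slitComponent.frontier_eq] at hzf
  have hzY : z ∈ disk ∩ ξ ⁻¹' slit lam := ⟨hz, hs⟩
  have hcc : connectedComponentIn (disk ∩ ξ ⁻¹' slit lam) z ∈ 𝓝 z :=
    hξ.isOpen_preimage_slit.connectedComponentIn.mem_nhds (mem_connectedComponentIn hzY)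
  obtain ⟨y, hy1, hy2⟩ := mem_closure_iff_nhds.1 hzf.1 _ hcc
  exact hzf.2 (subset_slitComponent isPreconnected_connectedComponentIn
    (connectedComponentIn_subset _ _) ⟨y, hy1, hy2⟩ (mem_connectedComponentIn hzY))

/-- Along the connected arc `ξ` is real and omits `lam`, so it stays on one side of it. -/
lemma isSide_of_exists {c z : ℂ} (h : IsReflection ξ c) (hz : z ∈ disk) (hzc : z ∈ orthoCircle c)
    (hre : (ξ z).re ≤ lam) : IsSide lam ξ c := by
  refine ⟨h, fun y hy hyc => ?_⟩
  by_contra! hlt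
  have hcont : ContinuousOn (fun y => (ξ y).re) (orthoCircle c ∩ disk) :=
    Complex.continuous_re.comp_continuousOn (hξ.continuousOn.mono inter_subset_right)
  obtain ⟨w, hw, hwl⟩ := (isPreconnected_orthoCircle_inter h.1).intermediate_value
    ⟨hzc, hz⟩ ⟨hyc, hy⟩ hcont ⟨hre, hlt.le⟩
  refine hξ.mapsTo hw.2 ?_
  have : ξ w = lam := Complex.ext hwl (by simpa using h.im_eq_zero hw.2 hw.1)
  rw [this]
  exact hξ.lam_mem

lemma exists_isSide {z : ℂ} (hz : z ∈ disk) (hs : ξ z ∉ slit lam) :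
    ∃ c, IsSide lam ξ c ∧ z ∈ orthoCircle c := by
  obtain ⟨him, hre⟩ := FiniteGap.notMem_slit.1 hs
  obtain ⟨c, hc, hzc⟩ := hξ.exists_isReflection hξ.lam_mem hξ.lam_neg hz him hre
  exact ⟨c, hξ.isSide_of_exists hc hz hzc hre, hzc⟩

/-- The component is connected and contains `0`, which is outside; it cannot meet the circle, on
which `ξ` leaves the slit plane. -/
lemma slitComponent_disjoint {c z : ℂ} (hc : IsSide lam ξ c) (hz : z ∈ slitComponent lam ξ) :
    z ∉ closedBall c (orthoRadius c) := by
  have hsub : slitComponent lam ξ ⊆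
      ball c (orthoRadius c) ∪ (closedBall c (orthoRadius c))ᶜ := by
    intro y hy
    have hyY := slitComponent_subset hy
    by_contra hcon
    rw [mem_union, not_or, mem_compl_iff, not_not] at hcon
    have : y ∈ orthoCircle c := le_antisymm (mem_closedBall.1 hcon.2)
      (not_lt.1 fun h => hcon.1 (mem_ball.2 h))
    exact hc.notMem_slit hyY.1 this hyY.2
  exact (isPreconnected_slitComponent.subset_right_of_subset_union isOpen_ball
    isClosed_closedBall.isOpen_compl
    (disjoint_compl_right.mono_left ball_subset_closedBall) hsub
    ⟨0, hξ.zero_mem_slitComponent, zero_notMem_closedBall hc.1.1⟩) hz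

/-- Near a point of a side in the closure of the fundamental domain, the side is contained in
this closure. -/
lemma eventually_mem_closure {c z₁ : ℂ} (hc : IsSide lam ξ c) (hz₁ : z₁ ∈ disk)
    (hz₁c : z₁ ∈ orthoCircle c) (hcl : z₁ ∈ closure (slitComponent lam ξ)) :
    ∀ᶠ z in 𝓝 z₁, z ∈ orthoCircle c → z ∈ closure (slitComponent lam ξ) := by
  have hc1 := hc.1.1
  have hr := orthoRadius_pos hc1
  have hfix : ∀ z ∈ orthoCircle c, reflection c z = z := fun z hz => inversion_of_mem_sphere hz
  have hrc : ∀ z ∈ disk, ContinuousAt (reflection c) z := fun z hz =>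
    (continuousOn_reflection hc1).continuousAt (isOpen_disk.mem_nhds hz)
  obtain ⟨U, hU, hinj⟩ := hξ.exists_injOn z₁ hz₁
  have hU' : reflection c ⁻¹' U ∈ 𝓝 z₁ :=
    (hrc z₁ hz₁).preimage_mem_nhds (by rwa [hfix z₁ hz₁c])
  obtain ⟨δ, hδ, hδU⟩ := Metric.mem_nhds_iff.1
    (inter_mem (inter_mem hU hU') (isOpen_disk.mem_nhds hz₁))
  -- `ξ` is injective near `z₁`, so a nearby point with real image is fixed by the inversion.
  have hgap : ∀ z ∈ ball z₁ δ, ξ z ∉ slit lam → z ∈ orthoCircle c := by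
    intro z hz hs
    obtain ⟨⟨hzU, hzU'⟩, hzd⟩ := hδU hz
    rw [← reflection_eq_self_iff hc1 (ne_of_mem_disk hc1 hzd)]
    refine hinj hzU' hzU ?_
    rw [hc.1.2 z hzd, conj_eq_self_of_im (FiniteGap.notMem_slit.1 hs).1]
  -- The half inside the circle is an intersection of two balls, hence convex; its inversion gives a
  -- connected piece outside, where the fundamental domain lies.
  set V := ball z₁ δ ∩ ball c (orthoRadius c) with hV
  have hVs : ∀ z ∈ V, z ∈ disk ∧ ξ z ∈ slit lam := by
    intro z hz
    refine ⟨(hδU hz.1).2, ?_⟩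
    by_contra hs
    exact (mem_ball.1 hz.2).ne (hgap z hz.1 hs)
  have hV2 : reflection c '' V ⊆ slitComponent lam ξ := by
    refine subset_slitComponent
      (((convex_ball z₁ δ).inter (convex_ball _ _)).isPreconnected.image _
      ((continuousOn_reflection hc1).mono fun z hz => (hVs z hz).1)) ?_ ?_
    · rintro _ ⟨z, hz, rfl⟩
      refine ⟨reflection_mem_disk hc1 (hVs z hz).1, ?_⟩
      rw [mem_preimage, hc.1.2 z (hVs z hz).1, conj_mem_slit]
      exact (hVs z hz).2
    · have hW : disk ∩ reflection c ⁻¹' ball z₁ δ ∈ 𝓝 z₁ :=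
        inter_mem (isOpen_disk.mem_nhds hz₁)
          ((hrc z₁ hz₁).preimage_mem_nhds (by rw [hfix z₁ hz₁c]; exact ball_mem_nhds _ hδ))
      obtain ⟨y, ⟨hyd, hyW⟩, hyF⟩ := mem_closure_iff_nhds.1 hcl _ hW
      refine ⟨y, ⟨reflection c y, ⟨hyW, ?_⟩, reflection_reflection hc1 y⟩, hyF⟩
      have hout := hξ.slitComponent_disjoint hc hyF
      rw [mem_closedBall, not_le] at hout
      rw [mem_ball, reflection, dist_inversion_center, div_lt_iff₀ (by linarith)]
      nlinarith
  filter_upwards [ball_mem_nhds z₁ hδ] with z hz hzc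
  have hzV : z ∈ closure V := by
    have : z ∈ closure (ball c (orthoRadius c)) := by
      rw [closure_ball _ hr.ne']; exact sphere_subset_closedBall hzc
    exact isOpen_ball.inter_closure ⟨hz, this⟩
  have h1 := mem_closure_image (hrc z (hδU hz).2) hzV
  rw [hfix z hzc] at h1
  exact closure_mono hV2 h1

/-- Lying in the closure is a closed condition on the arc and, by `eventually_mem_closure`, an open
one; the arc is connected. -/
lemma IsSide.subset_frontier {c z₁ : ℂ} (hc : IsSide lam ξ c) (hz₁ : z₁ ∈ disk)
    (hz₁c : z₁ ∈ orthoCircle c) (hcl : z₁ ∈ closure (slitComponent lam ξ)) :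
    orthoCircle c ∩ disk ⊆ frontier (slitComponent lam ξ) := by
  have hconn : PreconnectedSpace ↥(orthoCircle c ∩ disk) :=
    isPreconnected_iff_preconnectedSpace.1 (isPreconnected_orthoCircle_inter hc.1.1)
  have hclopen : IsClopen {z : ↥(orthoCircle c ∩ disk) | (z : ℂ) ∈ closure (slitComponent lam ξ)} := by
    refine ⟨isClosed_closure.preimage continuous_subtype_val, isOpen_iff_eventually.2 ?_⟩
    intro z hz
    have := continuous_subtype_val.continuousAt.eventually
      (hξ.eventually_mem_closure hc z.2.2 z.2.1 hz)
    filter_upwards [this] with y hy using hy y.2.1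
  have huniv := hclopen.eq_univ ⟨⟨z₁, hz₁c, hz₁⟩, hcl⟩
  intro z hz
  have hzc : (⟨z, hz⟩ : ↥(orthoCircle c ∩ disk)) ∈
      {z : ↥(orthoCircle c ∩ disk) | (z : ℂ) ∈ closure (slitComponent lam ξ)} := by
    rw [huniv]; trivial
  rw [hξ.isOpen_slitComponent.frontier_eq]
  exact ⟨hzc, fun h => hc.notMem_slit hz.2 hz.1 (slitComponent_subset h).2⟩

lemma exists_side_of_mem_frontier {z : ℂ} (hz : z ∈ disk)
    (hzf : z ∈ frontier (slitComponent lam ξ)) :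
    ∃ c ∈ boundaryCenters (slitComponent lam ξ), IsSide lam ξ c ∧ z ∈ orthoCircle c := by
  obtain ⟨c, hc, hzc⟩ := hξ.exists_isSide hz (hξ.notMem_slit_of_mem_frontier hz hzf)
  exact ⟨c, ⟨hc.1.1, IsSide.subset_frontier hξ hc hz hzc (frontier_subset_closure hzf)⟩, hc, hzc⟩

/-- `boundaryCenters` only asks that the arc lie in the frontier. Some point of it is on a side `d`.
As `ξ` is real on the arc, the inversion in `d` and the identity are lifts of the same map there and
agree at that point, so the whole arc lies on the circle of `d`. -/
lemma isSide_of_mem {c : ℂ} (hc : c ∈ boundaryCenters (slitComponent lam ξ)) :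
    IsSide lam ξ c := by
  obtain ⟨z₀, hz₀, hz₀d⟩ := nonempty_orthoCircle_inter hc.1
  obtain ⟨d, -, hd, hz₀'⟩ := hξ.exists_side_of_mem_frontier hz₀d (hc.2 ⟨hz₀, hz₀d⟩)
  have heq : EqOn (reflection d) id (orthoCircle c ∩ disk) := by
    refine hξ.eqOn_lift ℂ _ (isPreconnected_orthoCircle_inter hc.1) _ _
      ((continuousOn_reflection hd.1.1).mono inter_subset_right) continuousOn_id
      (fun z hz => reflection_mem_disk hd.1.1 hz.2) (fun z hz => hz.2) (fun z hz => ?_) z₀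
      ⟨hz₀, hz₀d⟩ (inversion_of_mem_sphere hz₀')
    have hs := FiniteGap.notMem_slit.1 (hξ.notMem_slit_of_mem_frontier hz.2 (hc.2 hz))
    rw [hd.1.2 z hz.2, conj_eq_self_of_im hs.1, id]
  have : c = d := eq_of_orthoCircle_subset hc.1 hd.1.1 fun z hz =>
    (reflection_eq_self_iff hd.1.1 (ne_of_mem_disk hd.1.1 hz.2)).1 (heq hz)
  rwa [this]

/-- The part of the disk outside all the disks bounded by the sides. -/
lemma outside_subset : {z | z ∈ disk ∧ ∀ c ∈ boundaryCenters (slitComponent lam ξ),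
    z ∉ closedBall c (orthoRadius c)} ⊆ slitComponent lam ξ := by
  set V := {z | z ∈ disk ∧ ∀ c ∈ boundaryCenters (slitComponent lam ξ),
    z ∉ closedBall c (orthoRadius c)} with hV
  have hpre : IsPreconnected V := isPreconnected_outside fun c hc => hc.1
  have h0 : (0 : ℂ) ∈ V := ⟨zero_mem_disk, fun c hc => zero_notMem_closedBall hc.1⟩
  -- `V` avoids the frontier, whose points in the disk all lie on circles bounding the component.
  have hsub : V ⊆ slitComponent lam ξ ∪ (closure (slitComponent lam ξ))ᶜ := by
    intro z hz
    by_contra hcon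
    rw [mem_union, not_or, mem_compl_iff, not_not] at hcon
    have hf : z ∈ frontier (slitComponent lam ξ) := by
      rw [hξ.isOpen_slitComponent.frontier_eq]; exact ⟨hcon.2, hcon.1⟩
    obtain ⟨c, hc, -, hzc⟩ := hξ.exists_side_of_mem_frontier hz.1 hf
    exact hz.2 c hc (sphere_subset_closedBall hzc)
  exact hpre.subset_left_of_subset_union hξ.isOpen_slitComponent
    isClosed_closure.isOpen_compl (disjoint_compl_right.mono_left subset_closure) hsub
    ⟨0, h0, hξ.zero_mem_slitComponent⟩

/-- A point on one of the circles is an endpoint of an arc in the frontier. Any other is a radial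
limit of points outside all the disks, because a finite union of closed disks is closed. -/
lemma mem_closure_slitComponent (hfin : (boundaryCenters (slitComponent lam ξ)).Finite) {z : ℂ}
    (hz : z ∈ unitCircle)
    (hzc : ∀ c ∈ boundaryCenters (slitComponent lam ξ), z ∉ ball c (orthoRadius c)) :
    z ∈ closure (slitComponent lam ξ) := by
  by_cases h : ∃ c ∈ boundaryCenters (slitComponent lam ξ), z ∈ closedBall c (orthoRadius c)
  · obtain ⟨c, hc, hzb⟩ := h
    have : z ∈ orthoCircle c := le_antisymm (mem_closedBall.1 hzb)
      (not_lt.1 fun h => hzc c hc (mem_ball.2 h))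
    have h1 := mem_closure_orthoCircle_inter hc.1 hz this
    exact closure_minimal (hc.2.trans frontier_subset_closure) isClosed_closure h1
  · push Not at h
    have hopen : IsOpen (⋃ c ∈ boundaryCenters (slitComponent lam ξ),
        closedBall c (orthoRadius c))ᶜ :=
      (hfin.isClosed_biUnion fun _ _ => isClosed_closedBall).isOpen_compl
    have hlim : Tendsto (fun t : ℝ => (t : ℂ) * z) (𝓝[<] 1) (𝓝 z) := by
      have : Continuous fun t : ℝ => (t : ℂ) * z := by fun_prop
      have h1 := this.tendsto 1
      simp only [Complex.ofReal_one, one_mul] at h1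
      exact h1.mono_left nhdsWithin_le_nhds
    refine mem_closure_of_tendsto hlim ?_
    filter_upwards [hlim.eventually (hopen.mem_nhds (by simpa using h)),
      Ioo_mem_nhdsLT (show (0 : ℝ) < 1 from one_pos)] with t ht ht1
    refine hξ.outside_subset ⟨?_, by simpa using ht⟩
    rw [mem_disk, norm_mul, mem_unitCircle.1 hz, mul_one, Complex.norm_real, Real.norm_eq_abs,
      abs_of_pos ht1.1]
    exact ht1.2

/-- The fundamental domain is symmetric with respect to the real axis. -/
lemma conj_mem_slitComponent {z : ℂ} (hz : z ∈ slitComponent lam ξ) :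
    conj z ∈ slitComponent lam ξ := by
  refine subset_slitComponent (V := conj '' slitComponent lam ξ)
    (isPreconnected_slitComponent.image _ Complex.continuous_conj.continuousOn) ?_
    ⟨0, ⟨0, hξ.zero_mem_slitComponent, map_zero _⟩, hξ.zero_mem_slitComponent⟩ ⟨z, hz, rfl⟩
  rintro _ ⟨y, hy, rfl⟩
  have hyY := slitComponent_subset hy
  refine ⟨conj_mem_disk hyY.1, ?_⟩
  rw [mem_preimage, hξ.map_conj hyY.1, conj_mem_slit]
  exact hyY.2

lemma conj_mem_closure {z : ℂ} (hz : z ∈ closure (slitComponent lam ξ)) :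
    conj z ∈ closure (slitComponent lam ξ) :=
  closure_mono (image_subset_iff.2 fun _ => hξ.conj_mem_slitComponent)
    (mem_closure_image Complex.continuous_conj.continuousAt hz)

omit hξ in
lemma conj_mem_orthoCircle {c z : ℂ} : conj z ∈ orthoCircle (conj c) ↔ z ∈ orthoCircle c := by
  rw [orthoCircle, orthoCircle, orthoRadius_conj, Metric.mem_sphere, Metric.mem_sphere,
    Complex.dist_conj_conj]

lemma conj_mem_boundaryCenters {c : ℂ} (hc : c ∈ boundaryCenters (slitComponent lam ξ)) :
    conj c ∈ boundaryCenters (slitComponent lam ξ) := by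
  refine ⟨by simpa using hc.1, fun z hz => ?_⟩
  have h1 : conj z ∈ orthoCircle c := by
    rw [← conj_mem_orthoCircle, Complex.conj_conj]; exact hz.1
  have h2 := hc.2 ⟨h1, conj_mem_disk hz.2⟩
  rw [hξ.isOpen_slitComponent.frontier_eq] at *
  have h3 := hξ.conj_mem_closure h2.1
  rw [Complex.conj_conj] at h3
  exact ⟨h3, fun h => h2.2 (hξ.conj_mem_slitComponent h)⟩

end IsSlitCovering

/-! ### Gaps and sides -/

/-- The real numbers `t` and `t'` are not separated by points of `E`. -/
def SameGap (E : Set ℂ) (t t' : ℝ) : Prop := ∀ s ∈ uIcc t t', (s : ℂ) ∉ E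

/-- The upper half-plane for `s = 1`, the lower half-plane for `s = -1`. -/
def halfPlane (s : ℝ) : Set ℂ := {w | 0 < s * w.im}

lemma convex_halfPlane (s : ℝ) : Convex ℝ (halfPlane s) :=
  convex_halfSpace_gt (f := fun w : ℂ => s * w.im)
    ⟨fun x y => by simp only [Complex.add_im, mul_add],
      fun a x => by simp only [Complex.smul_im, smul_eq_mul]; ring⟩ 0

lemma halfPlane_subset_slit (s lam : ℝ) : halfPlane s ⊆ slit lam := fun w hw him => by
  rw [halfPlane, mem_ofPred_eq, him, mul_zero] at hw
  exact (lt_irrefl _ hw).elim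

lemma nhdsWithin_halfPlane_neBot {s : ℝ} (hs : s ≠ 0) (t : ℝ) :
    (𝓝[halfPlane s] (t : ℂ)).NeBot := by
  rw [← mem_closure_iff_nhdsWithin_neBot]
  have hlim : Tendsto (fun ε : ℝ => (t : ℂ) + ε * (s * Complex.I)) (𝓝[>] 0) (𝓝 t) := by
    have : Continuous fun ε : ℝ => (t : ℂ) + ε * (s * Complex.I) := by fun_prop
    have h1 := this.tendsto 0
    simp only [Complex.ofReal_zero, zero_mul, add_zero] at h1
    exact h1.mono_left nhdsWithin_le_nhds
  refine mem_closure_of_tendsto hlim ?_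
  filter_upwards [self_mem_nhdsWithin] with ε hε
  have : 0 < ε * (s * s) := mul_pos hε (mul_self_pos.2 hs)
  simp only [halfPlane, mem_ofPred_eq, Complex.add_im, Complex.ofReal_im, zero_add,
    Complex.im_ofReal_mul, Complex.I_im, mul_one]
  linarith

lemma starConvex_slit {lam : ℝ} (h : lam < 0) : StarConvex ℝ 0 (slit lam) := by
  intro w hw a b ha hb hab him
  simp only [smul_zero, zero_add, Complex.smul_im, Complex.smul_re, smul_eq_mul] at him ⊢
  rcases hb.eq_or_lt with rfl | hb0
  · simpa using h
  · have := hw ((mul_eq_zero.1 him).resolve_left hb0.ne')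
    nlinarith

namespace IsSlitCovering

variable {E : Set ℂ} {lam : ℝ} {ξ : ℂ → ℂ} (hξ : IsSlitCovering E lam ξ)
include hξ

lemma slit_subset : slit lam ⊆ Eᶜ := fun w hw hE =>
  (hξ.re_le w hE).not_gt (hw (hξ.im_eq_zero w hE))

/-- The fundamental domain is a single sheet over the slit plane. -/
lemma exists_sheet : ∃ σ : ℂ → ℂ, ContinuousOn σ (slit lam) ∧ MapsTo σ (slit lam) disk ∧
    (∀ w ∈ slit lam, ξ (σ w) = w) ∧ ∀ z ∈ slitComponent lam ξ, σ (ξ z) = z := by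
  have h0 : (0 : ℂ) ∈ slit lam := by simp [slit, hξ.lam_neg]
  obtain ⟨σ, hσ, hσd, hσξ, hσ0⟩ := hξ.exists_liftOn (isOpen_slit lam) h0
    (starConvex_slit hξ.lam_neg) continuousOn_id hξ.slit_subset h0 zero_mem_disk hξ.map_zero
  have hF := slitComponent_subset (lam := lam) (ξ := ξ)
  refine ⟨σ, hσ, hσd, hσξ, hξ.eqOn_lift ℂ _ isPreconnected_slitComponent (σ ∘ ξ) id
    (hσ.comp (hξ.continuousOn.mono fun z hz => (hF hz).1) fun z hz => (hF hz).2) continuousOn_id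
    (fun z hz => hσd (hF hz).2) (fun z hz => (hF hz).1) (fun z hz => hσξ _ (hF hz).2) 0
    hξ.zero_mem_slitComponent ?_⟩
  rw [Function.comp_apply, hξ.map_zero, hσ0, id]

/-- Let `g` be the local section through `z`. Near `z` the fundamental domain has a point over the
half-plane where `σ` and `g` agree, so they agree on the convex set of half-plane points near `ξ z`,
and `σ` inherits the limit of `g`. -/
lemma tendsto_sheet {σ : ℂ → ℂ} (hσ : ContinuousOn σ (slit lam)) (hσd : MapsTo σ (slit lam) disk)
    (hσξ : ∀ w ∈ slit lam, ξ (σ w) = w) (hσF : ∀ z ∈ slitComponent lam ξ, σ (ξ z) = z) {s : ℝ}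
    {z : ℂ} (hz : z ∈ disk) (hcl : z ∈ closure (slitComponent lam ξ ∩ ξ ⁻¹' halfPlane s)) :
    Tendsto σ (𝓝[halfPlane s] (ξ z)) (𝓝 z) := by
  obtain ⟨ε, hε, hE⟩ := hξ.exists_ball_subset hz
  obtain ⟨g, hg, hgd, hgξ, hg0⟩ := hξ.exists_section hz hε hE
  have hball : ball (ξ z) ε ∈ 𝓝 (ξ z) := ball_mem_nhds _ hε
  have hgc : ContinuousAt g (ξ z) := hg.continuousAt hball
  obtain ⟨U, hU, hinj⟩ := hξ.exists_injOn z hz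
  have hgU : g ⁻¹' U ∈ 𝓝 (ξ z) := hgc.preimage_mem_nhds (by rwa [hg0])
  have hpre : ξ ⁻¹' (g ⁻¹' U ∩ ball (ξ z) ε) ∈ 𝓝 z :=
    (hξ.differentiableAt hz).continuousAt.preimage_mem_nhds (inter_mem hgU hball)
  obtain ⟨y, ⟨hyU, hyg, hyb⟩, hyF, hyH⟩ := mem_closure_iff_nhds.1 hcl _ (inter_mem hU hpre)
  have hgy : g (ξ y) = y := hinj hyg hyU (hgξ _ hyb)
  have heq : EqOn σ g (ball (ξ z) ε ∩ halfPlane s) := by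
    refine hξ.eqOn_lift ℂ _ ((convex_ball _ _).inter (convex_halfPlane s)).isPreconnected σ g
      (hσ.mono (inter_subset_right.trans (halfPlane_subset_slit s lam)))
      (hg.mono inter_subset_left) (fun w hw => hσd (halfPlane_subset_slit s lam hw.2))
      (fun w hw => hgd hw.1) (fun w hw => ?_) (ξ y) ⟨hyb, hyH⟩ (by rw [hgy, hσF y hyF])
    rw [hσξ w (halfPlane_subset_slit s lam hw.2), hgξ w hw.1]
  have ht : Tendsto g (𝓝[halfPlane s] (ξ z)) (𝓝 z) := by
    have := hgc.tendsto
    rw [hg0] at this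
    exact this.mono_left nhdsWithin_le_nhds
  refine ht.congr' ?_
  filter_upwards [self_mem_nhdsWithin, nhdsWithin_le_nhds hball] with w hw hwb
  exact (heq ⟨hwb, hw⟩).symm

lemma eq_of_mem_closure {s t : ℝ} (hs : s ≠ 0) {z z' : ℂ} (hz : z ∈ disk) (hz' : z' ∈ disk)
    (hzt : ξ z = t) (hzt' : ξ z' = t)
    (hcl : z ∈ closure (slitComponent lam ξ ∩ ξ ⁻¹' halfPlane s))
    (hcl' : z' ∈ closure (slitComponent lam ξ ∩ ξ ⁻¹' halfPlane s)) : z = z' := by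
  obtain ⟨σ, hσ, hσd, hσξ, hσF⟩ := hξ.exists_sheet
  have h1 := hξ.tendsto_sheet hσ hσd hσξ hσF hz hcl
  have h2 := hξ.tendsto_sheet hσ hσd hσξ hσF hz' hcl'
  rw [hzt] at h1
  rw [hzt'] at h2
  have := nhdsWithin_halfPlane_neBot hs t
  exact tendsto_nhds_unique h1 h2

/-- A frontier point lies over the open ray to the left of `lam`, so nearby points of the component
have non-real images. -/
lemma mem_closure_halfPlane {z : ℂ} (hz : z ∈ disk) (hzf : z ∈ frontier (slitComponent lam ξ)) :
    ∃ s ∈ ({1, -1} : Set ℝ), z ∈ closure (slitComponent lam ξ ∩ ξ ⁻¹' halfPlane s) := by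
  have hs := FiniteGap.notMem_slit.1 (hξ.notMem_slit_of_mem_frontier hz hzf)
  have hlt : (ξ z).re < lam := hs.2.lt_of_ne fun h => hξ.mapsTo hz (by
    rw [show ξ z = lam from Complex.ext h (by simpa using hs.1)]; exact hξ.lam_mem)
  have hev : ∀ᶠ y in 𝓝 z, (ξ y).re < lam :=
    (Complex.continuous_re.continuousAt.comp
      (hξ.differentiableAt hz).continuousAt).eventually_lt continuousAt_const hlt
  have hunion : z ∈ closure ((slitComponent lam ξ ∩ ξ ⁻¹' halfPlane 1) ∪
      (slitComponent lam ξ ∩ ξ ⁻¹' halfPlane (-1))) := by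
    rw [mem_closure_iff_nhds]
    intro V hV
    obtain ⟨y, ⟨hyV, hyre⟩, hyF⟩ :=
      mem_closure_iff_nhds.1 (frontier_subset_closure hzf) _ (inter_mem hV hev)
    refine ⟨y, hyV, ?_⟩
    have him : (ξ y).im ≠ 0 := fun h => (show (ξ y).re < lam from hyre).not_gt
      ((slitComponent_subset hyF).2 h)
    rcases him.lt_or_gt with h | h
    · exact Or.inr ⟨hyF, by simpa [halfPlane] using h⟩
    · exact Or.inl ⟨hyF, by simpa [halfPlane] using h⟩
  rw [closure_union] at hunion
  rcases hunion with h | h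
  · exact ⟨1, by simp, h⟩
  · exact ⟨-1, by simp, h⟩

omit hξ in
lemma ne_zero_of_mem_signs {s : ℝ} (hs : s ∈ ({1, -1} : Set ℝ)) : s ≠ 0 := by
  rcases hs with rfl | rfl <;> norm_num

/-- A side lies over a whole gap. -/
lemma exists_mem_orthoCircle {c z : ℂ} (hc : IsReflection ξ c) (hz : z ∈ disk)
    (hzc : z ∈ orthoCircle c) {t t' : ℝ} (ht : ξ z = t) (h : SameGap E t t') :
    ∃ z' ∈ disk, z' ∈ orthoCircle c ∧ ξ z' = t' := by
  -- The segment from `t` to `t'`, with the parameter clamped to `[0, 1]` so that the path is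
  -- defined on the simply connected space `ℝ`.
  set f : ℝ → ℂ := fun s => ((t + max 0 (min 1 s) * (t' - t) : ℝ) : ℂ) with hf
  have hfE : ∀ s, f s ∉ E := fun s => h _ <| by
    have h0 : 0 ≤ max 0 (min 1 s) := le_max_left _ _
    have h1 : max 0 (min 1 s) ≤ 1 := max_le zero_le_one (min_le_left _ _)
    rcases le_total t t' with hle | hle
    · rw [uIcc_of_le hle]; constructor <;> nlinarith
    · rw [uIcc_of_ge hle]; constructor <;> nlinarith
  obtain ⟨g, hg, hgd, hgξ, hg0⟩ := hξ.exists_lift ℝ f (by fun_prop) hfE 0 z hz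
    (by simp [hf, ht])
  refine ⟨g 1, hgd 1, ?_, by simp [hgξ, hf]⟩
  rw [← reflection_eq_self_iff hc.1 (ne_of_mem_disk hc.1 (hgd 1))]
  refine hξ.eqOn_lift ℝ univ isPreconnected_univ (reflection c ∘ g) g
    ((continuousOn_reflection hc.1).comp hg.continuousOn fun s _ => hgd s) hg.continuousOn
    (fun s _ => reflection_mem_disk hc.1 (hgd s)) (fun s _ => hgd s) (fun s _ => ?_) 0
    (mem_univ _) ?_ (mem_univ 1)
  · rw [Function.comp_apply, hc.2 _ (hgd s), hgξ, hf, Complex.conj_ofReal]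
  · rw [Function.comp_apply, hg0]; exact inversion_of_mem_sphere hzc

lemma sameGap_of_mem_orthoCircle {c z z' : ℂ} (hc : IsReflection ξ c) (hz : z ∈ disk)
    (hzc : z ∈ orthoCircle c) (hz' : z' ∈ disk) (hzc' : z' ∈ orthoCircle c) :
    SameGap E (ξ z).re (ξ z').re := by
  intro s hs hsE
  have hcont : ContinuousOn (fun y => (ξ y).re) (orthoCircle c ∩ disk) :=
    Complex.continuous_re.comp_continuousOn (hξ.continuousOn.mono inter_subset_right)
  have hpre := (isPreconnected_orthoCircle_inter hc.1).image _ hcont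
  have hsub := hpre.ordConnected.uIcc_subset ⟨z, ⟨hzc, hz⟩, rfl⟩ ⟨z', ⟨hzc', hz'⟩, rfl⟩
  obtain ⟨w, hw, hws⟩ := hsub hs
  refine hξ.mapsTo hw.2 ?_
  rwa [show ξ w = s from Complex.ext hws (by simpa using hc.im_eq_zero hw.2 hw.1)]

/-- Two sides over the same gap coincide or are complex conjugates of each other. -/
lemma eq_or_eq_conj {c d z w : ℂ} (hc : c ∈ boundaryCenters (slitComponent lam ξ))
    (hd : d ∈ boundaryCenters (slitComponent lam ξ)) (hz : z ∈ disk) (hzc : z ∈ orthoCircle c)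
    (hw : w ∈ disk) (hwd : w ∈ orthoCircle d) (h : SameGap E (ξ z).re (ξ w).re) :
    d = c ∨ d = conj c := by
  have hcs := hξ.isSide_of_mem hc
  have hds := hξ.isSide_of_mem hd
  obtain ⟨z', hz', hzc', hξz'⟩ := hξ.exists_mem_orthoCircle hcs.1 hz hzc
    (Complex.ext rfl (by simpa using hcs.1.im_eq_zero hz hzc)) h
  have hξw : ξ w = ((ξ w).re : ℂ) := Complex.ext rfl (by simpa using hds.1.im_eq_zero hw hwd)
  obtain ⟨s, hs, hcl⟩ := hξ.mem_closure_halfPlane hz' (hc.2 ⟨hzc', hz'⟩)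
  obtain ⟨s', hs', hcl'⟩ := hξ.mem_closure_halfPlane hw (hd.2 ⟨hwd, hw⟩)
  -- If both sides are approached from the same half-plane, the two boundary points coincide;
  -- otherwise one of them is conjugated first.
  by_cases hss : s = s'
  · subst hss
    have := hξ.eq_of_mem_closure (ne_zero_of_mem_signs hs) hz' hw hξz' hξw hcl hcl'
    subst this
    exact Or.inl (hξ.eq_of_isReflection hds.1 hcs.1 hz' hwd hzc')
  · have hneg : s' = -s := by
      rcases hs with rfl | rfl <;> rcases hs' with rfl | rfl <;>
        first | exact absurd rfl hss | norm_num
    subst hneg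
    have hcl2 : conj z' ∈ closure (slitComponent lam ξ ∩ ξ ⁻¹' halfPlane (-s)) := by
      refine closure_mono (image_subset_iff.2 fun y hy => ?_)
        (mem_closure_image Complex.continuous_conj.continuousAt hcl)
      refine ⟨hξ.conj_mem_slitComponent hy.1, ?_⟩
      have hyH := hy.2
      simp only [halfPlane, mem_preimage, mem_ofPred_eq] at hyH ⊢
      rw [hξ.map_conj (slitComponent_subset hy.1).1, Complex.conj_im]
      linarith
    have hξc : ξ (conj z') = ((ξ w).re : ℂ) := by
      rw [hξ.map_conj hz', hξz', Complex.conj_ofReal]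
    have := hξ.eq_of_mem_closure (ne_zero_of_mem_signs hs') (conj_mem_disk hz') hw hξc hξw hcl2 hcl'
    subst this
    exact Or.inr (hξ.eq_of_isReflection hds.1 (hξ.isSide_of_mem (hξ.conj_mem_boundaryCenters hc)).1
      hw hwd (conj_mem_orthoCircle.2 hzc'))

/-- There are finitely many sides if there are finitely many gaps. -/
lemma finite_boundaryCenters {T : Set ℝ} (hT : T.Finite)
    (hgap : ∀ t ≤ lam, (t : ℂ) ∉ E → ∃ t' ∈ T, SameGap E t t') :
    (boundaryCenters (slitComponent lam ξ)).Finite := by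
  -- Each side is labelled by the representative of its gap and a half-plane from which the domain
  -- approaches it; the label determines the side.
  have key : ∀ c ∈ boundaryCenters (slitComponent lam ξ), ∃ q ∈ T ×ˢ ({1, -1} : Set ℝ),
      ∃ z ∈ disk, z ∈ orthoCircle c ∧ ξ z = (q.1 : ℂ) ∧
        z ∈ closure (slitComponent lam ξ ∩ ξ ⁻¹' halfPlane q.2) := by
    intro c hc
    have hcs := hξ.isSide_of_mem hc
    obtain ⟨z, hzc, hz⟩ := nonempty_orthoCircle_inter hc.1
    have hξz : ξ z = ((ξ z).re : ℂ) := Complex.ext rfl (by simpa using hcs.1.im_eq_zero hz hzc)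
    obtain ⟨t', ht', hsame⟩ := hgap (ξ z).re (hcs.2 z hz hzc)
      (by rw [← hξz]; exact hξ.mapsTo hz)
    obtain ⟨z', hz', hzc', hξz'⟩ := hξ.exists_mem_orthoCircle hcs.1 hz hzc hξz hsame
    obtain ⟨s, hs, hcl⟩ := hξ.mem_closure_halfPlane hz' (hc.2 ⟨hzc', hz'⟩)
    exact ⟨(t', s), ⟨ht', hs⟩, z', hz', hzc', hξz', hcl⟩
  choose! q hq z hz hzc hξz hcl using key
  refine Set.Finite.of_injOn (f := q) hq (fun c hc d hd hcd => ?_)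
    (hT.prod (Set.toFinite ({1, -1} : Set ℝ)))
  have h1 := hξz c hc
  have h2 := hcl c hc
  rw [hcd] at h1 h2
  have heq := hξ.eq_of_mem_closure (ne_zero_of_mem_signs (hq d hd).2) (hz c hc) (hz d hd) h1
    (hξz d hd) h2 (hcl d hd)
  have h3 := hzc c hc
  rw [heq] at h3
  exact hξ.eq_of_isReflection (hξ.isSide_of_mem hc).1 (hξ.isSide_of_mem hd).1 (hz d hd) h3
    (hzc d hd)

end IsSlitCovering

/-! ### Geodesics with a common endpoint -/

/-- The point of height `y` on the geodesic that ends at the point `p` of the unit circle and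
corresponds to the vertical line through `a` in the upper half-plane model. -/
def geodesicPoint (p : ℂ) (a y : ℝ) : ℂ :=
  p * ((a + y * Complex.I - Complex.I) / (a + y * Complex.I + Complex.I))

lemma norm_cayley_lt_one {ζ : ℂ} (h : 0 < ζ.im) : ‖(ζ - Complex.I) / (ζ + Complex.I)‖ < 1 := by
  have h0 : 0 < ‖ζ + Complex.I‖ := norm_pos_iff.2 fun h1 => by
    have := congrArg Complex.im h1
    simp at this
    linarith
  rw [norm_div, div_lt_one h0, ← pow_lt_pow_iff_left₀ (norm_nonneg _) h0.le two_ne_zero]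
  simp only [← Complex.normSq_eq_norm_sq, Complex.normSq_apply]
  simp
  nlinarith

lemma geodesicPoint_mem_disk {p : ℂ} (hp : ‖p‖ = 1) {a y : ℝ} (hy : 0 < y) :
    geodesicPoint p a y ∈ disk := by
  rw [mem_disk, geodesicPoint, norm_mul, hp, one_mul]
  exact norm_cayley_lt_one (by simpa using hy)

/-- With `p` moved to infinity, geodesics ending at `p` become vertical lines. Orthogonality gives
`c = p * (1 + κ * I)`, and the abscissa is `-1 / κ`. -/
lemma exists_geodesicPoint_mem {p c : ℂ} (hp : ‖p‖ = 1) (hc : 1 < ‖c‖) (hpc : p ∈ orthoCircle c) :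
    ∃ a : ℝ, ∀ y > 0, geodesicPoint p a y ∈ orthoCircle c := by
  have hre : (p * conj c).re = 1 := by
    rw [← kleinMap_mem_orthoCircle hc hp.le, kleinMap_of_norm_eq_one hp]; exact hpc
  have hpp : p * conj p = 1 := by
    rw [Complex.mul_conj, Complex.normSq_eq_norm_sq, hp]; norm_num
  set κ : ℝ := (c * conj p).im with hκ
  have hcp : c * conj p = 1 + κ * Complex.I := by
    refine Complex.ext ?_ (by simp [hκ])
    have : (c * conj p).re = (p * conj c).re := by
      rw [← Complex.conj_re (c * conj p)]; simp [mul_comm]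
    rw [this, hre]; simp
  have hc' : c = p * (1 + κ * Complex.I) := by
    rw [← hcp]; linear_combination (-c) * hpp
  have hcn : ‖c‖ ^ 2 = 1 + κ ^ 2 := by
    rw [hc', norm_mul, hp, one_mul, ← Complex.normSq_eq_norm_sq, Complex.normSq_apply]
    simp; ring
  have hκ0 : κ ≠ 0 := fun h => by
    rw [h] at hcn; nlinarith
  have hr : orthoRadius c = |κ| := by
    rw [orthoRadius, hcn, add_sub_cancel_left, Real.sqrt_sq_eq_abs]
  refine ⟨-1 / κ, fun y hy => ?_⟩
  set ζ : ℂ := ((-1 / κ : ℝ) : ℂ) + y * Complex.I with hζ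
  have hζ0 : ζ + Complex.I ≠ 0 := fun h1 => by
    have := congrArg Complex.im h1
    simp [hζ] at this
    linarith
  have hdiff : geodesicPoint p (-1 / κ) y - c =
      p * ((-2 * Complex.I - κ * Complex.I * (ζ + Complex.I)) / (ζ + Complex.I)) := by
    rw [geodesicPoint, ← hζ]
    conv_lhs => rw [hc']
    field_simp
    ring
  rw [orthoCircle, Metric.mem_sphere, hr, dist_eq_norm, hdiff, norm_mul, hp, one_mul, norm_div,
    div_eq_iff (norm_ne_zero_iff.2 hζ0), ← Real.norm_eq_abs, ← Complex.norm_real, ← norm_mul,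
    ← pow_left_inj₀ (norm_nonneg _) (norm_nonneg _) two_ne_zero]
  simp only [← Complex.normSq_eq_norm_sq, Complex.normSq_apply]
  simp [hζ]
  field_simp
  ring

/-- A bounded holomorphic function on the disk cannot separate two geodesics with a common
endpoint. -/
lemma not_separated_of_bounded {φ : ℂ → ℂ} (hφ : DifferentiableOn ℂ φ disk)
    (hb : ∀ z ∈ disk, ‖φ z‖ ≤ 1) {p : ℂ} (hp : ‖p‖ = 1) {a a' δ : ℝ} (hδ : 0 < δ)
    (hsep : ∀ y > 0, δ ≤ dist (φ (geodesicPoint p a' y)) (φ (geodesicPoint p a y))) : False := by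
  -- The Schwarz lemma on the Euclidean disk of radius `y` about `a + y * I` bounds the difference
  -- by `2 * |a' - a| / y`. This `y` exceeds `|a' - a|` and makes the bound smaller than `δ`.
  set y : ℝ := |a' - a| + 1 + 2 * |a' - a| / δ with hy
  have h0 : 0 ≤ |a' - a| := abs_nonneg _
  have h1 : 0 ≤ 2 * |a' - a| / δ := by positivity
  have hypos : 0 < y := by linarith
  set f : ℂ → ℂ := fun ζ => φ (p * ((ζ - Complex.I) / (ζ + Complex.I))) with hf
  have him : ∀ ζ ∈ ball (a + y * Complex.I) y, 0 < ζ.im := fun ζ hζ => by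
    have := (Complex.abs_im_le_norm (ζ - (a + y * Complex.I))).trans_lt (mem_ball_iff_norm.1 hζ)
    rw [Complex.sub_im] at this
    simp at this
    linarith [(abs_lt.1 this).1]
  have hmem : ∀ ζ ∈ ball (a + y * Complex.I) y,
      p * ((ζ - Complex.I) / (ζ + Complex.I)) ∈ disk := fun ζ hζ => by
    rw [mem_disk, norm_mul, hp, one_mul]; exact norm_cayley_lt_one (him ζ hζ)
  have hdf : DifferentiableOn ℂ f (ball (a + y * Complex.I) y) := by
    refine hφ.comp ?_ hmem
    refine (differentiableOn_const _).mul (DifferentiableOn.div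
      (differentiableOn_id.sub (differentiableOn_const _))
      (differentiableOn_id.add (differentiableOn_const _)) fun ζ hζ h => ?_)
    have h2 := congrArg Complex.im h
    simp at h2
    linarith [him ζ hζ]
  have hcen : (a + y * Complex.I : ℂ) ∈ ball (a + y * Complex.I) y := mem_ball_self hypos
  have hmaps : MapsTo f (ball (a + y * Complex.I) y) (closedBall (f (a + y * Complex.I)) 2) :=
    fun ζ hζ => by
      rw [mem_closedBall, dist_eq_norm]
      refine (norm_sub_le _ _).trans ?_
      linarith [hb _ (hmem ζ hζ), hb _ (hmem _ hcen)]
  have hd : dist (a' + y * Complex.I : ℂ) (a + y * Complex.I) = |a' - a| := by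
    rw [dist_add_right, dist_eq_norm, ← Complex.ofReal_sub, Complex.norm_real, Real.norm_eq_abs]
  have key := Complex.dist_le_div_mul_dist_of_mapsTo_ball hdf hmaps
    (z := a' + y * Complex.I) (by rw [mem_ball, hd]; linarith)
  rw [hd] at key
  have hle : δ ≤ 2 / y * |a' - a| := (hsep y hypos).trans key
  rw [div_mul_eq_mul_div, le_div_iff₀ hypos, hy] at hle
  have : δ * (|a' - a| + 1 + 2 * |a' - a| / δ) = δ * (|a' - a| + 1) + 2 * |a' - a| := by
    field_simp
  nlinarith

/-! ### Bounded functions that separate real sets -/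

/-- The function `1 / (1 + √w)` on the slit plane. -/
def sqrtFun (w : ℂ) : ℂ := (1 + Complex.exp (Complex.log w / 2))⁻¹

lemma re_exp_half_log_pos {w : ℂ} (hw : w ∈ Complex.slitPlane) :
    0 < (Complex.exp (Complex.log w / 2)).re := by
  have h1 := Complex.neg_pi_lt_arg w
  have h2 : w.arg < Real.pi := lt_of_le_of_ne (Complex.arg_le_pi w)
    (Complex.mem_slitPlane_iff_arg.1 hw).1
  have him : (Complex.log w / 2).im = w.arg / 2 := by
    rw [Complex.div_ofNat_im, Complex.log_im]
  rw [Complex.exp_re, him]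
  exact mul_pos (Real.exp_pos _) (Real.cos_pos_of_mem_Ioo ⟨by linarith, by linarith⟩)

lemma one_add_exp_ne_zero {w : ℂ} (hw : w ∈ Complex.slitPlane) :
    1 + Complex.exp (Complex.log w / 2) ≠ 0 := fun h => by
  have := congrArg Complex.re h
  rw [Complex.add_re, Complex.one_re, Complex.zero_re] at this
  linarith [re_exp_half_log_pos hw]

lemma norm_sqrtFun_le {w : ℂ} (hw : w ∈ Complex.slitPlane) : ‖sqrtFun w‖ ≤ 1 := by
  rw [sqrtFun, norm_inv]
  refine inv_le_one_of_one_le₀ ?_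
  refine le_trans ?_ (Complex.re_le_norm _)
  rw [Complex.add_re, Complex.one_re]
  linarith [re_exp_half_log_pos hw]

lemma differentiableOn_sqrtFun : DifferentiableOn ℂ sqrtFun Complex.slitPlane := by
  intro w hw
  have := (Complex.differentiableAt_log hw).div_const 2
  exact (((differentiableAt_const 1).add this.cexp).inv
    (one_add_exp_ne_zero hw)).differentiableWithinAt

lemma sqrtFun_ofReal {r : ℝ} (hr : 0 < r) : sqrtFun r = ((1 + √r)⁻¹ : ℝ) := by
  have : Complex.exp (Complex.log r / 2) = (√r : ℝ) := by
    rw [← Complex.ofReal_log hr.le, Real.sqrt_eq_rpow, Real.rpow_def_of_pos hr, mul_one_div]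
    push_cast
    rfl
  rw [sqrtFun, this]
  push_cast
  rfl

/-- A holomorphic function on the complement of `E` with values in the slit plane separates the
sets `S` and `S'` of real numbers. -/
def Separated (E : Set ℂ) (S S' : Set ℝ) : Prop :=
  ∃ (h : ℂ → ℂ) (M M' : ℝ), DifferentiableOn ℂ h Eᶜ ∧ MapsTo h Eᶜ Complex.slitPlane ∧ M < M' ∧
    (∀ s ∈ S, (s : ℂ) ∉ E → ∃ r ≤ M, h s = (r : ℂ)) ∧
    ∀ s ∈ S', (s : ℂ) ∉ E → ∃ r ≥ M', h s = (r : ℂ)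

/-- `1 / (1 + √h)` is bounded and strictly decreasing in positive values of `h`, so `M < M'` keeps
its values along the two geodesics a fixed distance apart, against `not_separated_of_bounded`. -/
lemma IsRealCovering.not_separated {E : Set ℂ} {ξ : ℂ → ℂ} (hξ : IsRealCovering E ξ)
    {S S' : Set ℝ} (hsep : Separated E S S') {p : ℂ} (hp : ‖p‖ = 1) {a a' : ℝ}
    (ha : ∀ y > 0, ∃ s ∈ S, ξ (geodesicPoint p a y) = s)
    (ha' : ∀ y > 0, ∃ s ∈ S', ξ (geodesicPoint p a' y) = s) : False := by
  obtain ⟨h, M, M', hd, hm, hMM, hS, hS'⟩ := hsep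
  have hpos : ∀ r : ℝ, (r : ℂ) ∈ Complex.slitPlane → 0 < r := fun r hr => by
    simpa using hr
  have key : ∀ y > 0, ∃ r r' : ℝ, 0 < r ∧ r ≤ M ∧ M' ≤ r' ∧
      h (ξ (geodesicPoint p a y)) = r ∧ h (ξ (geodesicPoint p a' y)) = r' := by
    intro y hy
    obtain ⟨s, hs, hsξ⟩ := ha y hy
    obtain ⟨s', hs', hsξ'⟩ := ha' y hy
    have hE := hξ.mapsTo (geodesicPoint_mem_disk hp hy (a := a))
    have hE' := hξ.mapsTo (geodesicPoint_mem_disk hp hy (a := a'))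
    have hsl := hm hE
    rw [hsξ] at hE hsl ⊢
    rw [hsξ'] at hE' ⊢
    obtain ⟨r, hr, hrh⟩ := hS s hs hE
    obtain ⟨r', hr', hrh'⟩ := hS' s' hs' hE'
    exact ⟨r, r', hpos r (by rw [← hrh]; exact hsl), hr, hr', hrh, hrh'⟩
  have hM : 0 < M := by
    obtain ⟨r, r', h1, h2, -⟩ := key 1 one_pos
    linarith
  have hδ : 0 < (1 + √M)⁻¹ - (1 + √M')⁻¹ := by
    rw [sub_pos]
    have := Real.sqrt_lt_sqrt hM.le hMM
    exact inv_strictAnti₀ (by positivity) (by linarith)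
  refine not_separated_of_bounded (φ := sqrtFun ∘ h ∘ ξ)
    (differentiableOn_sqrtFun.comp (hd.comp hξ.differentiableOn hξ.mapsTo)
      (hm.comp hξ.mapsTo)) (fun z hz => norm_sqrtFun_le (hm (hξ.mapsTo hz))) hp hδ
    (a := a') (a' := a) fun y hy => ?_
  obtain ⟨r, r', hr0, hr, hr', e1, e2⟩ := key y hy
  have hr0' : 0 < r' := by linarith
  simp only [Function.comp_apply]
  rw [e1, e2, sqrtFun_ofReal hr0, sqrtFun_ofReal hr0', dist_eq_norm, ← Complex.ofReal_sub,
    Complex.norm_real]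
  refine le_trans ?_ (le_abs_self _)
  have h1 : (1 + √M)⁻¹ ≤ (1 + √r)⁻¹ := inv_anti₀ (by positivity)
    (by gcongr)
  have h2 : (1 + √r')⁻¹ ≤ (1 + √M')⁻¹ := inv_anti₀ (by positivity) (by gcongr)
  linarith

/-! ### Separation of the sides -/

/-- The gaps in `(-∞, lam] \ E` are finitely many and can be separated from each other and from
`(lam, ∞)` by holomorphic functions. -/
structure HasSeparatedGaps (E : Set ℂ) (lam : ℝ) : Prop where
  exists_finite : ∃ T : Set ℝ, T.Finite ∧
    ∀ t ≤ lam, (t : ℂ) ∉ E → ∃ t' ∈ T, SameGap E t t'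
  separated : ∀ t ≤ lam, ∀ t' ≤ lam, (t : ℂ) ∉ E → (t' : ℂ) ∉ E → ¬ SameGap E t t' →
    Separated E {s | SameGap E t s} {s | SameGap E t' s} ∨
      Separated E {s | SameGap E t' s} {s | SameGap E t s}
  separated_outer : ∀ t ≤ lam, (t : ℂ) ∉ E → Separated E (Ioi lam) {s | SameGap E t s}

lemma mem_orthoCircle_of_norm_eq_one {p c : ℂ} (hp : ‖p‖ = 1) (hc : 1 < ‖c‖) :
    p ∈ orthoCircle c ↔ (p * conj c).re = 1 := by
  rw [← kleinMap_mem_orthoCircle hc hp.le, kleinMap_of_norm_eq_one hp]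

lemma dist_centers_sq {c d : ℂ} (hc : 1 < ‖c‖) (hd : 1 < ‖d‖) :
    dist c d ^ 2 = orthoRadius c ^ 2 + orthoRadius d ^ 2 + 2 * (1 - (c * conj d).re) := by
  rw [dist_sq_eq, orthoRadius_sq hc, orthoRadius_sq hd]; ring

/-- In the Klein model the chords meet at `I * (c - d) / t`. Since `t ^ 2 - dist c d ^ 2` is the
product of the squared radii minus `(1 - (c * conj d).re) ^ 2`, the hypothesis puts this point
inside the disk. -/
lemma exists_common_point {c d : ℂ} (hc : 1 < ‖c‖) (hd : 1 < ‖d‖)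
    (h : |1 - (c * conj d).re| < orthoRadius c * orthoRadius d) :
    ∃ z ∈ disk, z ∈ orthoCircle c ∧ z ∈ orthoCircle d := by
  have hrc := orthoRadius_pos hc
  have hrd := orthoRadius_pos hd
  set t : ℝ := (conj c * d).im with ht
  have hsq : (1 - (c * conj d).re) ^ 2 < orthoRadius c ^ 2 * orthoRadius d ^ 2 := by
    rw [← mul_pow, ← sq_abs]
    exact pow_lt_pow_left₀ h (abs_nonneg _) two_ne_zero
  have ht2 : t ^ 2 = dist c d ^ 2 +
      (orthoRadius c ^ 2 * orthoRadius d ^ 2 - (1 - (c * conj d).re) ^ 2) := by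
    rw [dist_sq_eq, orthoRadius_sq hc, orthoRadius_sq hd, ht]
    simp only [← Complex.normSq_eq_norm_sq, Complex.normSq_apply]
    simp
    ring
  have ht0 : 0 < |t| := by
    rw [abs_pos]
    intro h0
    rw [h0] at ht2
    nlinarith [sq_nonneg (dist c d)]
  have ht0' : t ≠ 0 := abs_pos.1 ht0
  set k : ℂ := ((t⁻¹ : ℝ) : ℂ) * (Complex.I * (c - d)) with hk
  have hkn : ‖k‖ < 1 := by
    rw [hk, norm_mul, norm_mul, Complex.norm_I, one_mul, Complex.norm_real, Real.norm_eq_abs,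
      abs_inv, inv_mul_lt_iff₀ ht0, mul_one, ← dist_eq_norm, ← abs_of_nonneg (dist_nonneg (x := c)),
      ← sq_lt_sq]
    linarith
  refine ⟨kleinMap k, kleinMap_mem_disk (mem_disk.2 hkn),
    (kleinMap_mem_orthoCircle hc hkn.le).2 ?_, (kleinMap_mem_orthoCircle hd hkn.le).2 ?_⟩
  · rw [hk, mul_assoc, Complex.re_ofReal_mul, inv_mul_eq_one₀ ht0', ht]
    simp; ring
  · rw [hk, mul_assoc, Complex.re_ofReal_mul, inv_mul_eq_one₀ ht0', ht]
    simp; ring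

/-- The point dividing the segment of centers in the ratio of the radii satisfies both chord
equations, and these give `‖p‖ = 1`. -/
lemma exists_tangent_point {c d : ℂ} (hc : 1 < ‖c‖) (hd : 1 < ‖d‖)
    (h : 1 - (c * conj d).re = orthoRadius c * orthoRadius d) :
    ∃ p : ℂ, ‖p‖ = 1 ∧ p ∈ orthoCircle c ∧ p ∈ orthoCircle d := by
  have hrc := orthoRadius_pos hc
  have hrd := orthoRadius_pos hd
  set r := orthoRadius c with hr
  set r' := orthoRadius d with hr'
  have hrr : 0 < r + r' := by positivity
  have hc2 : ‖c‖ ^ 2 = 1 + r ^ 2 := by rw [hr, orthoRadius_sq hc]; ring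
  have hd2 : ‖d‖ ^ 2 = 1 + r' ^ 2 := by rw [hr', orthoRadius_sq hd]; ring
  have hcc : (c * conj c).re = 1 + r ^ 2 := by
    rw [Complex.mul_conj, Complex.ofReal_re, Complex.normSq_eq_norm_sq, hc2]
  have hdd : (d * conj d).re = 1 + r' ^ 2 := by
    rw [Complex.mul_conj, Complex.ofReal_re, Complex.normSq_eq_norm_sq, hd2]
  have hcd : (c * conj d).re = 1 - r * r' := by linarith
  have hdc : (d * conj c).re = 1 - r * r' := by
    rw [← hcd, ← Complex.conj_re (c * conj d)]; simp [mul_comm]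
  set p : ℂ := (((r + r')⁻¹ : ℝ) : ℂ) * ((r' : ℝ) * c + (r : ℝ) * d) with hp
  have hpc : (p * conj c).re = 1 := by
    rw [hp, mul_assoc, Complex.re_ofReal_mul, add_mul, Complex.add_re, mul_assoc, mul_assoc,
      Complex.re_ofReal_mul, Complex.re_ofReal_mul, hcc, hdc, inv_mul_eq_one₀ hrr.ne']
    ring
  have hpd : (p * conj d).re = 1 := by
    rw [hp, mul_assoc, Complex.re_ofReal_mul, add_mul, Complex.add_re, mul_assoc, mul_assoc,
      Complex.re_ofReal_mul, Complex.re_ofReal_mul, hcd, hdd, inv_mul_eq_one₀ hrr.ne']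
    ring
  have hpn : ‖p‖ = 1 := by
    have h1 : ‖p‖ ^ 2 = 1 := by
      have : (p * conj p).re = (r + r')⁻¹ * (r' * (p * conj c).re + r * (p * conj d).re) := by
        conv_lhs => rw [hp]
        rw [← hp]
        rw [show conj p = (((r + r')⁻¹ : ℝ) : ℂ) * ((r' : ℝ) * conj c + (r : ℝ) * conj d) by
          rw [hp]; simp]
        rw [show p * ((((r + r')⁻¹ : ℝ) : ℂ) * ((r' : ℝ) * conj c + (r : ℝ) * conj d)) =
          (((r + r')⁻¹ : ℝ) : ℂ) * ((r' : ℝ) * (p * conj c) + (r : ℝ) * (p * conj d)) by ring]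
        rw [Complex.re_ofReal_mul, Complex.add_re, Complex.re_ofReal_mul, Complex.re_ofReal_mul]
      rw [← Complex.normSq_eq_norm_sq, ← Complex.ofReal_re (Complex.normSq p), ← Complex.mul_conj,
        this, hpc, hpd, inv_mul_eq_one₀ hrr.ne']
      ring
    exact (pow_eq_one_iff_of_nonneg (norm_nonneg _) two_ne_zero).1 h1
  exact ⟨p, hpn, (mem_orthoCircle_of_norm_eq_one hpn hc).2 hpc,
    (mem_orthoCircle_of_norm_eq_one hpn hd).2 hpd⟩

namespace IsSlitCovering

variable {E : Set ℂ} {lam : ℝ} {ξ : ℂ → ℂ} (hξ : IsSlitCovering E lam ξ)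
include hξ

/-- A side with the endpoint `p`, as a geodesic over a gap. -/
lemma exists_geodesic {c p : ℂ} (hc : c ∈ boundaryCenters (slitComponent lam ξ)) (hp : ‖p‖ = 1)
    (hpc : p ∈ orthoCircle c) : ∃ (a : ℝ) (z : ℂ), z ∈ disk ∧ z ∈ orthoCircle c ∧
      (ξ z).re ≤ lam ∧ (((ξ z).re : ℝ) : ℂ) ∉ E ∧
      ∀ y > 0, ∃ s ∈ {s | SameGap E (ξ z).re s}, ξ (geodesicPoint p a y) = s := by
  have hcs := hξ.isSide_of_mem hc
  obtain ⟨a, ha⟩ := exists_geodesicPoint_mem hp hc.1 hpc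
  have hreal : ∀ y > 0, ξ (geodesicPoint p a y) = ((ξ (geodesicPoint p a y)).re : ℂ) := fun y hy =>
    Complex.ext rfl (by simpa using hcs.1.im_eq_zero (geodesicPoint_mem_disk hp hy) (ha y hy))
  have h1 := geodesicPoint_mem_disk hp one_pos (a := a)
  refine ⟨a, geodesicPoint p a 1, h1, ha 1 one_pos, hcs.2 _ h1 (ha 1 one_pos), ?_,
    fun y hy => ⟨_, hξ.sameGap_of_mem_orthoCircle hcs.1 h1 (ha 1 one_pos)
      (geodesicPoint_mem_disk hp hy) (ha y hy), hreal y hy⟩⟩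
  rw [← hreal 1 one_pos]
  exact hξ.mapsTo h1

/-- If `p` were in the open disk, the real diameter would cross the side, but `ξ > lam` on the
former and `ξ ≤ lam` on the latter. If `p` were on the circle, diameter and side would be geodesics
with a common endpoint, lying over sets that a bounded function separates. -/
lemma notMem_closedBall_of_im_eq_zero (hE : HasSeparatedGaps E lam) {c p : ℂ}
    (hc : c ∈ boundaryCenters (slitComponent lam ξ)) (hp : ‖p‖ = 1) (him : p.im = 0) :
    p ∉ closedBall c (orthoRadius c) := by
  have hcs := hξ.isSide_of_mem hc
  intro hpb
  rcases (mem_closedBall.1 hpb).lt_or_eq with hlt | heq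
  · have hcont : ContinuousOn (fun t : ℝ => dist ((t : ℂ) * p) c) (Icc 0 1) := by fun_prop
    have h0 := zero_notMem_closedBall hc.1
    rw [mem_closedBall, not_le] at h0
    obtain ⟨t, ht, htr⟩ := intermediate_value_Ioo' zero_le_one hcont
      (show orthoRadius c ∈ Ioo _ _ from ⟨by simpa using hlt, by simpa using h0⟩)
    have htd : (t : ℂ) * p ∈ disk := by
      rw [mem_disk, norm_mul, hp, mul_one, Complex.norm_real, Real.norm_eq_abs, abs_of_pos ht.1]
      exact ht.2
    have h1 := hξ.lt_re_of_im_eq_zero hξ.lam_mem hξ.lam_neg htd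
      (by rw [Complex.im_ofReal_mul, him, mul_zero])
    exact h1.not_ge (hcs.2 _ htd htr)
  · obtain ⟨a, z, hz, hzc, hzl, hzE, ha⟩ := hξ.exists_geodesic hc hp heq
    refine hξ.not_separated (hE.separated_outer _ hzl hzE) hp (a := 0) (fun y hy => ?_) ha
    have hd := geodesicPoint_mem_disk hp hy (a := 0)
    have hgim : (geodesicPoint p 0 y).im = 0 := by
      have hy1 : ((y : ℂ) + 1) ≠ 0 := by
        have : (y + 1 : ℝ) ≠ 0 := by positivity
        exact_mod_cast this
      have : geodesicPoint p 0 y = (((y - 1) / (y + 1) : ℝ) : ℂ) * p := by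
        rw [geodesicPoint, mul_comm]
        congr 1
        push_cast
        rw [zero_add, ← sub_one_mul, ← add_one_mul, mul_div_mul_right _ _ Complex.I_ne_zero]
      rw [this, Complex.im_ofReal_mul, him, mul_zero]
    refine ⟨_, hξ.lt_re_of_im_eq_zero hξ.lam_mem hξ.lam_neg hd hgim, Complex.ext rfl ?_⟩
    rw [Complex.ofReal_im, ← Complex.conj_eq_iff_im, ← hξ.map_conj hd, conj_eq_self_of_im hgim]

/-- Sides over different gaps are separated by a bounded function. Distinct sides over one gap are
conjugate with non-real centers, so a common endpoint would be real, which is already excluded. -/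
lemma notMem_of_tangent (hE : HasSeparatedGaps E lam) {c d p : ℂ}
    (hc : c ∈ boundaryCenters (slitComponent lam ξ))
    (hd : d ∈ boundaryCenters (slitComponent lam ξ)) (hcd : c ≠ d) (hp : ‖p‖ = 1)
    (hpc : p ∈ orthoCircle c) : p ∉ orthoCircle d := by
  intro hpd
  obtain ⟨a, z, hz, hzc, hzl, hzE, ha⟩ := hξ.exists_geodesic hc hp hpc
  obtain ⟨b, w, hw, hwd, hwl, hwE, hb⟩ := hξ.exists_geodesic hd hp hpd
  by_cases hsame : SameGap E (ξ z).re (ξ w).re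
  · rcases hξ.eq_or_eq_conj hc hd hz hzc hw hwd hsame with h | h
    · exact hcd h.symm
    · have h1 := (mem_orthoCircle_of_norm_eq_one hp hc.1).1 hpc
      have h2 := (mem_orthoCircle_of_norm_eq_one hp hd.1).1 hpd
      rw [h, Complex.conj_conj] at h2
      simp only [Complex.mul_re, Complex.conj_re, Complex.conj_im] at h1 h2
      have h3 : p.im * c.im = 0 := by linarith
      rcases mul_eq_zero.1 h3 with him | him
      · exact hξ.notMem_closedBall_of_im_eq_zero hE hc hp him (sphere_subset_closedBall hpc)
      · exact hcd (by rw [h, conj_eq_self_of_im him])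
  · rcases hE.separated _ hzl _ hwl hzE hwE hsame with h | h
    · exact hξ.not_separated h hp ha hb
    · exact hξ.not_separated h hp hb ha

/-- The domain lies outside the disk of `d` and accumulates on the whole side `c`; a nested `c`
would have to meet the circle of `d` inside the disk, where distinct sides never meet. -/
lemma not_nested {c d : ℂ} (hc : c ∈ boundaryCenters (slitComponent lam ξ))
    (hd : d ∈ boundaryCenters (slitComponent lam ξ)) (hcd : c ≠ d) :
    orthoRadius d < orthoRadius c + dist c d := by
  by_contra! hle
  obtain ⟨z, hzc, hz⟩ := nonempty_orthoCircle_inter hc.1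
  have hcl : z ∈ (ball d (orthoRadius d))ᶜ :=
    closure_minimal (fun y hy hyd => hξ.slitComponent_disjoint (hξ.isSide_of_mem hd) hy
      (ball_subset_closedBall hyd)) isOpen_ball.isClosed_compl
      (frontier_subset_closure (hc.2 ⟨hzc, hz⟩))
  rw [mem_compl_iff, mem_ball, not_lt] at hcl
  have hzc' := Metric.mem_sphere.1 hzc
  have hzd : z ∈ orthoCircle d := le_antisymm
    (by linarith [dist_triangle z c d]) hcl
  exact hcd (hξ.eq_of_isReflection (hξ.isSide_of_mem hc).1 (hξ.isSide_of_mem hd).1 hz hzc hzd)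

/-- By `dist_centers_sq`, the position of two circles is read off by comparing `1 - (c * conj d).re`
with plus or minus the product of the radii: strictly between, they cross; at or below the lower
value, they are nested; at the upper value, they are tangent on the unit circle; above it, the
closed disks are disjoint. -/
lemma schottkyFamily (hE : HasSeparatedGaps E lam) :
    SchottkyFamily (boundaryCenters (slitComponent lam ξ)) := by
  obtain ⟨T, hT, hgap⟩ := hE.exists_finite
  refine ⟨hξ.finite_boundaryCenters hT hgap, fun c hc => hc.1,
    fun c => hξ.conj_mem_boundaryCenters, fun c hc d hd hcd => ?_⟩
  have hrc := orthoRadius_pos hc.1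
  have hrd := orthoRadius_pos hd.1
  have hdist := dist_centers_sq hc.1 hd.1
  rcases lt_trichotomy (1 - (c * conj d).re) (orthoRadius c * orthoRadius d) with h | h | h
  · exfalso
    by_cases h' : -(orthoRadius c * orthoRadius d) < 1 - (c * conj d).re
    · obtain ⟨z, hz, hzc, hzd⟩ := exists_common_point hc.1 hd.1 (abs_lt.2 ⟨h', h⟩)
      exact hcd (hξ.eq_of_isReflection (hξ.isSide_of_mem hc).1 (hξ.isSide_of_mem hd).1 hz hzc hzd)
    · have h1 := hξ.not_nested hc hd hcd
      have h2 := hξ.not_nested hd hc hcd.symm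
      rw [dist_comm] at h2
      have h3 : (orthoRadius c - orthoRadius d) ^ 2 < dist c d ^ 2 :=
        sq_lt_sq.2 (by rw [abs_of_nonneg (dist_nonneg (x := c)), abs_lt]; constructor <;> linarith)
      nlinarith
  · exfalso
    obtain ⟨p, hp, hpc, hpd⟩ := exists_tangent_point hc.1 hd.1 h
    exact hξ.notMem_of_tangent hE hc hd hcd hp hpc hpd
  · have h3 : (orthoRadius c + orthoRadius d) ^ 2 < dist c d ^ 2 := by nlinarith
    exact lt_of_pow_lt_pow_left₀ 2 dist_nonneg h3

theorem exists_arcLength_remainder_le (hE : HasSeparatedGaps E lam) :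
    ∃ A C : ℝ, 0 < A ∧ ∀ m : ℕ, arcLength (remainder (slitComponent lam ξ) m) ≤
      ENNReal.ofReal (C * Real.exp (-A * m)) := by
  have hB := hξ.schottkyFamily hE
  exact FiniteGap.exists_arcLength_remainder_le hB
    (fun c hc => hξ.notMem_closedBall_of_im_eq_zero hE hc (by simp) (by simp))
    fun z hz hzc => hξ.mem_closure_slitComponent hB.finite hz hzc

end IsSlitCovering

/-! ### A finite coordinate on the complement of the bands -/

/-- The coordinate `1 / (w - b)` on the Riemann sphere minus the point `b`. -/
def coord (b : ℝ) (w : OnePoint ℂ) : ℂ := w.elim 0 fun v => (v - b)⁻¹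

open Classical in
/-- The inverse of `coord b`. -/
def coordInv (b : ℝ) (ζ : ℂ) : OnePoint ℂ :=
  if ζ = 0 then OnePoint.infty else ((b + ζ⁻¹ : ℂ) : OnePoint ℂ)

lemma coord_infty (b : ℝ) : coord b OnePoint.infty = 0 := rfl

lemma coord_coe (b : ℝ) (v : ℂ) : coord b (v : OnePoint ℂ) = (v - b)⁻¹ := rfl

lemma coordInv_zero (b : ℝ) : coordInv b 0 = OnePoint.infty := if_pos rfl

lemma coordInv_of_ne (b : ℝ) {ζ : ℂ} (h : ζ ≠ 0) :
    coordInv b ζ = ((b + ζ⁻¹ : ℂ) : OnePoint ℂ) := if_neg h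

lemma coord_coordInv (b : ℝ) (ζ : ℂ) : coord b (coordInv b ζ) = ζ := by
  rcases eq_or_ne ζ 0 with rfl | h
  · rw [coordInv_zero, coord_infty]
  · rw [coordInv_of_ne b h, coord_coe, add_sub_cancel_left, inv_inv]

/-- The point `b` is excluded because the convention `0⁻¹ = 0` gives it the coordinate of `∞`. -/
lemma coordInv_coord (b : ℝ) {w : OnePoint ℂ} (hw : w ≠ ((b : ℂ) : OnePoint ℂ)) :
    coordInv b (coord b w) = w := by
  induction w using OnePoint.rec with
  | infty => rw [coord_infty, coordInv_zero]
  | coe v =>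
    have : v - b ≠ 0 := sub_ne_zero.2 fun h => hw (by rw [h])
    rw [coord_coe, coordInv_of_ne b (inv_ne_zero this), inv_inv, add_sub_cancel]

lemma continuous_coordInv (b : ℝ) : Continuous (coordInv b) := by
  rw [continuous_iff_continuousAt]
  intro ζ
  rcases eq_or_ne ζ 0 with rfl | h
  · rw [continuousAt_iff_punctured_nhds, coordInv_zero]
    have h1 : Tendsto (fun ζ : ℂ => (b : ℂ) + ζ⁻¹) (𝓝[≠] 0) (cocompact ℂ) := by
      rw [← Metric.cobounded_eq_cocompact]
      exact (tendsto_const_add_cobounded _).comp tendsto_inv₀_nhdsNE_zero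
    have h2 : Tendsto ((↑) : ℂ → OnePoint ℂ) (cocompact ℂ) (𝓝 OnePoint.infty) := by
      rw [← coclosedCompact_eq_cocompact]
      exact OnePoint.tendsto_coe_infty
    refine (h2.comp h1).congr' ?_
    filter_upwards [self_mem_nhdsWithin] with y hy using (coordInv_of_ne b hy).symm
  · have h1 : ContinuousAt (fun ζ : ℂ => ((b + ζ⁻¹ : ℂ) : OnePoint ℂ)) ζ :=
      OnePoint.continuous_coe.continuousAt.comp (continuousAt_const.add (continuousAt_inv₀ h))
    refine h1.congr ?_
    filter_upwards [isOpen_ne.mem_nhds h] with y hy using (coordInv_of_ne b hy).symm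

/-- The set of real numbers `S` in the coordinate `coord b`. -/
def coordSet (b : ℝ) (S : Set ℝ) : Set ℂ := coordInv b ⁻¹' (sphereCompl S)ᶜ

lemma mem_coordSet {b : ℝ} {S : Set ℝ} {ζ : ℂ} :
    ζ ∈ coordSet b S ↔ ζ ≠ 0 ∧ ∃ s ∈ S, (b : ℂ) + ζ⁻¹ = s := by
  rw [coordSet, sphereCompl, compl_compl, mem_preimage]
  rcases eq_or_ne ζ 0 with rfl | h
  · simp [coordInv_zero]
  · rw [coordInv_of_ne b h]
    simp only [mem_image, OnePoint.coe_eq_coe, ne_eq, h, not_false_eq_true, true_and, eq_comm]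

lemma ofReal_mem_coordSet {b : ℝ} {S : Set ℝ} {t : ℝ} :
    (t : ℂ) ∈ coordSet b S ↔ t ≠ 0 ∧ b + t⁻¹ ∈ S := by
  rw [mem_coordSet]
  refine and_congr (by simp) ⟨?_, fun h => ⟨_, h, by push_cast; rfl⟩⟩
  rintro ⟨s, hs, h⟩
  have : b + t⁻¹ = s := by exact_mod_cast h
  rwa [this]

lemma exists_ofReal_of_mem_coordSet {b : ℝ} {S : Set ℝ} {ζ : ℂ} (h : ζ ∈ coordSet b S) :
    ∃ t : ℝ, ζ = t ∧ t ≠ 0 ∧ b + t⁻¹ ∈ S := by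
  obtain ⟨-, s, hs, h2⟩ := mem_coordSet.1 h
  have hζ : ζ = ((s - b : ℝ) : ℂ)⁻¹ := by
    rw [Complex.ofReal_sub, ← h2, add_sub_cancel_left, inv_inv]
  have hζ' : ζ = (((s - b)⁻¹ : ℝ) : ℂ) := by rw [hζ, Complex.ofReal_inv]
  rw [hζ'] at h
  exact ⟨_, hζ', ofReal_mem_coordSet.1 h⟩

lemma isClosed_coordSet {b : ℝ} {S : Set ℝ} (hS : IsCompact S) : IsClosed (coordSet b S) := by
  refine IsClosed.preimage (continuous_coordInv b) ?_
  rw [sphereCompl, compl_compl]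
  exact (hS.image (OnePoint.continuous_coe.comp Complex.continuous_ofReal)).isClosed

/-- Sending the right endpoint to infinity makes the rest of `[a, b]` a ray ending at `(a - b)⁻¹`,
so that the exterior of `[a, b]`, with `∞` included, becomes a slit plane. -/
lemma mem_coordSet_Icc {a b : ℝ} (hab : a < b) {ζ : ℂ} :
    ζ ∈ coordSet b (Icc a b) ↔ ζ ∉ slit (a - b)⁻¹ := by
  have hneg : a - b < 0 := by linarith
  constructor
  · intro h
    obtain ⟨t, rfl, ht0, ht⟩ := exists_ofReal_of_mem_coordSet h
    rw [notMem_slit, Complex.ofReal_im, Complex.ofReal_re]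
    refine ⟨rfl, ?_⟩
    have h1 : t⁻¹ < 0 := lt_of_le_of_ne (by linarith [ht.2]) (inv_ne_zero ht0)
    have h2 : t < 0 := inv_lt_zero.1 h1
    rw [le_inv_of_neg h2 hneg]
    linarith [ht.1]
  · intro h
    obtain ⟨him, hre⟩ := notMem_slit.1 h
    have hζ : ζ = ζ.re := Complex.ext rfl (by simpa using him)
    have h2 : ζ.re < 0 := lt_of_le_of_lt hre (inv_lt_zero.2 hneg)
    rw [hζ, ofReal_mem_coordSet]
    rw [le_inv_of_neg h2 hneg] at hre
    exact ⟨h2.ne, by linarith, by linarith [inv_lt_zero.2 h2]⟩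

section

variable {S : Set ℝ} {b : ℝ} {x : ℂ → OnePoint ℂ}

lemma coordInv_coord_of_mem (hb : b ∈ S) {w : OnePoint ℂ} (hw : w ∈ sphereCompl S) :
    coordInv b (coord b w) = w :=
  coordInv_coord b fun h => hw ⟨b, hb, h.symm⟩

/-- At a finite value `x` avoids `b ∈ S`; where `x = 1 / g` near a pole, the coordinate is `g / (1 -
b * g)`. -/
lemma analyticAt_coord (hb : b ∈ S) (hx : IsNormalizedCovering S x) {z : ℂ} (hz : z ∈ disk) :
    AnalyticAt ℂ (coord b ∘ x) z := by
  obtain ⟨hmaps, -⟩ := hx.covering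
  rcases hx.holomorphic z hz with ⟨f, hf, hfx⟩ | ⟨g, hg, hg0, hgx⟩
  · have hne : f z - b ≠ 0 := sub_ne_zero.2 fun h =>
      hmaps hz ⟨b, hb, by rw [hfx.self_of_nhds, h]⟩
    refine ((hf.sub analyticAt_const).inv hne).congr ?_
    filter_upwards [hfx] with y hy
    simp [hy, coord_coe]
  · have hne : 1 - b * g z ≠ 0 := by simp [hg0]
    refine (hg.div (analyticAt_const.sub (analyticAt_const.mul hg)) hne).congr ?_
    filter_upwards [hgx] with y hy
    rw [Function.comp_apply, hy]
    split_ifs with h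
    · simp [h, coord_infty]
    · rw [coord_coe]
      have : (g y)⁻¹ - b = (1 - b * g y) / g y := by field_simp
      rw [Pi.div_apply, this, inv_div]
      rfl

/-- The slope at `0` is `1 / (z x(z) - z b)`, with limit `1 / r`. -/
lemma exists_hasDerivAt_coord (hx : IsNormalizedCovering S x) :
    ∃ r : ℝ, 0 < r ∧ HasDerivAt (coord b ∘ x) r 0 := by
  obtain ⟨r, hr, hlim⟩ := hx.residue_pos
  have hr' : (r : ℂ) ≠ 0 := by exact_mod_cast hr.ne'
  refine ⟨r⁻¹, by positivity, ?_⟩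
  rw [hasDerivAt_iff_tendsto_slope]
  have h1 : Tendsto (fun z : ℂ => (z * finiteValue (x z) - z * b)⁻¹) (𝓝[≠] 0)
      (𝓝 ((r : ℂ) - 0 * b)⁻¹) := by
    refine Tendsto.inv₀ (hlim.sub ?_) (by simpa using hr')
    exact (tendsto_id.mono_left nhdsWithin_le_nhds).mul_const _
  rw [zero_mul, sub_zero, ← Complex.ofReal_inv] at h1
  refine h1.congr' ?_
  filter_upwards [hlim.eventually_ne hr', self_mem_nhdsWithin] with z hz hz0
  rw [slope_def_field, Function.comp_apply, Function.comp_apply, hx.map_zero, coord_infty,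
    sub_zero, sub_zero]
  have hz0' : z ≠ 0 := hz0
  generalize x z = w at hz ⊢
  induction w using OnePoint.rec with
  | infty => exact (hz (by simp [finiteValue])).elim
  | coe v =>
    rw [coord_coe]
    change (z * v - z * b)⁻¹ = _
    rw [← mul_sub, mul_inv, div_eq_mul_inv, mul_comm]

/-- Lifting and uniqueness transfer from `x`, since `coordInv b` is continuous and inverts `coord b`
away from `b`. -/
lemma IsNormalizedCovering.isRealCovering (hb : b ∈ S) (hS : IsCompact S)
    (hx : IsNormalizedCovering S x) : IsRealCovering (coordSet b S) (coord b ∘ x) := by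
  obtain ⟨hmaps, hcov⟩ := hx.covering
  have hinv : ∀ z ∈ disk, coordInv b (coord b (x z)) = x z := fun z hz =>
    coordInv_coord_of_mem hb (hmaps hz)
  refine ⟨isClosed_coordSet hS, fun e he => ?_, fun z hz =>
    (analyticAt_coord hb hx hz).differentiableAt.differentiableWithinAt, fun z hz h => ?_, ?_, ?_,
    ?_, ?_, exists_hasDerivAt_coord hx⟩
  · obtain ⟨t, rfl, -⟩ := exists_ofReal_of_mem_coordSet he
    exact Complex.ofReal_im t
  · rw [Function.comp_apply, coordSet, mem_preimage, hinv z hz] at h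
    exact h (hmaps hz)
  · intro z hz
    obtain ⟨U, hUo, hzU, hU⟩ := hcov.isLocalHomeomorph.isLocallyInjective ⟨z, hz⟩
    refine ⟨(↑) '' U, (isOpen_disk.isOpenMap_subtype_val U hUo).mem_nhds ⟨_, hzU, rfl⟩, ?_⟩
    rintro _ ⟨u, hu, rfl⟩ _ ⟨v, hv, rfl⟩ huv
    have h1 : x u = x v := by
      rw [← hinv u u.2, ← hinv v v.2]; exact congrArg (coordInv b) huv
    exact congrArg Subtype.val (hU hu hv (Subtype.ext h1))
  · intro A _ _ _ f hf hfE a₀ z₀ hz₀ hξ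
    have hfS : ∀ a, coordInv b (f a) ∈ sphereCompl S := fun a => not_not.1 (hfE a)
    obtain ⟨G, ⟨hG0, hG⟩, -⟩ := hcov.existsUnique_continuousMap_lifts
      (⟨fun a => ⟨coordInv b (f a), hfS a⟩,
        ((continuous_coordInv b).comp hf).subtype_mk _⟩ : C(A, sphereCompl S)) a₀ ⟨z₀, hz₀⟩ (by
        refine Subtype.ext ?_
        change x z₀ = coordInv b (f a₀)
        rw [← hξ, Function.comp_apply, hinv z₀ hz₀])
    refine ⟨fun a => G a, continuous_subtype_val.comp G.continuous, fun a => (G a).2,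
      fun a => ?_, congrArg Subtype.val hG0⟩
    have h1 : x (G a) = coordInv b (f a) := congrArg Subtype.val (congrFun hG a)
    rw [Function.comp_apply, h1, coord_coordInv]
  · intro A _ s hs f g hf hg hfd hgd hfg a₀ ha₀ h0 a ha
    have : PreconnectedSpace s := isPreconnected_iff_preconnectedSpace.1 hs
    have h1 := hcov.eq_of_comp_eq (A := s) (g₁ := fun a => ⟨f a, hfd a.2⟩)
      (g₂ := fun a => ⟨g a, hgd a.2⟩)
      ((continuousOn_iff_continuous_domRestrict.1 hf).subtype_mk _)
      ((continuousOn_iff_continuous_domRestrict.1 hg).subtype_mk _)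
      (by
        funext a
        refine Subtype.ext ?_
        change x (f a) = x (g a)
        rw [← hinv _ (hfd a.2), ← hinv _ (hgd a.2)]
        exact congrArg (coordInv b) (hfg a a.2))
      ⟨a₀, ha₀⟩ (Subtype.ext h0)
    exact congrArg Subtype.val (congrFun h1 ⟨a, ha⟩)
  · rw [Function.comp_apply, hx.map_zero, coord_infty]

lemma IsNormalizedCovering.isSlitCovering {a : ℝ} (hab : a < b) (ha : a ∈ S) (hb : b ∈ S)
    (hS : IsCompact S) (hSab : S ⊆ Icc a b) (hx : IsNormalizedCovering S x) :
    IsSlitCovering (coordSet b S) (a - b)⁻¹ (coord b ∘ x) := by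
  have hneg : a - b < 0 := by linarith
  refine ⟨hx.isRealCovering hb hS, ?_, inv_lt_zero.2 hneg, fun e he => ?_⟩
  · rw [ofReal_mem_coordSet, inv_inv, add_sub_cancel]
    exact ⟨inv_ne_zero hneg.ne, ha⟩
  · obtain ⟨t, rfl, ht0, ht⟩ := exists_ofReal_of_mem_coordSet he
    have h1 : (t : ℂ) ∈ coordSet b (Icc a b) := ofReal_mem_coordSet.2 ⟨ht0, hSab ht⟩
    exact (notMem_slit.1 ((mem_coordSet_Icc hab).1 h1)).2

lemma IsNormalizedCovering.fundamentalDomain_eq {a : ℝ} (hab : a < b) (hb : b ∈ S)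
    (hx : IsNormalizedCovering S x) :
    fundamentalDomain a b x = slitComponent (a - b)⁻¹ (coord b ∘ x) := by
  obtain ⟨hmaps, -⟩ := hx.covering
  rw [fundamentalDomain, slitComponent]
  congr 1
  ext z
  refine and_congr_right fun hz => ?_
  have h := mem_coordSet_Icc hab (ζ := coord b (x z))
  rw [coordSet, mem_preimage, coordInv_coord_of_mem hb (hmaps hz), mem_compl_iff, not_iff_not] at h
  exact h

end

/-! ### The gaps between the bands -/

section

variable {ℓ : ℕ} {α β : Fin (ℓ + 1) → ℝ} (hband : ∀ j, α j < β j)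
  (hgap : ∀ j : Fin ℓ, β j.castSucc < α j.succ)

lemma isCompact_bands (α β : Fin (ℓ + 1) → ℝ) : IsCompact (bands α β) :=
  isCompact_iUnion fun _ => isCompact_Icc

include hband

lemma left_mem_bands (j : Fin (ℓ + 1)) : α j ∈ bands α β :=
  mem_iUnion.2 ⟨j, left_mem_Icc.2 (hband j).le⟩

lemma right_mem_bands (j : Fin (ℓ + 1)) : β j ∈ bands α β :=
  mem_iUnion.2 ⟨j, right_mem_Icc.2 (hband j).le⟩

include hgap

lemma monotone_left : Monotone α :=
  Fin.monotone_iff_le_succ.2 fun i => ((hband _).trans (hgap i)).le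

lemma monotone_right : Monotone β :=
  Fin.monotone_iff_le_succ.2 fun i => ((hgap i).trans (hband _)).le

lemma bands_subset : bands α β ⊆ Icc (α 0) (β (Fin.last ℓ)) :=
  iUnion_subset fun j => Icc_subset_Icc (monotone_left hband hgap (Fin.zero_le j))
    (monotone_right hband hgap (Fin.le_last j))

lemma left_lt_right : α 0 < β (Fin.last ℓ) :=
  (hband 0).trans_le (monotone_right hband hgap (Fin.zero_le _))

omit hband hgap in
lemma exists_gap {u : ℝ} (hu : u ∈ Icc (α 0) (β (Fin.last ℓ))) (hub : u ∉ bands α β) :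
    ∃ i : Fin ℓ, β i.castSucc < u ∧ u < α i.succ := by
  classical
  have hne : (Finset.univ.filter fun j => α j ≤ u).Nonempty :=
    ⟨0, by simpa using hu.1⟩
  set k := (Finset.univ.filter fun j => α j ≤ u).max' hne with hk
  have hkm : α k ≤ u := (Finset.mem_filter.1 (Finset.max'_mem _ hne)).2
  have hku : β k < u := by
    by_contra! h
    exact hub (mem_iUnion.2 ⟨k, hkm, h⟩)
  have hkl : k ≠ Fin.last ℓ := fun h => (h ▸ hku).not_ge hu.2
  obtain ⟨i, hi⟩ := Fin.exists_castSucc_eq.2 hkl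
  refine ⟨i, hi ▸ hku, ?_⟩
  by_contra! h
  have h1 : i.succ ≤ k := Finset.le_max' _ _ (by simpa using h)
  rw [← hi] at h1
  exact h1.not_gt Fin.castSucc_lt_succ

lemma notMem_bands {i : Fin ℓ} {u : ℝ} (h1 : β i.castSucc < u) (h2 : u < α i.succ) :
    u ∉ bands α β := by
  rw [bands, mem_iUnion]
  rintro ⟨j, hj1, hj2⟩
  rcases le_or_gt j i.castSucc with h | h
  · linarith [monotone_right hband hgap h]
  · linarith [monotone_left hband hgap (Fin.castSucc_lt_iff_succ_le.1 h)]

omit hband hgap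

/-- The real number with coordinate `t`. -/
def bandPoint (b t : ℝ) : ℝ := b + t⁻¹

lemma bandPoint_anti {b t t' : ℝ} (h : t ≤ t') (ht' : t' < 0) : bandPoint b t' ≤ bandPoint b t := by
  have := (inv_le_inv_of_neg ht' (h.trans_lt ht')).2 h
  unfold bandPoint
  linarith

lemma bandPoint_mem_Ico {a b t : ℝ} (hab : a < b) (ht : t ≤ (a - b)⁻¹) :
    bandPoint b t ∈ Ico a b := by
  have hneg : a - b < 0 := by linarith
  have ht0 : t < 0 := ht.trans_lt (inv_lt_zero.2 hneg)
  rw [le_inv_of_neg ht0 hneg] at ht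
  unfold bandPoint
  exact ⟨by linarith, by linarith [inv_lt_zero.2 ht0]⟩

lemma notMem_coordSet_iff {b t : ℝ} {S : Set ℝ} (ht : t < 0) :
    (t : ℂ) ∉ coordSet b S ↔ bandPoint b t ∉ S := by
  rw [ofReal_mem_coordSet, not_and]
  exact ⟨fun h => h ht.ne, fun h _ => h⟩

include hband hgap

lemma neg_of_le {t : ℝ} (ht : t ≤ (α 0 - β (Fin.last ℓ))⁻¹) : t < 0 :=
  ht.trans_lt (inv_lt_zero.2 (by linarith [left_lt_right hband hgap]))

lemma exists_gap_of_le {t : ℝ} (ht : t ≤ (α 0 - β (Fin.last ℓ))⁻¹)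
    (htE : (t : ℂ) ∉ coordSet (β (Fin.last ℓ)) (bands α β)) :
    ∃ i : Fin ℓ, β i.castSucc < bandPoint (β (Fin.last ℓ)) t ∧
      bandPoint (β (Fin.last ℓ)) t < α i.succ :=
  exists_gap (Ico_subset_Icc_self (bandPoint_mem_Ico (left_lt_right hband hgap) ht))
    ((notMem_coordSet_iff (neg_of_le hband hgap ht)).1 htE)

lemma sameGap_of_gap {t t' : ℝ} (ht : t < 0) (ht' : t' < 0) {i : Fin ℓ}
    (h1 : β i.castSucc < bandPoint (β (Fin.last ℓ)) t)
    (h2 : bandPoint (β (Fin.last ℓ)) t < α i.succ)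
    (h1' : β i.castSucc < bandPoint (β (Fin.last ℓ)) t')
    (h2' : bandPoint (β (Fin.last ℓ)) t' < α i.succ) :
    SameGap (coordSet (β (Fin.last ℓ)) (bands α β)) t t' := by
  intro s hs
  have hs0 : s < 0 := hs.2.trans_lt (max_lt ht ht')
  rw [notMem_coordSet_iff hs0]
  rcases le_total t t' with h | h
  · rw [uIcc_of_le h] at hs
    exact notMem_bands hband hgap (h1'.trans_le (bandPoint_anti hs.2 ht'))
      ((bandPoint_anti hs.1 hs0).trans_lt h2)
  · rw [uIcc_of_ge h] at hs
    exact notMem_bands hband hgap (h1.trans_le (bandPoint_anti hs.2 ht))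
      ((bandPoint_anti hs.1 hs0).trans_lt h2')

/-- All points in the gap of `t` lie between the same two bands. -/
lemma gap_of_sameGap {t s : ℝ} (ht : t ≤ (α 0 - β (Fin.last ℓ))⁻¹) {i : Fin ℓ}
    (h1 : β i.castSucc < bandPoint (β (Fin.last ℓ)) t)
    (h2 : bandPoint (β (Fin.last ℓ)) t < α i.succ)
    (h : SameGap (coordSet (β (Fin.last ℓ)) (bands α β)) t s) :
    s < 0 ∧ β i.castSucc < bandPoint (β (Fin.last ℓ)) s ∧
      bandPoint (β (Fin.last ℓ)) s < α i.succ := by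
  have hab := left_lt_right hband hgap
  have hneg : α 0 - β (Fin.last ℓ) < 0 := by linarith
  -- Band endpoints are points of the removed set, so their coordinates cannot lie between `t` and
  -- `s`; this is used for the left end of the hull and for the two ends of the gap.
  have key : ∀ v ∈ bands α β, v < β (Fin.last ℓ) → (v - β (Fin.last ℓ))⁻¹ ∉ uIcc t s := by
    intro v hv hvb hmem
    refine h _ hmem (ofReal_mem_coordSet.2 ⟨inv_ne_zero (by linarith), ?_⟩)
    rwa [inv_inv, add_sub_cancel]
  have ht0 := neg_of_le hband hgap ht
  have hsl : s < (α 0 - β (Fin.last ℓ))⁻¹ := by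
    by_contra! hle
    exact key _ (left_mem_bands hband 0) hab (mem_uIcc.2 (Or.inl ⟨ht, hle⟩))
  have hs0 := neg_of_le hband hgap hsl.le
  have hsub := bandPoint_mem_Ico hab hsl.le
  have hval : ∀ v : ℝ, v < β (Fin.last ℓ) → ∀ r < 0,
      ((v - β (Fin.last ℓ))⁻¹ ≤ r ↔ bandPoint (β (Fin.last ℓ)) r ≤ v) := fun v hv r hr => by
    rw [inv_le_of_neg (by linarith) hr, bandPoint]
    constructor <;> intro h <;> linarith
  have hval' : ∀ v : ℝ, v < β (Fin.last ℓ) → ∀ r < 0,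
      (r ≤ (v - β (Fin.last ℓ))⁻¹ ↔ v ≤ bandPoint (β (Fin.last ℓ)) r) := fun v hv r hr => by
    rw [le_inv_of_neg hr (by linarith), bandPoint]
    constructor <;> intro h <;> linarith
  have htb := (bandPoint_mem_Ico hab ht).2
  refine ⟨hs0, ?_, ?_⟩
  · by_contra! hle
    have hv : β i.castSucc < β (Fin.last ℓ) := h1.trans htb
    exact key _ (right_mem_bands hband _) hv (mem_uIcc.2
      (Or.inl ⟨(hval' _ hv _ ht0).2 h1.le, (hval _ hv _ hs0).2 hle⟩))
  · by_contra! hle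
    have hv : α i.succ < β (Fin.last ℓ) := hle.trans_lt hsub.2
    exact key _ (left_mem_bands hband _) hv (mem_uIcc.2
      (Or.inr ⟨(hval' _ hv _ hs0).2 hle, (hval _ hv _ ht0).2 h2.le⟩))

/-! ### Separating functions attached to the bands -/

omit hband hgap

/-- The function `(w - a') / (w - b')` in the coordinate `coord b`. -/
def bandFun (b a' b' : ℝ) (ζ : ℂ) : ℂ := (1 + (b - a') * ζ) / (1 + (b - b') * ζ)

lemma bandFun_denom_ne_zero {b b' : ℝ} {S : Set ℝ} (hb' : b' ∈ S) {ζ : ℂ}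
    (hζ : ζ ∉ coordSet b S) : 1 + (b - b' : ℂ) * ζ ≠ 0 := by
  intro h
  have h0 : ζ ≠ 0 := by rintro rfl; simp at h
  refine hζ (mem_coordSet.2 ⟨h0, b', hb', ?_⟩)
  have : ζ⁻¹ = b' - b := by
    field_simp
    linear_combination h
  rw [this]; ring

lemma differentiableOn_bandFun {b a' b' : ℝ} {S : Set ℝ} (hb' : b' ∈ S) :
    DifferentiableOn ℂ (bandFun b a' b') (coordSet b S)ᶜ :=
  DifferentiableOn.div (by fun_prop) (by fun_prop) fun _ hζ => bandFun_denom_ne_zero hb' hζ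

/-- A value `-m ≤ 0` of `(w - a') / (w - b')` forces `w = (a' + m * b') / (1 + m)`, a point of the
band. -/
lemma bandFun_mem_slitPlane {b a' b' : ℝ} (hab : a' < b') {S : Set ℝ} (hS : Icc a' b' ⊆ S) :
    MapsTo (bandFun b a' b') (coordSet b S)ᶜ Complex.slitPlane := by
  intro ζ hζ
  have hd := bandFun_denom_ne_zero (hS (right_mem_Icc.2 hab.le)) hζ
  by_contra hcon
  rw [Complex.mem_slitPlane_iff, not_or, not_lt, not_not] at hcon
  set m : ℝ := -(bandFun b a' b' ζ).re with hm
  have hm0 : 0 ≤ m := by linarith [hcon.1]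
  have hval : bandFun b a' b' ζ = ((-m : ℝ) : ℂ) := Complex.ext (by simp [hm]) (by simpa using hcon.2)
  rw [bandFun, div_eq_iff hd] at hval
  have h0 : ζ ≠ 0 := by
    rintro rfl
    simp only [mul_zero, add_zero, mul_one] at hval
    have h1 : (1 : ℝ) = -m := by exact_mod_cast hval
    linarith
  have hm1 : 0 < 1 + m := by linarith
  refine hζ (mem_coordSet.2 ⟨h0, (a' + m * b') / (1 + m), hS ⟨?_, ?_⟩, ?_⟩)
  · rw [le_div_iff₀ hm1]; nlinarith
  · rw [div_le_iff₀ hm1]; nlinarith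
  · have hm2 : (1 + m : ℂ) ≠ 0 := by exact_mod_cast hm1.ne'
    push_cast at hval ⊢
    field_simp
    linear_combination hval

lemma bandFun_zero (b a' b' : ℝ) : bandFun b a' b' ((0 : ℝ) : ℂ) = ((1 : ℝ) : ℂ) := by
  simp [bandFun]

lemma bandFun_ofReal {b a' b' t : ℝ} (ht : t ≠ 0) (h : bandPoint b t ≠ b') :
    bandFun b a' b' t = ((1 + (b' - a') / (bandPoint b t - b') : ℝ) : ℂ) := by
  have h1 : bandPoint b t - b' ≠ 0 := sub_ne_zero.2 h
  have h2 : 1 + (b - b') * t ≠ 0 := by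
    intro h3
    apply h1
    rw [bandPoint]
    field_simp
    linarith
  have h3 : (1 + (b - a') * t) / (1 + (b - b') * t) = 1 + (b' - a') / (bandPoint b t - b') := by
    have h4 : bandPoint b t - b' = (1 + (b - b') * t) / t := by
      rw [bandPoint]; field_simp; ring
    rw [h4, div_div_eq_mul_div, div_eq_iff h2, add_mul, one_mul, div_mul_cancel₀ _ h2]
    ring
  rw [← h3, bandFun]
  push_cast
  rfl

lemma icc_subset_bands (α β : Fin (ℓ + 1) → ℝ) (j : Fin (ℓ + 1)) :
    Icc (α j) (β j) ⊆ bands α β := subset_iUnion (fun j => Icc (α j) (β j)) j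

include hband hgap

/-- The band just left of gap `j` lies between the two gaps. Its function exceeds `1` to the right
of the band; to the left, within the hull, it is bounded by its value at `α 0`, which is below `1`.
-/
lemma separated_of_lt {t t' : ℝ} (ht : t ≤ (α 0 - β (Fin.last ℓ))⁻¹)
    (ht' : t' ≤ (α 0 - β (Fin.last ℓ))⁻¹) {i j : Fin ℓ} (hij : i < j)
    (h1 : β i.castSucc < bandPoint (β (Fin.last ℓ)) t)
    (h2 : bandPoint (β (Fin.last ℓ)) t < α i.succ)
    (h1' : β j.castSucc < bandPoint (β (Fin.last ℓ)) t')
    (h2' : bandPoint (β (Fin.last ℓ)) t' < α j.succ) :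
    Separated (coordSet (β (Fin.last ℓ)) (bands α β))
      {s | SameGap (coordSet (β (Fin.last ℓ)) (bands α β)) t s}
      {s | SameGap (coordSet (β (Fin.last ℓ)) (bands α β)) t' s} := by
  set k := j.castSucc with hk
  have hbk := hband k
  have h0k : α 0 ≤ α k := monotone_left hband hgap (Fin.zero_le k)
  refine ⟨bandFun (β (Fin.last ℓ)) (α k) (β k), 1 - (β k - α k) / (β k - α 0), 1,
    differentiableOn_bandFun (right_mem_bands hband k),
    bandFun_mem_slitPlane hbk (icc_subset_bands α β k), ?_, fun s hs _ => ?_, fun s hs _ => ?_⟩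
  · have : 0 < (β k - α k) / (β k - α 0) := div_pos (by linarith) (by linarith)
    linarith
  · obtain ⟨hs0, hs1, hs2⟩ := gap_of_sameGap hband hgap ht h1 h2 hs
    have hik : α i.succ ≤ α k := monotone_left hband hgap
      (Fin.castSucc_lt_iff_succ_le.1 (Fin.castSucc_lt_castSucc_iff.2 hij))
    have h0s : α 0 < bandPoint (β (Fin.last ℓ)) s := by
      linarith [monotone_left hband hgap (Fin.zero_le i.castSucc), hband i.castSucc]
    refine ⟨_, ?_, bandFun_ofReal hs0.ne (by linarith)⟩
    have : (β k - α k) / (bandPoint (β (Fin.last ℓ)) s - β k) =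
        -((β k - α k) / (β k - bandPoint (β (Fin.last ℓ)) s)) := by
      rw [← div_neg, neg_sub]
    rw [this]
    have := div_le_div_of_nonneg_left (a := β k - α k) (by linarith)
      (show 0 < β k - bandPoint (β (Fin.last ℓ)) s by linarith)
      (show β k - bandPoint (β (Fin.last ℓ)) s ≤ β k - α 0 by linarith)
    linarith
  · obtain ⟨hs0, hs1, hs2⟩ := gap_of_sameGap hband hgap ht' h1' h2' hs
    refine ⟨_, ?_, bandFun_ofReal hs0.ne hs1.ne'⟩
    have : 0 < (β k - α k) / (bandPoint (β (Fin.last ℓ)) s - β k) :=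
      div_pos (by linarith) (by linarith)
    linarith

/-- The function of the first band decreases to the right of that band, so the last band leaves room
between its values on a gap and those beyond the hull. At `∞` it is `1`, and to the left of the hull
it is below `1`. -/
lemma separated_outer_gap {t : ℝ} (ht : t ≤ (α 0 - β (Fin.last ℓ))⁻¹) {i : Fin ℓ}
    (h1 : β i.castSucc < bandPoint (β (Fin.last ℓ)) t)
    (h2 : bandPoint (β (Fin.last ℓ)) t < α i.succ) :
    Separated (coordSet (β (Fin.last ℓ)) (bands α β)) (Ioi (α 0 - β (Fin.last ℓ))⁻¹)
      {s | SameGap (coordSet (β (Fin.last ℓ)) (bands α β)) t s} := by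
  have hb0 := hband 0
  have hab := left_lt_right hband hgap
  have hneg : α 0 - β (Fin.last ℓ) < 0 := by linarith
  have h0i : β 0 ≤ β i.castSucc := monotone_right hband hgap (Fin.zero_le _)
  have hil : α i.succ ≤ α (Fin.last ℓ) := monotone_left hband hgap (Fin.le_last _)
  have hll := hband (Fin.last ℓ)
  refine ⟨bandFun (β (Fin.last ℓ)) (α 0) (β 0), 1 + (β 0 - α 0) / (β (Fin.last ℓ) - β 0),
    1 + (β 0 - α 0) / (α (Fin.last ℓ) - β 0),
    differentiableOn_bandFun (right_mem_bands hband 0),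
    bandFun_mem_slitPlane hb0 (icc_subset_bands α β 0), ?_, fun s hs _ => ?_, fun s hs _ => ?_⟩
  · have := div_lt_div_of_pos_left (a := β 0 - α 0) (by linarith)
      (show 0 < α (Fin.last ℓ) - β 0 by linarith)
      (show α (Fin.last ℓ) - β 0 < β (Fin.last ℓ) - β 0 by linarith)
    linarith
  · have hM : 0 < (β 0 - α 0) / (β (Fin.last ℓ) - β 0) := div_pos (by linarith) (by linarith)
    rcases lt_trichotomy s 0 with hs0 | rfl | hs0
    · have hsa : bandPoint (β (Fin.last ℓ)) s < α 0 := by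
        have := (inv_lt_of_neg hneg hs0).1 hs
        unfold bandPoint
        linarith
      refine ⟨_, ?_, bandFun_ofReal hs0.ne (by linarith)⟩
      have : (β 0 - α 0) / (bandPoint (β (Fin.last ℓ)) s - β 0) < 0 :=
        div_neg_of_pos_of_neg (by linarith) (by linarith)
      linarith
    · exact ⟨1, by linarith, bandFun_zero _ _ _⟩
    · have hsb : β (Fin.last ℓ) < bandPoint (β (Fin.last ℓ)) s := by
        have := inv_pos.2 hs0
        unfold bandPoint
        linarith
      refine ⟨_, ?_, bandFun_ofReal hs0.ne' (by linarith)⟩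
      have := div_le_div_of_nonneg_left (a := β 0 - α 0) (by linarith)
        (show 0 < β (Fin.last ℓ) - β 0 by linarith)
        (show β (Fin.last ℓ) - β 0 ≤ bandPoint (β (Fin.last ℓ)) s - β 0 by linarith)
      linarith
  · obtain ⟨hs0, hs1, hs2⟩ := gap_of_sameGap hband hgap ht h1 h2 hs
    refine ⟨_, ?_, bandFun_ofReal hs0.ne (by linarith)⟩
    have := div_le_div_of_nonneg_left (a := β 0 - α 0) (by linarith)
      (show 0 < bandPoint (β (Fin.last ℓ)) s - β 0 by linarith)
      (show bandPoint (β (Fin.last ℓ)) s - β 0 ≤ α (Fin.last ℓ) - β 0 by linarith)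
    linarith

lemma hasSeparatedGaps :
    HasSeparatedGaps (coordSet (β (Fin.last ℓ)) (bands α β)) (α 0 - β (Fin.last ℓ))⁻¹ := by
  refine ⟨⟨range fun i : Fin ℓ => ((β i.castSucc + α i.succ) / 2 - β (Fin.last ℓ))⁻¹,
    finite_range _, fun t ht htE => ?_⟩, fun t ht t' ht' htE htE' hsame => ?_,
    fun t ht htE => ?_⟩
  · obtain ⟨i, h1, h2⟩ := exists_gap_of_le hband hgap ht htE
    have hi := hgap i
    have hil : α i.succ ≤ α (Fin.last ℓ) := monotone_left hband hgap (Fin.le_last _)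
    have hll := hband (Fin.last ℓ)
    refine ⟨_, ⟨i, rfl⟩, sameGap_of_gap hband hgap (neg_of_le hband hgap ht)
      (inv_lt_zero.2 (by linarith)) h1 h2 ?_ ?_⟩
    · rw [bandPoint, inv_inv]; linarith
    · rw [bandPoint, inv_inv]; linarith
  · obtain ⟨i, h1, h2⟩ := exists_gap_of_le hband hgap ht htE
    obtain ⟨j, h1', h2'⟩ := exists_gap_of_le hband hgap ht' htE'
    rcases lt_trichotomy i j with h | rfl | h
    · exact Or.inl (separated_of_lt hband hgap ht ht' h h1 h2 h1' h2')
    · exact absurd (sameGap_of_gap hband hgap (neg_of_le hband hgap ht)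
        (neg_of_le hband hgap ht') h1 h2 h1' h2') hsame
    · exact Or.inr (separated_of_lt hband hgap ht' ht h h1' h2' h1 h2)
  · obtain ⟨i, h1, h2⟩ := exists_gap_of_le hband hgap ht htE
    exact separated_outer_gap hband hgap ht h1 h2

end

end FiniteGap

end

/-! ### The theorem for the bands -/

theorem corollary3p3 (ℓ : ℕ) (α β : Fin (ℓ + 1) → ℝ)
    (hband : ∀ j, α j < β j) (hgap : ∀ j : Fin ℓ, β j.castSucc < α j.succ)
    (x : ℂ → OnePoint ℂ)
    (hx : FiniteGap.IsNormalizedCovering (FiniteGap.bands α β) x) :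
    ∃ A C : ℝ, 0 < A ∧ ∀ m : ℕ,
      FiniteGap.arcLength
          (FiniteGap.remainder (FiniteGap.fundamentalDomain (α 0) (β (Fin.last ℓ)) x) m) ≤
        ENNReal.ofReal (C * Real.exp (-A * m)) := by
  have hab := FiniteGap.left_lt_right hband hgap
  have hb := FiniteGap.right_mem_bands hband (Fin.last ℓ)
  have hcov := hx.isSlitCovering hab (FiniteGap.left_mem_bands hband 0) hb
    (FiniteGap.isCompact_bands α β) (FiniteGap.bands_subset hband hgap)
  rw [hx.fundamentalDomain_eq hab hb]
  exact hcov.exists_arcLength_remainder_le (FiniteGap.hasSeparatedGaps hband hgap)
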